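/- Let $\eta^1,\eta^2,\eta^3$ be the left-invariant coframe of $\mathbb S^3$ with $d\eta^1=-2\eta^2\wedge\eta^3$ (and cyclic permutations). A $U(2)$-invariant metric is $$g=C\Big(\tfrac1{4F}dz^2+F(\eta^1)^2+(\eta^2)^2+(\eta^3)^2\Big),\qquad F=F(z)>0,\ C=C(z)>0\ \text{smooth},$$ on $I\times\mathbb S^3$, $I\subseteq\mathbb R$ open; $s$ is its scalar curvature. For $t\in\mathbb R$ it is called $B^t$-flat if $-4\,Bach+2t\big(\nabla^2s-(\triangle s)g-s\,\mathring{Ric}\big)=0$, where $Bach_{ij}=\nabla^p\nabla^qW_{pijq}+\frac12W_{pijq}Ric^{pq}$ (the Euler–Lagrange equation of $\int|W|^2+t\int s^2$); it is CSC if $s$ is constant. Primes denote $d/dz$. Put $\mathcal L^\pm=(\mp\frac12\frac d{dz}+1)(\mp\frac d{dz}+1)$, $$\mathcal B(F,F)=\big(-\tfrac12F''+\tfrac32F'+F-1\big)\big(\mathcal L^+(F)-1\big)+F'\big(\mathcal L^+(F)\big)',$$ $$\mathcal F_1=24\big(F(C^{1/2})'\big)'+4C^{1/2}\big(F''+\tfrac12F-2\big)+sC^{3/2},$$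 $$\mathcal F_2=\tfrac83\big(\mathcal L^+(\mathcal L^-(F))-1\big)+t\,s\,C^{3/2}\big((C^{-1/2})''-\tfrac14C^{-1/2}\big)+\tfrac t2\tfrac CFF's'+tC's',$$ $$\mathcal T=16\,\mathcal B(F,F)-18tFC's'-6tCF's'-\tfrac34tsC^{-1}\big(C^2(-16+4F+Cs)+12F(C')^2+8CC'F'\big).$$ The reduced system, for three unknown smooth functions $F,C,s$ of $z$ with $F\ne0$ and $C>0$, is $$(CFs')'=0,\qquad\mathcal F_1=0,\qquad\mathcal F_2=0 .\tag{R}$$ 1. For every $t\in\mathbb R$, (R) is critically determined: at each point where $F\neq0$, $C>0$, it is equivalent to prescribing the highest derivatives $(F'''',C'',s'')$ as a smooth function of the eight quantities $(F,F',F'',F''',C,C',s,s')$; any values of these eight quantities at a point $z_0$ with $F\ne0$, $C>0$ are the initial conditions of a solution near $z_0$, and two solutions on an interval containing $z_0$ with the same initial conditions coincide. 2. For every $t\in\mathbb R$, $\mathcal T$ is constant along each solution of (R) on an interval. 3. Let $t\in\mathbb R$, $t\neq0$. For $F>0$, $(F,C,s)$ solves (R) and $\mathcal T=0$ if and only if the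 metric of $F,C$ is $B^t$-flat and $s$ is its scalar curvature. The initial conditions at any $z_0$ of the local solutions of (R) with $\mathcal T=0$ form a nonempty $7$-dimensional embedded smooth submanifold of $\mathbb R^8$, and so do those of the $B^t$-flat metrics. 4. Let $t\ne0$. Homotheties act on the metrics by $(F,C)\mapsto(F(\cdot+a),e^bC(\cdot+a))$, $a,b\in\mathbb R$; call a metric self-homothetic if $F$ is constant and $C=C_0e^{\mu z}$. Identify the metrics defined near $z_0$ with their initial conditions at $z_0$. Up to homothety the $B^t$-flat metrics form a $5$-parameter family, and the CSC $B^t$-flat metrics form a $4$-parameter family. This means, with $k=5$ and $k=4$ respectively: the class is nonempty; its metrics that are not self-homothetic are dense in it; and each such metric belongs to a family $g_u$ of metrics of the class, $u\in V\subseteq\mathbb R^k$ open, with smoothly immersed initial conditions, such that for some $\varepsilon>0$ the map sending $(u,a,b)\in V\times(-\varepsilon,\varepsilon)^2$ to the metric $g_u$ translated by $a$ and multiplied by $e^b$ is a homeomorphism onto an open subset of the class. 5. Let $t\ne0$. There is a CSC $B^t$-flat metric, on some $I\times\mathbb S^3$ with $I$ an open interval, such that no metric $K\big(\tfrac1{4F}dz^2+F(\eta^1)^2+(\eta^2)^2+(\eta^3)^2\big)$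 with the same $F$ and smooth $K=K(z)>0$ on $I$ is extremal Kähler for one of the complex structures $J^\pm$, $J^\pm\partial_z=\pm\frac1{2F}e_1$, $J^\pm e_2=e_3$, where $e_i$ is the frame dual to $\eta^i$ (extremal Kähler: $J$ is parallel and $J\nabla s$ is Killing). -/

import Mathlib

open Set
open scoped ContDiff

noncomputable section

namespace U2

/-! ## The metric `g = C (dz² / (4F) + F (η¹)² + (η²)² + (η³)²)` on `I × S³`

Everything is expressed in the frame `E₀ = ∂/∂z, E₁ = e₁, E₂ = e₂, E₃ = e₃`, where `e₁, e₂, e₃` is the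
left-invariant frame of `S³ = SU(2)` dual to `η¹, η², η³` with
`dη¹ = -2 η² ∧ η³` and its cyclic permutations.  The metric is invariant under the left action, so
the components of all tensors derived from it are functions of `z` alone. -/

/-- The diagonal entries of the metric in the frame `E₀, E₁, E₂, E₃`. -/
def gDiag (F C : ℝ → ℝ) (a : Fin 4) (z : ℝ) : ℝ :=
  ![C z / (4 * F z), C z * F z, C z, C z] a

/-- The metric components `g(E_a, E_b)`. -/
def g (F C : ℝ → ℝ) (a b : Fin 4) (z : ℝ) : ℝ :=
  if a = b then gDiag F C a z else 0

/-- The components of the inverse metric. -/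
def gInv (F C : ℝ → ℝ) (a b : Fin 4) (z : ℝ) : ℝ :=
  if a = b then (gDiag F C a z)⁻¹ else 0

/-- The derivative `E_a f` of a function `f = f(z)`. -/
def D (a : Fin 4) (f : ℝ → ℝ) (z : ℝ) : ℝ :=
  if a = 0 then deriv f z else 0

/-- The structure constants of the frame, `[E_a, E_b] = ∑ k, bracket a b k • E_k`:
`[e₁, e₂] = 2 e₃`, `[e₂, e₃] = 2 e₁`, `[e₃, e₁] = 2 e₂`, and `E₀` commutes with all the others. -/
def bracket (a b k : Fin 4) : ℝ :=
  if (a = 1 ∧ b = 2 ∧ k = 3) ∨ (a = 2 ∧ b = 3 ∧ k = 1) ∨ (a = 3 ∧ b = 1 ∧ k = 2) then 2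
  else if (a = 2 ∧ b = 1 ∧ k = 3) ∨ (a = 3 ∧ b = 2 ∧ k = 1) ∨ (a = 1 ∧ b = 3 ∧ k = 2) then -2
  else 0

/-- `g(∇_{E_a} E_b, E_c)` for the Levi-Civita connection, by the Koszul formula. -/
def connLower (F C : ℝ → ℝ) (a b c : Fin 4) (z : ℝ) : ℝ :=
  (D a (g F C b c) z + D b (g F C a c) z - D c (g F C a b) z
    + ∑ l, (bracket a b l * g F C l c z - bracket a c l * g F C l b z
      - bracket b c l * g F C l a z)) / 2

/-- The connection coefficients, `∇_{E_a} E_b = ∑ k, conn a b k • E_k`. -/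
def conn (F C : ℝ → ℝ) (a b k : Fin 4) (z : ℝ) : ℝ :=
  ∑ c, connLower F C a b c z * gInv F C c k z

/-- The curvature components, `R(E_a, E_b) E_c = ∑ k, curvUp a b c k • E_k`, where
`R(X, Y) = ∇_X ∇_Y - ∇_Y ∇_X - ∇_{[X, Y]}`. -/
def curvUp (F C : ℝ → ℝ) (a b c k : Fin 4) (z : ℝ) : ℝ :=
  D a (conn F C b c k) z - D b (conn F C a c k) z
    + ∑ m, (conn F C b c m z * conn F C a m k z - conn F C a c m z * conn F C b m k z
      - bracket a b m * conn F C m c k z)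

/-- The Riemann tensor `Rm_{abcd} = g(R(E_a, E_b) E_c, E_d)`; sectional curvatures are
`Rm_{abba}` in an orthonormal frame. -/
def riem (F C : ℝ → ℝ) (a b c d : Fin 4) (z : ℝ) : ℝ :=
  ∑ k, curvUp F C a b c k z * g F C k d z

/-- The Ricci tensor. -/
def ric (F C : ℝ → ℝ) (i j : Fin 4) (z : ℝ) : ℝ :=
  ∑ p, ∑ q, gInv F C p q z * riem F C p i j q z

/-- The scalar curvature. -/
def scal (F C : ℝ → ℝ) (z : ℝ) : ℝ :=
  ∑ i, ∑ j, gInv F C i j z * ric F C i j z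

/-- The Weyl tensor (in dimension four). -/
def weyl (F C : ℝ → ℝ) (a b c d : Fin 4) (z : ℝ) : ℝ :=
  riem F C a b c d z
    - (g F C a d z * ric F C b c z + g F C b c z * ric F C a d z
        - g F C a c z * ric F C b d z - g F C b d z * ric F C a c z) / 2
    + scal F C z / 6 * (g F C a d z * g F C b c z - g F C a c z * g F C b d z)

/-- Covariant derivative of a covector field, `(∇_{E_a} θ)(E_b)`. -/
def covDeriv1 (F C : ℝ → ℝ) (θ : Fin 4 → ℝ → ℝ) (a b : Fin 4) (z : ℝ) : ℝ :=
  D a (θ b) z - ∑ m, conn F C a b m z * θ m z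

/-- Covariant derivative of a `(0,2)`-tensor, `(∇_{E_a} T)(E_b, E_c)`. -/
def covDeriv2 (F C : ℝ → ℝ) (T : Fin 4 → Fin 4 → ℝ → ℝ) (a b c : Fin 4) (z : ℝ) : ℝ :=
  D a (T b c) z - ∑ m, (conn F C a b m z * T m c z + conn F C a c m z * T b m z)

/-- Covariant derivative of a `(0,3)`-tensor, `(∇_{E_a} T)(E_b, E_c, E_d)`. -/
def covDeriv3 (F C : ℝ → ℝ) (T : Fin 4 → Fin 4 → Fin 4 → ℝ → ℝ) (a b c d : Fin 4) (z : ℝ) : ℝ :=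
  D a (T b c d) z - ∑ m, (conn F C a b m z * T m c d z + conn F C a c m z * T b m d z
    + conn F C a d m z * T b c m z)

/-- Covariant derivative of a `(0,4)`-tensor, `(∇_{E_a} T)(E_b, E_c, E_d, E_e)`. -/
def covDeriv4 (F C : ℝ → ℝ) (T : Fin 4 → Fin 4 → Fin 4 → Fin 4 → ℝ → ℝ)
    (a b c d e : Fin 4) (z : ℝ) : ℝ :=
  D a (T b c d e) z - ∑ m, (conn F C a b m z * T m c d e z + conn F C a c m z * T b m d e z
    + conn F C a d m z * T b c m e z + conn F C a e m z * T b c d m z)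

/-- The divergence `∇^q W_{bcdq}` of the Weyl tensor. -/
def divWeyl (F C : ℝ → ℝ) (b c d : Fin 4) (z : ℝ) : ℝ :=
  ∑ p, ∑ q, gInv F C p q z * covDeriv4 F C (weyl F C) p b c d q z

/-- The Bach tensor `Bach_{ij} = ∇^p ∇^q W_{pijq} + ½ W_{pijq} Ric^{pq}`. -/
def bach (F C : ℝ → ℝ) (i j : Fin 4) (z : ℝ) : ℝ :=
  ∑ p, ∑ q, gInv F C p q z * covDeriv3 F C (divWeyl F C) q p i j z
    + (∑ p, ∑ q, ∑ k, ∑ l, gInv F C p k z * gInv F C q l z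
        * weyl F C p i j q z * ric F C k l z) / 2

/-- The Hessian `∇² f` of a function `f = f(z)`. -/
def hess (F C : ℝ → ℝ) (f : ℝ → ℝ) (i j : Fin 4) (z : ℝ) : ℝ :=
  covDeriv1 F C (fun b => D b f) i j z

/-- The Laplacian `△ f` of a function `f = f(z)`. -/
def lap (F C : ℝ → ℝ) (f : ℝ → ℝ) (z : ℝ) : ℝ :=
  ∑ i, ∑ j, gInv F C i j z * hess F C f i j z

/-- The trace-free Ricci tensor. -/
def ricTF (F C : ℝ → ℝ) (i j : Fin 4) (z : ℝ) : ℝ :=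
  ric F C i j z - scal F C z / 4 * g F C i j z

/-- The Euler-Lagrange tensor `-4 Bach + 2 t (∇² s - (△ s) g - s Ric₀)` of
`∫ |W|² + t ∫ s²`. -/
def btTensor (t : ℝ) (F C : ℝ → ℝ) (i j : Fin 4) (z : ℝ) : ℝ :=
  -4 * bach F C i j z + t * (2 * (hess F C (scal F C) i j z
    - lap F C (scal F C) z * g F C i j z - scal F C z * ricTF F C i j z))

/-- `F`, `C` define a smooth Riemannian metric `C (dz² / (4F) + F (η¹)² + (η²)² + (η³)²)` on
`I × S³`, `I` open. -/
def IsMetricOn (F C : ℝ → ℝ) (I : Set ℝ) : Prop :=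
  IsOpen I ∧ ContDiffOn ℝ ∞ F I ∧ ContDiffOn ℝ ∞ C I ∧ ∀ z ∈ I, 0 < F z ∧ 0 < C z

/-- The metric of `F`, `C` is `B^t`-flat on `I × S³`. -/
def IsBtFlat (t : ℝ) (F C : ℝ → ℝ) (I : Set ℝ) : Prop :=
  IsMetricOn F C I ∧ ∀ z ∈ I, ∀ i j, btTensor t F C i j z = 0

/-- The metric of `F`, `C` has constant scalar curvature and is `B^t`-flat on `I × S³`. -/
def IsCSCBtFlat (t : ℝ) (F C : ℝ → ℝ) (I : Set ℝ) : Prop :=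
  IsBtFlat t F C I ∧ ∃ c, ∀ z ∈ I, scal F C z = c

/-! ## Extremal Kähler metrics -/

/-- The complex structures `J^±` (`ε = 1` and `ε = -1`), `J E_a = ∑ b, cxStr ε F a b • E_b`:
`J ∂_z = ε/(2F) e₁`, `J e₁ = -2εF ∂_z`, `J e₂ = e₃`, `J e₃ = -e₂`. -/
def cxStr (ε : ℝ) (F : ℝ → ℝ) (a b : Fin 4) (z : ℝ) : ℝ :=
  !![0, ε / (2 * F z), 0, 0; -2 * ε * F z, 0, 0, 0; 0, 0, 0, 1; 0, 0, -1, 0] a b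

/-- The fundamental form `ω^±(E_a, E_b) = g(J^± E_a, E_b)`. -/
def kForm (ε : ℝ) (F C : ℝ → ℝ) (a b : Fin 4) (z : ℝ) : ℝ :=
  ∑ c, cxStr ε F a c z * g F C c b z

/-- The covector field dual to the vector field `J^± ∇s`, with `s` the scalar curvature. -/
def jGradScal (ε : ℝ) (F C : ℝ → ℝ) (b : Fin 4) (z : ℝ) : ℝ :=
  ∑ a, ∑ c, gInv F C a c z * D c (scal F C) z * kForm ε F C a b z

/-- The metric of `F`, `C` is extremal Kähler for `J^ε`: the form `ω^ε` is parallel and the vector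
field `J^ε ∇s` is Killing. -/
def IsExtremalKahler (ε : ℝ) (F C : ℝ → ℝ) (I : Set ℝ) : Prop :=
  IsMetricOn F C I ∧
    (∀ z ∈ I, ∀ a b c, covDeriv2 F C (kForm ε F C) a b c z = 0) ∧
    ∀ z ∈ I, ∀ a b, covDeriv1 F C (jGradScal ε F C) a b z
      + covDeriv1 F C (jGradScal ε F C) b a z = 0

/-- The metric of `F`, `C` is conformal to an extremal Kähler metric: some `K (dz² / (4F) + ...)`
with another conformal factor `K = K(z) > 0` is extremal Kähler for `J^+` or `J^-`. -/
def IsConformallyExtremal (F : ℝ → ℝ) (I : Set ℝ) : Prop :=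
  ∃ K : ℝ → ℝ, IsExtremalKahler 1 F K I ∨ IsExtremalKahler (-1) F K I

/-! ## The reduced system -/

/-- `L^+ F = (-½ d/dz + 1)(-d/dz + 1) F`. -/
def Lplus (F : ℝ → ℝ) : ℝ → ℝ :=
  (fun G z => -(1 / 2) * deriv G z + G z) (fun z => -deriv F z + F z)

/-- `L^- F = (½ d/dz + 1)(d/dz + 1) F`. -/
def Lminus (F : ℝ → ℝ) : ℝ → ℝ :=
  (fun G z => 1 / 2 * deriv G z + G z) (fun z => deriv F z + F z)

/-- The third-order operator
`B(F, F) = (-½ F'' + 3/2 F' + F - 1)(L^+ F - 1) + F' (L^+ F)'`. -/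
def opB (F : ℝ → ℝ) (z : ℝ) : ℝ :=
  (-(1 / 2) * deriv (deriv F) z + 3 / 2 * deriv F z + F z - 1) * (Lplus F z - 1)
    + deriv F z * deriv (Lplus F) z

/-- `(C F s')'`. -/
def opE (F C s : ℝ → ℝ) (z : ℝ) : ℝ :=
  deriv (fun x => C x * F x * deriv s x) z

/-- `24 (F (C^{1/2})')' + 4 C^{1/2} (F'' + F/2 - 2) + s C^{3/2}`. -/
def opF1 (F C s : ℝ → ℝ) (z : ℝ) : ℝ :=
  24 * deriv (fun x => F x * deriv (fun y => √(C y)) x) z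
    + 4 * √(C z) * (deriv (deriv F) z + 1 / 2 * F z - 2) + s z * √(C z) ^ 3

/-- `8/3 (L^+ L^- F - 1) + t s C^{3/2} ((C^{-1/2})'' - C^{-1/2}/4)
+ (t/2) (C/F) F' s' + t C' s'`. -/
def opF2 (t : ℝ) (F C s : ℝ → ℝ) (z : ℝ) : ℝ :=
  8 / 3 * (Lplus (Lminus F) z - 1)
    + t * s z * √(C z) ^ 3 * (deriv (deriv fun y => (√(C y))⁻¹) z - 1 / 4 * (√(C z))⁻¹)
    + t / 2 * (C z / F z) * deriv F z * deriv s z + t * deriv C z * deriv s z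

/-- The conserved quantity `16 B(F, F) - 18 t F C' s' - 6 t C F' s'
- (3/4) t s C⁻¹ (C² (-16 + 4F + C s) + 12 F C'² + 8 C C' F')`. -/
def opT (t : ℝ) (F C s : ℝ → ℝ) (z : ℝ) : ℝ :=
  16 * opB F z - 18 * t * F z * deriv C z * deriv s z - 6 * t * C z * deriv F z * deriv s z
    - 3 / 4 * t * s z * (C z)⁻¹ * (C z ^ 2 * (-16 + 4 * F z + C z * s z)
      + 12 * F z * deriv C z ^ 2 + 8 * C z * deriv C z * deriv F z)

/-- `(F, C, s)` is a smooth solution on the open set `I` of the reduced system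
`(C F s')' = 0`, `F₁(F, C) = 0`, `F₂(F, C) = 0`, with `F ≠ 0` and `C > 0`
(so that `C^{1/2}` makes sense and `C ≠ 0`). -/
def SolvesReduced (t : ℝ) (F C s : ℝ → ℝ) (I : Set ℝ) : Prop :=
  IsOpen I ∧ ContDiffOn ℝ ∞ F I ∧ ContDiffOn ℝ ∞ C I ∧ ContDiffOn ℝ ∞ s I ∧
    (∀ z ∈ I, F z ≠ 0 ∧ 0 < C z) ∧
    ∀ z ∈ I, opE F C s z = 0 ∧ opF1 F C s z = 0 ∧ opF2 t F C s z = 0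

/-! ## Initial data and parameter counts -/

/-- The eight initial conditions `F, F', F'', F''', C, C', s, s'` at `z`. -/
def cauchyData (F C s : ℝ → ℝ) (z : ℝ) : Fin 8 → ℝ :=
  ![F z, deriv F z, deriv (deriv F) z, deriv (deriv (deriv F)) z, C z, deriv C z, s z, deriv s z]

/-- The admissible initial conditions: `F ≠ 0` and `C > 0`. -/
def admissible : Set (Fin 8 → ℝ) := {p | p 0 ≠ 0 ∧ 0 < p 4}

/-- The initial conditions at `z` of a metric, `s` being its scalar curvature. -/
def metricData (F C : ℝ → ℝ) (z : ℝ) : Fin 8 → ℝ := cauchyData F C (scal F C) z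

/-- The initial conditions at `z₀` of the local solutions of the reduced system with `T = 0`. -/
def reducedDataSet (t z₀ : ℝ) : Set (Fin 8 → ℝ) :=
  {p | ∃ ε > 0, ∃ F C s : ℝ → ℝ, SolvesReduced t F C s (Ioo (z₀ - ε) (z₀ + ε)) ∧
    (∀ z ∈ Ioo (z₀ - ε) (z₀ + ε), opT t F C s z = 0) ∧ cauchyData F C s z₀ = p}

/-- The initial conditions at `z₀` of the metrics of a class `P` which are defined near `z₀`. -/
def dataSet (P : (ℝ → ℝ) → (ℝ → ℝ) → Set ℝ → Prop) (z₀ : ℝ) : Set (Fin 8 → ℝ) :=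
  {p | ∃ ε > 0, ∃ F C : ℝ → ℝ, P F C (Ioo (z₀ - ε) (z₀ + ε)) ∧ metricData F C z₀ = p}

/-- The metrics on which translations in `z` act by homotheties: `F` is constant and
`C = C₀ e^{μ z}`. -/
def SelfHomothetic (F C : ℝ → ℝ) (I : Set ℝ) : Prop :=
  ∃ c C₀ μ : ℝ, ∀ z ∈ I, F z = c ∧ C z = C₀ * Real.exp (μ * z)

/-- The initial conditions at `z₀` of the metrics of a class `P` which are defined near `z₀` and
are not self-homothetic. -/
def regularDataSet (P : (ℝ → ℝ) → (ℝ → ℝ) → Set ℝ → Prop) (z₀ : ℝ) : Set (Fin 8 → ℝ) :=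
  {p | ∃ ε > 0, ∃ F C : ℝ → ℝ, P F C (Ioo (z₀ - ε) (z₀ + ε)) ∧ metricData F C z₀ = p ∧
    ¬ SelfHomothetic F C (Ioo (z₀ - ε) (z₀ + ε))}

/-- `S` is an embedded smooth submanifold of `ℝ⁸` of dimension `d` and codimension `e`. -/
def IsSubmanifold (d e : ℕ) (S : Set (Fin 8 → ℝ)) : Prop :=
  ∀ p ∈ S, ∃ φ : OpenPartialHomeomorph (Fin 8 → ℝ) ((Fin d → ℝ) × (Fin e → ℝ)),
    p ∈ φ.source ∧ ContDiffOn ℝ ∞ φ φ.source ∧ ContDiffOn ℝ ∞ φ.symm φ.target ∧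
      ∀ q ∈ φ.source, q ∈ S ↔ (φ q).2 = 0

/-- The initial conditions at `z₀` of the metric obtained from that of `F`, `C` by the homothety
consisting of the translation by `a` in `z` and multiplication by `e^b`. -/
def homothetyData (F C : ℝ → ℝ) (z₀ a b : ℝ) : Fin 8 → ℝ :=
  metricData (fun z => F (z + a)) (fun z => Real.exp b * C (z + a)) z₀

/-- Up to homothety, the metrics of the class `P` form a `k`-parameter family: the metrics near any
metric of the class that is not self-homothetic are, up to small homotheties, parametrized without
repetition by an open subset of `ℝᵏ`.  In detail, near `z₀` there is a family of metrics `g_u`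
in the class, with parameters `u` in an open set `V ⊆ ℝᵏ`, whose initial conditions are
immersed smoothly, which contains the given metric, and such that `(u, a, b) ↦` (the metric `g_u`
translated by `a` and multiplied by `e^b`) is a homeomorphism from `V × (-ε, ε) × (-ε, ε)` onto a
neighbourhood of the given metric in the class, metrics being identified with their initial
conditions at `z₀`. Moreover, the class is not empty and the metrics that are not self-homothetic
are dense in it. -/
def IsFamilyUpToHomothety (k : ℕ) (P : (ℝ → ℝ) → (ℝ → ℝ) → Set ℝ → Prop) (z₀ : ℝ) : Prop :=
  (dataSet P z₀).Nonempty ∧ dataSet P z₀ ⊆ closure (regularDataSet P z₀) ∧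
  ∀ p ∈ regularDataSet P z₀, ∃ ε > 0, ∃ V : Set (Fin k → ℝ), IsOpen V ∧
    ∃ F C : (Fin k → ℝ) → ℝ → ℝ,
      (∀ u ∈ V, P (F u) (C u) (Ioo (z₀ - ε) (z₀ + ε))) ∧
      (∃ u ∈ V, metricData (F u) (C u) z₀ = p) ∧
      ContDiffOn ℝ ∞ (fun u => metricData (F u) (C u) z₀) V ∧
      (∀ u ∈ V, Function.Injective (fderiv ℝ (fun u => metricData (F u) (C u) z₀) u)) ∧
      Topology.IsEmbedding ((V ×ˢ Ioo (-ε) ε ×ˢ Ioo (-ε) ε).domRestrict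
        fun x : (Fin k → ℝ) × ℝ × ℝ => homothetyData (F x.1) (C x.1) z₀ x.2.1 x.2.2) ∧
      ∃ U : Set (Fin 8 → ℝ), IsOpen U ∧
        (fun x : (Fin k → ℝ) × ℝ × ℝ => homothetyData (F x.1) (C x.1) z₀ x.2.1 x.2.2) ''
          (V ×ˢ Ioo (-ε) ε ×ˢ Ioo (-ε) ε) = U ∩ dataSet P z₀

end U2

end

/-!
The connection respects the grading of the frame by the Klein four-group, hence so does every tensor
derived from the metric, and the Bach tensor, the Ricci tensor and the Hessian of `s` are diagonal.
The equation `F₁ = 0` says that `s` is the scalar curvature. The components of the `B^t`-tensor are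
combinations of `T`, `F₂` and `(C F s')'`, and vanish simultaneously exactly when these three do.

Solved for its highest derivatives, the reduced system is a vector field on `{F ≠ 0, C > 0} ⊆ ℝ⁸`
that preserves `T` and `C F s'`. On `F > 0` the `B^t`-flat metrics form the level set `T = 0`, and
those of constant scalar curvature its intersection with `C F s' = 0`. Translations act on initial
conditions by the flow and multiplication by `e^b` acts by a linear rescaling. The generators of the
two actions are linearly independent precisely off the self-homothetic metrics, and there a slice
transverse to both is a local family up to homothety.

For an extremal Kähler metric, parallelism of the Kähler form forces `K' = ∓K`, and the Killing
condition then forces `s'' = ∓s'`. Together these give `L⁺ L⁻ F = 1`, which does not involve `K` and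
fails for some `B^t`-flat metric of constant scalar curvature.
-/

noncomputable section

namespace U2

/-! ## Integral curves and flows -/

section IntegralCurves

variable {E G : Type*} [NormedAddCommGroup E] [NormedSpace ℝ E] [NormedAddCommGroup G]
  [NormedSpace ℝ G]

/-- `y` is an integral curve of the vector field `v` on the open set `I`, with values in `S`. -/
structure IsIntegralCurveIn (v : E → E) (S : Set E) (y : ℝ → E) (I : Set ℝ) : Prop where
  isOpen : IsOpen I
  mapsTo : MapsTo y I S
  hasDerivAt : ∀ z ∈ I, HasDerivAt y (v (y z)) z

variable {v : E → E} {S S' : Set E} {y y' : ℝ → E} {I : Set ℝ} {z z₀ : ℝ}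

namespace IsIntegralCurveIn

lemma mono (hy : IsIntegralCurveIn v S y I) (h : S ⊆ S') : IsIntegralCurveIn v S' y I :=
  ⟨hy.isOpen, hy.mapsTo.mono_right h, hy.hasDerivAt⟩

lemma contDiffAt [CompleteSpace E] (hv : ContDiffOn ℝ ∞ v S) (hy : IsIntegralCurveIn v S y I)
    (hz : z ∈ I) : ContDiffAt ℝ ∞ y z := by
  obtain ⟨ε, hε, hsub⟩ := Metric.nhds_basis_closedBall.mem_iff.1 (hy.isOpen.mem_nhds hz)
  rw [Real.closedBall_eq_Icc] at hsub
  have hsmooth : ContDiffOn ℝ ∞ y (Icc (z - ε) (z + ε)) :=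
    ODE.contDiffOn_enat_Icc_of_hasDerivWithinAt (f := fun _ => v) (n := ⊤) (u := S)
      (hv.comp contDiff_snd.contDiffOn fun _ hx => hx.2)
      (fun x hx => (hy.hasDerivAt x (hsub hx)).hasDerivWithinAt) fun x hx => hy.mapsTo (hsub hx)
  exact hsmooth.contDiffAt (Icc_mem_nhds (by linarith) (by linarith))

lemma eventuallyEq (hS : IsOpen S) (hv : ContDiffOn ℝ 1 v S) (hy : IsIntegralCurveIn v S y I)
    (hy' : IsIntegralCurveIn v S y' I) (hz : z ∈ I) (heq : y z = y' z) : y =ᶠ[nhds z] y' := by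
  obtain ⟨K, s, hs, hLip⟩ :=
    (hv.contDiffAt (hS.mem_nhds (hy.mapsTo hz))).exists_lipschitzOnWith
  refine ODE_solution_unique_of_eventually (v := fun _ => v) (s := fun _ => s) (K := K)
    (Filter.Eventually.of_forall fun _ => hLip) ?_ ?_ heq
  · filter_upwards [hy.isOpen.mem_nhds hz, (hy.hasDerivAt z hz).continuousAt.eventually_mem hs]
      with x hx hxs using ⟨hy.hasDerivAt x hx, hxs⟩
  · filter_upwards [hy.isOpen.mem_nhds hz,
      (hy'.hasDerivAt z hz).continuousAt.eventually_mem (heq ▸ hs)]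
      with x hx hxs using ⟨hy'.hasDerivAt x hx, hxs⟩

theorem eqOn (hS : IsOpen S) (hv : ContDiffOn ℝ 1 v S) (hI : IsPreconnected I)
    (hy : IsIntegralCurveIn v S y I) (hy' : IsIntegralCurveIn v S y' I) (hz₀ : z₀ ∈ I)
    (heq : y z₀ = y' z₀) : EqOn y y' I := by
  have hopen : IsOpen {z ∈ I | y z = y' z} := by
    refine isOpen_iff_mem_nhds.2 fun z hz => ?_
    filter_upwards [hy.isOpen.mem_nhds hz.1, hy.eventuallyEq hS hv hy' hz.1 hz.2]
      with x hx hxeq using ⟨hx, hxeq⟩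
  have hopen' : IsOpen {z ∈ I | y z ≠ y' z} := by
    refine isOpen_iff_mem_nhds.2 fun z hz => ?_
    have hne := ((hy.hasDerivAt z hz.1).continuousAt.sub
      (hy'.hasDerivAt z hz.1).continuousAt).eventually_ne (sub_ne_zero.2 hz.2)
    filter_upwards [hy.isOpen.mem_nhds hz.1, hne] with x hx hxne using ⟨hx, sub_ne_zero.1 hxne⟩
  intro w hw
  by_contra hne
  obtain ⟨x, -, hxeq, hxne⟩ := hI _ _ hopen hopen'
    (fun x hx => (em (y x = y' x)).imp (⟨hx, ·⟩) (⟨hx, ·⟩)) ⟨z₀, hz₀, hz₀, heq⟩ ⟨w, hw, hw, hne⟩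
  exact hxne.2 hxeq.2

lemma comp_eq_comp {Q : E → G} (hQ : ∀ p ∈ S, DifferentiableAt ℝ Q p)
    (hQv : ∀ p ∈ S, fderiv ℝ Q p (v p) = 0) (hI : IsPreconnected I)
    (hy : IsIntegralCurveIn v S y I) (hz : z ∈ I) (hz₀ : z₀ ∈ I) : Q (y z) = Q (y z₀) := by
  have hderiv (x : ℝ) (hx : x ∈ I) : HasDerivAt (fun x => Q (y x)) 0 x :=
    hQv _ (hy.mapsTo hx) ▸
      (hQ _ (hy.mapsTo hx)).hasFDerivAt.comp_hasDerivAt x (hy.hasDerivAt x hx)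
  exact hy.isOpen.is_const_of_deriv_eq_zero hI
    (fun x hx => (hderiv x hx).differentiableAt.differentiableWithinAt)
    (fun x hx => (hderiv x hx).deriv) hz hz₀

lemma comp_sub_const {δ : ℝ} (hy : IsIntegralCurveIn v S y (Ioo (-δ) δ)) (z₀ : ℝ) :
    IsIntegralCurveIn v S (fun z => y (z - z₀)) (Ioo (z₀ - δ) (z₀ + δ)) := by
  have hmem {z : ℝ} (hz : z ∈ Ioo (z₀ - δ) (z₀ + δ)) : z - z₀ ∈ Ioo (-δ) δ := by
    constructor <;> linarith [hz.1, hz.2]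
  exact ⟨isOpen_Ioo, fun _ hz => hy.mapsTo (hmem hz),
    fun z hz => (hy.hasDerivAt _ (hmem hz)).comp_sub_const z z₀⟩

end IsIntegralCurveIn

lemma exists_isIntegralCurveIn [CompleteSpace E] (hS : IsOpen S) (hv : ContDiffOn ℝ 1 v S) {p : E}
    (hp : p ∈ S) (z₀ : ℝ) :
    ∃ ε > 0, ∃ y : ℝ → E, y z₀ = p ∧ IsIntegralCurveIn v S y (Ioo (z₀ - ε) (z₀ + ε)) := by
  obtain ⟨y, hy₀, ε, hε, hy⟩ := (hv.contDiffAt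
    (hS.mem_nhds hp)).exists_forall_mem_closedBall_exists_eq_forall_mem_Ioo_hasDerivAt₀ z₀
  have hcont : ContinuousAt y z₀ := (hy z₀ ⟨by linarith, by linarith⟩).continuousAt
  obtain ⟨δ, hδ, hball⟩ := Metric.eventually_nhds_iff_ball.1
    (hcont.eventually_mem (hS.mem_nhds (hy₀ ▸ hp)))
  rw [Real.ball_eq_Ioo] at hball
  refine ⟨min ε δ, lt_min hε hδ, y, hy₀, isOpen_Ioo, fun z hz => hball z ?_, fun z hz => hy z ?_⟩
  · constructor <;> [linarith [hz.1, min_le_right ε δ]; linarith [hz.2, min_le_right ε δ]]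
  · constructor <;> [linarith [hz.1, min_le_left ε δ]; linarith [hz.2, min_le_left ε δ]]

/-- `α (x, s)` is, for `x ∈ N` and `|s| < ε`, the position at time `s` of the integral curve of `v`
which starts at `x`. -/
structure IsLocalFlow (v : E → E) (α : E × ℝ → E) (N : Set E) (ε : ℝ) : Prop where
  map_zero : ∀ x ∈ N, α (x, 0) = x
  hasDerivAt : ∀ x ∈ N, ∀ s ∈ Ioo (-ε) ε, HasDerivAt (fun s => α (x, s)) (v (α (x, s))) s

variable {α : E × ℝ → E} {p : E} {c ε : ℝ} {K L : NNReal} {U N : Set E}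

lemma IsLocalFlow.mono {N' : Set E} {ε' : ℝ} (hα : IsLocalFlow v α N ε) (hN : N' ⊆ N)
    (hε : ε' ≤ ε) : IsLocalFlow v α N' ε' :=
  ⟨fun x hx => hα.map_zero x (hN hx), fun x hx s hs =>
    hα.hasDerivAt x (hN hx) s ⟨by linarith [hs.1], by linarith [hs.2]⟩⟩

lemma IsLocalFlow.norm_sub_sub_le (hα : IsLocalFlow v α N ε) (hvU : LipschitzOnWith K v U)
    (hαL : ∀ s ∈ Ioo (-ε) ε, LipschitzOnWith L (fun x => α (x, s)) N)
    (hU : ∀ x ∈ N, ∀ s ∈ Ioo (-ε) ε, α (x, s) ∈ U ∧ ‖v (α (x, s)) - v p‖ ≤ c)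
    {x x' : E} (hx : x ∈ N) (hx' : x' ∈ N) {s s' : ℝ} (hs : s ∈ Ioo (-ε) ε)
    (hs' : s' ∈ Ioo (-ε) ε) :
    ‖α (x, s) - α (x', s') - ((x - x') + (s - s') • v p)‖
      ≤ c * ‖s - s'‖ + K * L * ε * ‖x - x'‖ := by
  have hzero : (0 : ℝ) ∈ Ioo (-ε) ε := by constructor <;> linarith [hs.1, hs.2]
  have htime : ‖(α (x, s) - s • v p) - (α (x, s') - s' • v p)‖ ≤ c * ‖s - s'‖ := by
    refine (convex_Ioo (-ε) ε).norm_image_sub_le_of_norm_hasDerivWithin_le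
      (f := fun s => α (x, s) - s • v p) (f' := fun s => v (α (x, s)) - v p) (fun r hr => ?_)
      (fun r hr => (hU x hx r hr).2) hs' hs
    simpa only [one_smul] using ((hα.hasDerivAt x hx r hr).fun_sub
      ((hasDerivAt_id' r).smul_const (v p))).hasDerivWithinAt (s := Ioo (-ε) ε)
  have hspace : ‖(α (x, s') - α (x', s')) - (α (x, 0) - α (x', 0))‖
      ≤ K * L * ‖x - x'‖ * ‖s' - 0‖ := by
    refine (convex_Ioo (-ε) ε).norm_image_sub_le_of_norm_hasDerivWithin_le
      (f := fun s => α (x, s) - α (x', s)) (f' := fun s => v (α (x, s)) - v (α (x', s)))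
      (fun r hr => ((hα.hasDerivAt x hx r hr).sub
        (hα.hasDerivAt x' hx' r hr)).hasDerivWithinAt) (fun r hr => ?_) hzero hs'
    calc ‖v (α (x, r)) - v (α (x', r))‖ ≤ K * ‖α (x, r) - α (x', r)‖ :=
          hvU.norm_sub_le (hU x hx r hr).1 (hU x' hx' r hr).1
      _ ≤ K * (L * ‖x - x'‖) := by gcongr; exact (hαL r hr).norm_sub_le hx hx'
      _ = K * L * ‖x - x'‖ := by ring
  rw [hα.map_zero x hx, hα.map_zero x' hx', sub_zero] at hspace
  calc ‖α (x, s) - α (x', s') - ((x - x') + (s - s') • v p)‖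
      = ‖((α (x, s) - s • v p) - (α (x, s') - s' • v p))
          + ((α (x, s') - α (x', s')) - (x - x'))‖ := by congr 1; module
    _ ≤ c * ‖s - s'‖ + K * L * ‖x - x'‖ * ‖s'‖ :=
        (norm_add_le _ _).trans (add_le_add htime hspace)
    _ ≤ c * ‖s - s'‖ + K * L * ‖x - x'‖ * ε := by gcongr; exact (abs_lt.2 hs').le
    _ = c * ‖s - s'‖ + K * L * ε * ‖x - x'‖ := by ring

lemma exists_pos_le_le_mul_le {a b c : ℝ} (ha : 0 < a) (hb : 0 < b) (hc : 0 < c) (M : ℝ) :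
    ∃ η > 0, η ≤ a ∧ η ≤ b ∧ M * η ≤ c := by
  have hsmall : ∀ᶠ η : ℝ in nhdsWithin 0 (Ioi 0), η < a ∧ η < b ∧ M * η < c :=
    Filter.Eventually.filter_mono nhdsWithin_le_nhds <|
      (gt_mem_nhds ha).and <| (gt_mem_nhds hb).and <|
        ((continuous_const_mul M).tendsto' 0 0 (mul_zero M)).eventually (gt_mem_nhds hc)
  obtain ⟨η, ⟨hηa, hηb, hηc⟩, hη⟩ := (hsmall.and self_mem_nhdsWithin).exists
  exact ⟨η, hη, hηa.le, hηb.le, hηc.le⟩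

lemma IsLocalFlow.hasStrictFDerivAt (hv : ContDiffAt ℝ 1 v p) (hα : IsLocalFlow v α N ε)
    (hN : N ∈ nhds p) (hε : 0 < ε)
    (hαL : ∀ s ∈ Ioo (-ε) ε, LipschitzOnWith L (fun x => α (x, s)) N)
    (hαc : ContinuousAt α (p, 0)) :
    HasStrictFDerivAt α (ContinuousLinearMap.fst ℝ E ℝ
      + (ContinuousLinearMap.snd ℝ E ℝ).smulRight (v p)) (p, 0) := by
  obtain ⟨K, U, hU, hvU⟩ := hv.exists_lipschitzOnWith
  refine .of_isLittleO (Asymptotics.isLittleO_iff.2 fun c hc => ?_)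
  have hvc : ∀ᶠ x in nhds p, ‖v x - v p‖ ≤ c / 2 := by
    have : ContinuousAt (fun x => ‖v x - v p‖) p := (hv.continuousAt.sub continuousAt_const).norm
    filter_upwards [this.eventually_lt_const (u := c / 2) (by simpa using half_pos hc)]
      with x hx using hx.le
  have hαp : Filter.Tendsto α (nhds (p, 0)) (nhds p) := by
    simpa only [ContinuousAt, hα.map_zero p (mem_of_mem_nhds hN)] using hαc
  have hnear : ∀ᶠ x : E × ℝ in nhds (p, 0),
      (x.1 ∈ N) ∧ α x ∈ U ∧ ‖v (α x) - v p‖ ≤ c / 2 :=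
    ((continuous_fst.tendsto' (p, (0 : ℝ)) p rfl).eventually hN).and
      ((hαp.eventually hU).and (hαp.eventually hvc))
  obtain ⟨δ, hδ, hball⟩ := Metric.eventually_nhds_iff_ball.1 hnear
  obtain ⟨η, hη, hηδ, hηε, hηc⟩ := exists_pos_le_le_mul_le hδ hε (half_pos hc) (K * L)
  have hmem (x : E) (hx : x ∈ Metric.ball p η) (s : ℝ) (hs : s ∈ Ioo (-η) η) :=
    hball (x, s) (by
      rw [← ball_prod_same, Real.ball_eq_Ioo]
      exact ⟨Metric.ball_subset_ball hηδ hx, by constructor <;> linarith [hs.1, hs.2]⟩)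
  have hηN : Metric.ball p η ⊆ N := fun x hx => (hmem x hx 0 (by simpa using hη)).1
  have hbox : Metric.ball p η ×ˢ Ioo (-η) η ∈ nhds (p, (0 : ℝ)) :=
    prod_mem_nhds (Metric.ball_mem_nhds p hη) (Ioo_mem_nhds (neg_lt_zero.2 hη) hη)
  filter_upwards [prod_mem_nhds hbox hbox]
  rintro ⟨⟨x, s⟩, ⟨x', s'⟩⟩ ⟨⟨hx, hs⟩, ⟨hx', hs'⟩⟩
  have hfst : ‖x - x'‖ ≤ ‖((x, s) : E × ℝ) - (x', s')‖ :=
    norm_fst_le (((x, s) : E × ℝ) - (x', s'))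
  have hsnd : ‖s - s'‖ ≤ ‖((x, s) : E × ℝ) - (x', s')‖ :=
    norm_snd_le (((x, s) : E × ℝ) - (x', s'))
  calc _ ≤ c / 2 * ‖s - s'‖ + K * L * η * ‖x - x'‖ :=
        (hα.mono hηN hηε).norm_sub_sub_le hvU
          (fun r hr => (hαL r ⟨by linarith [hr.1], by linarith [hr.2]⟩).mono hηN)
          (fun x hx s hs => (hmem x hx s hs).2) hx hx' hs hs'
    _ ≤ c / 2 * ‖((x, s) : E × ℝ) - (x', s')‖ + c / 2 * ‖((x, s) : E × ℝ) - (x', s')‖ := by gcongr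
    _ = _ := by ring

theorem exists_isLocalFlow [CompleteSpace E] (hv : ContDiffAt ℝ 1 v p) :
    ∃ α : E × ℝ → E, ∃ N ∈ nhds p, ∃ ε > 0, IsLocalFlow v α N ε ∧
      HasStrictFDerivAt α (ContinuousLinearMap.fst ℝ E ℝ
        + (ContinuousLinearMap.snd ℝ E ℝ).smulRight (v p)) (p, 0) := by
  obtain ⟨ε, hε, a, r, L, K, hr, hpl⟩ := IsPicardLindelof.of_contDiffAt_one hv
  obtain ⟨α, hα, L', hL'⟩ :=
    (hpl 0).exists_forall_mem_closedBall_eq_hasDerivWithinAt_lipschitzOnWith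
  simp only [zero_sub, zero_add] at hα hL'
  have hN : Metric.closedBall p r ∈ nhds p := Metric.closedBall_mem_nhds p hr
  have hflow : IsLocalFlow v (Function.uncurry α) (Metric.closedBall p r) ε :=
    ⟨fun x hx => (hα x hx).1, fun x hx s hs =>
      ((hα x hx).2 s (Ioo_subset_Icc_self hs)).hasDerivAt (Icc_mem_nhds hs.1 hs.2)⟩
  have hcont : ContinuousOn (Function.uncurry α) (Metric.closedBall p r ×ˢ Icc (-ε) ε) :=
    continuousOn_prod_of_continuousOn_lipschitzOnWith _ L'
      (fun x hx => HasDerivWithinAt.continuousOn (hα x hx).2) hL'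
  exact ⟨_, _, hN, ε, hε, hflow, hflow.hasStrictFDerivAt hv hN hε
    (fun s hs => hL' s (Ioo_subset_Icc_self hs))
    (hcont.continuousAt (prod_mem_nhds hN (Icc_mem_nhds (neg_lt_zero.2 hε) hε)))⟩

theorem exists_isLocalFlow_isIntegralCurveIn [CompleteSpace E] (hS : IsOpen S)
    (hv : ContDiffOn ℝ 1 v S) (hp : p ∈ S) :
    ∃ α : E × ℝ → E, ∃ N ∈ nhds p, ∃ ε > 0, (∀ x ∈ N, α (x, 0) = x) ∧
      (∀ x ∈ N, IsIntegralCurveIn v S (fun s => α (x, s)) (Ioo (-ε) ε)) ∧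
      HasStrictFDerivAt α (ContinuousLinearMap.fst ℝ E ℝ
        + (ContinuousLinearMap.snd ℝ E ℝ).smulRight (v p)) (p, 0) := by
  obtain ⟨α, N, hN, ε, hε, hα, hα'⟩ := exists_isLocalFlow (hv.contDiffAt (hS.mem_nhds hp))
  have hαS : ∀ᶠ x in nhds (p, (0 : ℝ)), α x ∈ S :=
    hα'.continuousAt.eventually_mem (hS.mem_nhds (by rwa [hα.map_zero p (mem_of_mem_nhds hN)]))
  obtain ⟨N', hN', J, hJ, hNJ⟩ := mem_nhds_prod_iff.1 hαS
  obtain ⟨η, hη, hηJ⟩ := Metric.mem_nhds_iff.1 hJ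
  rw [Real.ball_eq_Ioo, zero_sub, zero_add] at hηJ
  have hαmin := hα.mono (inter_subset_left (t := N')) (min_le_left ε η)
  refine ⟨α, N ∩ N', Filter.inter_mem hN hN', min ε η, lt_min hε hη, hαmin.map_zero,
    fun x hx => ⟨isOpen_Ioo, fun s hs => hNJ ⟨hx.2, hηJ ?_⟩, hαmin.hasDerivAt x hx⟩, hα'⟩
  exact Ioo_subset_Ioo (neg_le_neg (min_le_right ε η)) (min_le_right ε η) hs

end IntegralCurves

/-! ## Charts adapted to a submersion, and slices -/

section Slices

open Function Module

variable {E F K G A : Type*} [NormedAddCommGroup E] [NormedSpace ℝ E] [NormedAddCommGroup F]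
  [NormedSpace ℝ F] [NormedAddCommGroup K] [NormedSpace ℝ K] [NormedAddCommGroup G]
  [NormedSpace ℝ G] [NormedAddCommGroup A]
  {n : WithTop ℕ∞} {Q : E → G} {U : Set E} {p : E}

lemma exists_continuousLinearEquiv_of_injective [FiniteDimensional ℝ E] [FiniteDimensional ℝ F]
    (hfin : finrank ℝ E = finrank ℝ F) {f : E →L[ℝ] F} (hf : Injective f) :
    ∃ e : E ≃L[ℝ] F, (e : E →L[ℝ] F) = f :=
  ⟨(LinearEquiv.ofInjectiveOfFinrankEq f.toLinearMap hf hfin).toContinuousLinearEquiv, rfl⟩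

lemma exists_leftInverse_of_injective [FiniteDimensional ℝ E] [FiniteDimensional ℝ F]
    {f : E →L[ℝ] F} (hf : Injective f) : ∃ g : F →L[ℝ] E, ∀ x, g (f x) = x := by
  obtain ⟨g, hg⟩ := f.toLinearMap.exists_leftInverse_of_injective (LinearMap.ker_eq_bot.2 hf)
  exact ⟨g.toContinuousLinearMap, LinearMap.congr_fun hg⟩

lemma exists_continuousLinearEquiv_prod_of_surjective [FiniteDimensional ℝ E]
    [FiniteDimensional ℝ K] [FiniteDimensional ℝ G]
    (hfin : finrank ℝ E = finrank ℝ K + finrank ℝ G) {f : E →L[ℝ] G} (hf : Surjective f) :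
    ∃ e : E ≃L[ℝ] K × G, ∀ x, (e x).2 = f x := by
  have hker : finrank ℝ f.toLinearMap.ker = finrank ℝ K := by
    have hrange := f.toLinearMap.finrank_range_add_finrank_ker
    rw [LinearMap.range_eq_top.2 hf, finrank_top] at hrange
    omega
  obtain ⟨π, hπ⟩ := f.toLinearMap.ker.subtype.exists_leftInverse_of_injective (by simp)
  let κ : f.toLinearMap.ker ≃ₗ[ℝ] K := LinearEquiv.ofFinrankEq _ _ hker
  let k : E →L[ℝ] K := (κ.toLinearMap ∘ₗ π).toContinuousLinearMap
  have hinj : Injective (k.prod f) := by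
    refine (injective_iff_map_eq_zero _).2 fun x hx => ?_
    have hfx : f x = 0 := congrArg Prod.snd hx
    have hπx : π x = 0 := κ.map_eq_zero_iff.1 (congrArg Prod.fst hx)
    exact congrArg Subtype.val ((LinearMap.congr_fun hπ ⟨x, hfx⟩).symm.trans hπx)
  obtain ⟨e, he⟩ := exists_continuousLinearEquiv_of_injective (by simpa using hfin) hinj
  exact ⟨e, fun x => congrArg Prod.snd (DFunLike.congr_fun he x)⟩

lemma injective_fderiv_of_eventually_leftInverse {f : E → F} {g : F → E}
    (hf : DifferentiableAt ℝ f p) (hg : DifferentiableAt ℝ g (f p))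
    (hgf : ∀ᶠ x in nhds p, g (f x) = x) : Injective (fderiv ℝ f p) := by
  have hcomp := (hg.hasFDerivAt.comp p hf.hasFDerivAt).unique
    ((hasFDerivAt_id p).congr_of_eventuallyEq hgf)
  exact LeftInverse.injective (g := fderiv ℝ g (f p)) (DFunLike.congr_fun hcomp)

lemma injective_fderiv_symm_comp {φ : OpenPartialHomeomorph E F} {ι : K → F} {π : F → K} {x : K}
    (hφ : DifferentiableAt ℝ φ (φ.symm (ι x))) (hφι : DifferentiableAt ℝ (φ.symm ∘ ι) x)
    (hι : ContinuousAt ι x) (hx : ι x ∈ φ.target) (hπ : Differentiable ℝ π)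
    (hπι : LeftInverse π ι) : Injective (fderiv ℝ (φ.symm ∘ ι) x) := by
  refine injective_fderiv_of_eventually_leftInverse (g := π ∘ φ) hφι
    (hπ.differentiableAt.comp _ hφ) ?_
  filter_upwards [hι.eventually_mem (φ.open_target.mem_nhds hx)] with x' hx'
  simp only [comp_apply, φ.right_inv hx', hπι x']

theorem exists_openPartialHomeomorph_contDiffOn [CompleteSpace E] {f : E → F} (hU : IsOpen U)
    (hf : ContDiffOn ℝ n f U) (hn : n ≠ 0) (hp : p ∈ U) {e : E ≃L[ℝ] F}
    (he : HasFDerivAt f (e : E →L[ℝ] F) p) :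
    ∃ φ : OpenPartialHomeomorph E F, p ∈ φ.source ∧ φ.source ⊆ U ∧ ⇑φ = f ∧
      ContDiffOn ℝ n φ.symm φ.target := by
  have hfp := hf.contDiffAt (hU.mem_nhds hp)
  let V : Set E := U ∩ fderiv ℝ f ⁻¹' range ((↑) : (E ≃L[ℝ] F) → E →L[ℝ] F)
  have hV : IsOpen V := (hf.continuousOn_fderiv_of_isOpen hU
    (ENat.one_le_iff_ne_zero_withTop.2 hn)).isOpen_inter_preimage hU ContinuousLinearEquiv.isOpen
  let φ := (hfp.toOpenPartialHomeomorph f he hn).restrOpen V hV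
  refine ⟨φ, ⟨hfp.mem_toOpenPartialHomeomorph_source he hn, hp, e, he.fderiv.symm⟩,
    fun q hq => hq.2.1, rfl, fun y hy => ?_⟩
  obtain ⟨-, hqU, e', he'⟩ := φ.map_target hy
  have hfq := hf.contDiffAt (hU.mem_nhds hqU)
  exact (φ.contDiffAt_symm (f₀' := e') hy
    (he' ▸ (hfq.differentiableAt hn).hasFDerivAt) hfq).contDiffWithinAt

theorem exists_chart_of_surjective_fderiv [FiniteDimensional ℝ E] [FiniteDimensional ℝ K]
    [FiniteDimensional ℝ G] (hfin : finrank ℝ E = finrank ℝ K + finrank ℝ G) (hU : IsOpen U)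
    (hQ : ContDiffOn ℝ n Q U) (hn : n ≠ 0) (hp : p ∈ U) (hsurj : Surjective (fderiv ℝ Q p)) :
    ∃ φ : OpenPartialHomeomorph E (K × G), p ∈ φ.source ∧ φ.source ⊆ U ∧
      ContDiffOn ℝ n φ φ.source ∧ ContDiffOn ℝ n φ.symm φ.target ∧
      ∀ q ∈ φ.source, (φ q).2 = Q q := by
  have := FiniteDimensional.complete ℝ E
  obtain ⟨e, he⟩ := exists_continuousLinearEquiv_prod_of_surjective (K := K) hfin hsurj
  let k : E →L[ℝ] K := (ContinuousLinearMap.fst ℝ K G).comp (e : E →L[ℝ] K × G)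
  have hkQ : ContDiffOn ℝ n (fun q => (k q, Q q)) U := k.contDiff.contDiffOn.prodMk hQ
  have hderiv : HasFDerivAt (fun q => (k q, Q q)) (e : E →L[ℝ] K × G) p :=
    (k.hasFDerivAt.prodMk
      ((hQ.contDiffAt (hU.mem_nhds hp)).differentiableAt hn).hasFDerivAt).congr_fderiv
      (by ext x <;> simp [k, he])
  obtain ⟨φ, hpφ, hφU, hφ, hsymm⟩ := exists_openPartialHomeomorph_contDiffOn hU hkQ hn hp hderiv
  exact ⟨φ, hpφ, hφU, hφ ▸ hkQ.mono hφU, hsymm, fun q _ => by rw [hφ]⟩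

lemma isEmbedding_domRestrict_comp {X Y Z : Type*} [TopologicalSpace X] [TopologicalSpace Y]
    [TopologicalSpace Z] (ψ : OpenPartialHomeomorph Y Z) {j : X → Y} (hj : Topology.IsEmbedding j)
    {s : Set X} (hs : MapsTo j s ψ.source) : Topology.IsEmbedding (s.domRestrict (ψ ∘ j)) :=
  ψ.isEmbedding_restrict.comp ((hj.comp .subtypeVal).codRestrict ψ.source fun x => hs x.2)

/-- `σ` is a slice of radius `δ` at `p ∈ {Q = c}` for the local action `Φ` of `A`, with `Φ` defined
on `N`: it immerses the ball of radius `δ` of `K` into the level set `{Q = c}`, and the translates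
of its image by the ball of radius `δ` of `A` fill, without repetition, a neighbourhood of `p` in
`{Q = c}`. -/
structure IsSlice (n : WithTop ℕ∞) (Φ : E × A → E) (N : Set (E × A)) (Q : E → G) (p : E) (σ : K → E)
    (δ : ℝ) : Prop where
  map_zero : σ 0 = p
  contDiffOn : ContDiffOn ℝ n σ (Metric.ball 0 δ)
  injective_fderiv : ∀ u ∈ Metric.ball 0 δ, Injective (fderiv ℝ σ u)
  mem : ∀ u ∈ Metric.ball 0 δ, ∀ a ∈ Metric.ball 0 δ, (σ u, a) ∈ N
  apply_eq : ∀ u ∈ Metric.ball 0 δ, Q (σ u) = Q p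
  isEmbedding : Topology.IsEmbedding
    ((Metric.ball 0 δ ×ˢ Metric.ball 0 δ).domRestrict fun x : K × A => Φ (σ x.1, x.2))
  exists_image_eq : ∃ O, IsOpen O ∧ (fun x : K × A => Φ (σ x.1, x.2)) ''
    (Metric.ball 0 δ ×ˢ Metric.ball 0 δ) = O ∩ {q | Q q = Q p}

variable {Φ : E × A → E} {N : Set (E × A)}

lemma isSlice_of_straightening {τ : K × G → E} {ψ : OpenPartialHomeomorph ((K × G) × A) E} {δ : ℝ}
    (hn : n ≠ 0) (hδ : 0 < δ) (hτ0 : τ 0 = p) (hψ : ∀ x, ψ x = Φ (τ x.1, x.2))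
    (hinv : ∀ x ∈ N, Q (Φ x) = Q x.1)
    (hball : ∀ x ∈ Metric.ball (0 : (K × G) × A) δ, x ∈ ψ.source ∧ (τ x.1, x.2) ∈ N ∧
      ContDiffAt ℝ n τ x.1 ∧ Injective (fderiv ℝ τ x.1) ∧ Q (τ x.1) = Q p + x.1.2) :
    IsSlice n Φ N Q p (fun u : K => τ (u, 0)) δ := by
  have hmem {u : K} (hu : u ∈ Metric.ball 0 δ) {a : A} (ha : a ∈ Metric.ball 0 δ) :
      ((u, (0 : G)), a) ∈ Metric.ball (0 : (K × G) × A) δ := by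
    simpa [Prod.norm_def, hδ] using And.intro hu ha
  have hmem₀ {u : K} (hu : u ∈ Metric.ball 0 δ) := hball _ (hmem hu (Metric.mem_ball_self hδ))
  refine ⟨hτ0, fun u hu => ?_, fun u hu => ?_, fun u hu a ha => (hball _ (hmem hu ha)).2.1,
    fun u hu => by simpa using (hmem₀ hu).2.2.2.2, ?_,
    ψ '' Metric.ball 0 δ, ψ.isOpen_image_of_subset_source Metric.isOpen_ball
      fun x hx => (hball x hx).1, Subset.antisymm ?_ ?_⟩
  · exact ((hmem₀ hu).2.2.1.comp u
      (contDiff_id.prodMk contDiff_const).contDiffAt).contDiffWithinAt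
  · obtain ⟨-, -, hsmooth, hinj, -⟩ := hmem₀ hu
    have hderiv : HasFDerivAt (fun u => τ (u, 0)) _ u :=
      HasFDerivAt.comp (f := fun u => (u, (0 : G))) u (hsmooth.differentiableAt hn).hasFDerivAt
        (hasFDerivAt_prodMk_left u 0)
    rw [hderiv.fderiv]
    exact hinj.comp LinearMap.inl_injective
  · have hj : Topology.IsEmbedding fun x : K × A => ((x.1, (0 : G)), x.2) :=
      LeftInverse.isEmbedding (f := fun y : (K × G) × A => (y.1.1, y.2)) (fun x => rfl)
        (by fun_prop) (by fun_prop)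
    have hj_maps : MapsTo (fun x : K × A => ((x.1, (0 : G)), x.2))
        (Metric.ball 0 δ ×ˢ Metric.ball 0 δ) ψ.source := fun x hx => (hball _ (hmem hx.1 hx.2)).1
    convert isEmbedding_domRestrict_comp ψ hj hj_maps using 2
    exact funext fun x => (hψ ((x.1, 0), x.2)).symm
  · rintro _ ⟨⟨u, a⟩, ⟨hu, ha⟩, rfl⟩
    obtain ⟨-, hxN, -, -, hQx⟩ := hball _ (hmem hu ha)
    exact ⟨⟨_, hmem hu ha, hψ _⟩, (hinv _ hxN).trans (by simpa using hQx)⟩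
  · rintro _ ⟨⟨⟨⟨u, w⟩, a⟩, hx, rfl⟩, hq⟩
    obtain ⟨-, hxN, -, -, hQx⟩ := hball _ hx
    have hw : w = 0 := by
      have hqx := (hψ _ ▸ hinv _ hxN : Q (ψ ((u, w), a)) = _).symm.trans hq
      simpa using hQx.symm.trans hqx
    subst hw
    have hx' : ‖u‖ < δ ∧ ‖a‖ < δ := by simpa [Prod.norm_def, hδ] using hx
    exact ⟨(u, a), by simpa using hx', (hψ ((u, 0), a)).symm⟩

variable [NormedSpace ℝ A] {L : A →L[ℝ] E}

lemma fderiv_apply_eq_zero_of_eventually_eq (hQ : DifferentiableAt ℝ Q p)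
    (hΦ : HasFDerivAt Φ (ContinuousLinearMap.fst ℝ E A + L.comp (ContinuousLinearMap.snd ℝ E A))
      (p, 0)) (hΦp : Φ (p, 0) = p) (hinv : ∀ᶠ x in nhds (p, 0), Q (Φ x) = Q x.1) (a : A) :
    fderiv ℝ Q p (L a) = 0 := by
  have hcomp : HasFDerivAt (fun x => Q (Φ x)) _ (p, 0) :=
    HasFDerivAt.comp (g := Q) (p, 0) (by rw [hΦp]; exact hQ.hasFDerivAt) hΦ
  have hfst : HasFDerivAt (fun x : E × A => Q x.1) _ (p, 0) :=
    HasFDerivAt.comp (g := Q) (f := Prod.fst) (p, 0) hQ.hasFDerivAt hasFDerivAt_fst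
  simpa using DFunLike.congr_fun (hcomp.unique (hfst.congr_of_eventuallyEq hinv)) (0, a)

lemma surjective_prod_of_leftInverse {f : E →L[ℝ] G} {T : E →L[ℝ] A} (hf : Surjective f)
    (hT : ∀ a, T (L a) = a) (hfL : ∀ a, f (L a) = 0) : Surjective (f.prod T) := fun ⟨w, a⟩ => by
  obtain ⟨v, hv⟩ := hf w
  exact ⟨v + L (a - T v), by simp [hv, hT, hfL]⟩

lemma injective_add_of_leftInverse {f : K →L[ℝ] E} {T : E →L[ℝ] A}
    (hf : Injective f) (hT : ∀ a, T (L a) = a) (hTf : ∀ x, T (f x) = 0) :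
    Injective fun x : K × A => f x.1 + L x.2 := by
  refine (injective_iff_map_eq_zero (f.coprod L)).2 fun ⟨x, a⟩ hxa => ?_
  have ha : a = 0 := by simpa [hTf, hT] using congrArg T hxa
  subst ha
  exact Prod.ext (hf (by simpa using hxa)) rfl

variable [FiniteDimensional ℝ E] [FiniteDimensional ℝ K] [FiniteDimensional ℝ G]
  [FiniteDimensional ℝ A]

/-- The chart straightens `Q` together with a left inverse of `L`. -/
lemma exists_transversal (hfin : finrank ℝ E = finrank ℝ K + finrank ℝ G + finrank ℝ A)
    (hU : IsOpen U) (hQ : ContDiffOn ℝ n Q U) (hn : n ≠ 0) (hp : p ∈ U)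
    (hsurj : Surjective (fderiv ℝ Q p)) (hL : Injective L) (hQL : ∀ a, fderiv ℝ Q p (L a) = 0) :
    ∃ τ : K × G → E, τ 0 = p ∧
      (∀ᶠ x in nhds 0, ContDiffAt ℝ n τ x ∧ Injective (fderiv ℝ τ x) ∧ Q (τ x) = Q p + x.2) ∧
      Injective fun x : (K × G) × A => fderiv ℝ τ 0 x.1 + L x.2 := by
  obtain ⟨T, hT⟩ := exists_leftInverse_of_injective hL
  have hR : ContDiffOn ℝ n (fun q => (Q q, T q)) U := hQ.prodMk T.contDiff.contDiffOn
  have hQp := ((hQ.contDiffAt (hU.mem_nhds hp)).differentiableAt hn).hasFDerivAt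
  have hR' : HasFDerivAt (fun q => (Q q, T q)) ((fderiv ℝ Q p).prod T) p := hQp.prodMk T.hasFDerivAt
  have hRsurj : Surjective (fderiv ℝ (fun q => (Q q, T q)) p) :=
    hR'.fderiv ▸ surjective_prod_of_leftInverse hsurj hT hQL
  obtain ⟨φ, hpφ, -, hφ, hsymm, hφR⟩ := exists_chart_of_surjective_fderiv (K := K)
    (by rw [hfin, finrank_prod, add_assoc]) hU hR hn hp hRsurj
  let ι : K × G → K × G × A := fun x => φ p + (x.1, x.2, 0)
  have hι : ContDiff ℝ n ι := by fun_prop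
  have hι0 : ι 0 = φ p := by simp [ι]
  have htarget : ∀ᶠ x in nhds 0, ι x ∈ φ.target :=
    hι.continuous.continuousAt.eventually_mem (φ.open_target.mem_nhds (hι0 ▸ φ.map_source hpφ))
  have hτ (x : K × G) (hx : ι x ∈ φ.target) : ContDiffAt ℝ n (φ.symm ∘ ι) x :=
    (hsymm.contDiffAt (φ.open_target.mem_nhds hx)).comp x hι.contDiffAt
  have hRτ (x : K × G) (hx : ι x ∈ φ.target) :
      Q (φ.symm (ι x)) = Q p + x.2 ∧ T (φ.symm (ι x)) = T p := by
    have h := hφR _ (φ.map_target hx)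
    rw [φ.right_inv hx] at h
    have hp2 := hφR p hpφ
    exact ⟨by simpa [ι, hp2] using (congrArg Prod.fst h).symm,
      by simpa [ι, hp2] using (congrArg Prod.snd h).symm⟩
  have hinj (x : K × G) (hx : ι x ∈ φ.target) : Injective (fderiv ℝ (φ.symm ∘ ι) x) :=
    injective_fderiv_symm_comp (π := fun y => ((y - φ p).1, (y - φ p).2.1))
      ((hφ.contDiffAt (φ.open_source.mem_nhds (φ.map_target hx))).differentiableAt hn)
      ((hτ x hx).differentiableAt hn) hι.continuous.continuousAt hx (by fun_prop)
      fun x => by simp [ι]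
  have hTτ (x : K × G) : T (fderiv ℝ (φ.symm ∘ ι) 0 x) = 0 := by
    have hcomp := T.hasFDerivAt.comp 0
      ((hτ 0 htarget.self_of_nhds).differentiableAt hn).hasFDerivAt
    exact DFunLike.congr_fun (hcomp.unique ((hasFDerivAt_const (T p) 0).congr_of_eventuallyEq
      (htarget.mono fun x hx => (hRτ x hx).2))) x
  exact ⟨φ.symm ∘ ι, by simp [hι0, φ.left_inv hpφ],
    htarget.mono fun x hx => ⟨hτ x hx, hinj x hx, (hRτ x hx).1⟩,
    injective_add_of_leftInverse (hinj 0 htarget.self_of_nhds) hT hTτ⟩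

lemma exists_straightening (hfin : finrank ℝ E = finrank ℝ K + finrank ℝ G + finrank ℝ A)
    (hU : IsOpen U) (hQ : ContDiffOn ℝ n Q U) (hn : n ≠ 0) (hp : p ∈ U)
    (hsurj : Surjective (fderiv ℝ Q p)) (hL : Injective L)
    (hΦ : HasStrictFDerivAt Φ
      (ContinuousLinearMap.fst ℝ E A + L.comp (ContinuousLinearMap.snd ℝ E A)) (p, 0))
    (hQL : ∀ a, fderiv ℝ Q p (L a) = 0) :
    ∃ (τ : K × G → E) (ψ : OpenPartialHomeomorph ((K × G) × A) E), τ 0 = p ∧ 0 ∈ ψ.source ∧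
      (∀ x, ψ x = Φ (τ x.1, x.2)) ∧
      ∀ᶠ y in nhds 0, ContDiffAt ℝ n τ y ∧ Injective (fderiv ℝ τ y) ∧ Q (τ y) = Q p + y.2 := by
  have := FiniteDimensional.complete ℝ ((K × G) × A)
  obtain ⟨τ, hτ0, hτ, hτL⟩ := exists_transversal (K := K) hfin hU hQ hn hp hsurj hL hQL
  obtain ⟨e, he⟩ := exists_continuousLinearEquiv_of_injective
    (f := (fderiv ℝ τ 0).coprod L) (by simp [hfin]) hτL
  have hτfst : HasStrictFDerivAt (fun x : (K × G) × A => (τ x.1, x.2)) _ 0 :=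
    (HasStrictFDerivAt.comp (f := Prod.fst) (0 : (K × G) × A)
      (hτ.self_of_nhds.1.hasStrictFDerivAt hn) hasStrictFDerivAt_fst).prodMk hasStrictFDerivAt_snd
  have hΨ : HasStrictFDerivAt (fun x : (K × G) × A => Φ (τ x.1, x.2))
      (e : (K × G) × A →L[ℝ] E) 0 := by
    refine (HasStrictFDerivAt.comp (g := Φ) (0 : (K × G) × A) (by simpa [hτ0] using hΦ)
      hτfst).congr_fderiv ?_
    rw [he]
    ext x <;> simp
  exact ⟨τ, hΨ.toOpenPartialHomeomorph, hτ0, hΨ.mem_toOpenPartialHomeomorph_source,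
    fun x => rfl, hτ⟩

theorem exists_isSlice (hfin : finrank ℝ E = finrank ℝ K + finrank ℝ G + finrank ℝ A)
    (hU : IsOpen U) (hQ : ContDiffOn ℝ n Q U) (hn : n ≠ 0) (hp : p ∈ U)
    (hsurj : Surjective (fderiv ℝ Q p)) (hL : Injective L)
    (hΦ : HasStrictFDerivAt Φ
      (ContinuousLinearMap.fst ℝ E A + L.comp (ContinuousLinearMap.snd ℝ E A)) (p, 0))
    (hΦp : Φ (p, 0) = p) (hN : N ∈ nhds (p, 0)) (hinv : ∀ x ∈ N, Q (Φ x) = Q x.1) :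
    ∃ σ : K → E, ∃ δ > 0, IsSlice n Φ N Q p σ δ := by
  obtain ⟨τ, ψ, hτ0, hψ0, hψ, hτ⟩ := exists_straightening (K := K) hfin hU hQ hn hp hsurj hL hΦ
    (fderiv_apply_eq_zero_of_eventually_eq
      ((hQ.contDiffAt (hU.mem_nhds hp)).differentiableAt hn) hΦ.hasFDerivAt hΦp
      (Filter.eventually_of_mem hN hinv))
  have hτN : ∀ᶠ x : (K × G) × A in nhds 0, (τ x.1, x.2) ∈ N := by
    have hcont : ContinuousAt (fun x : (K × G) × A => (τ x.1, x.2)) 0 :=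
      (ContinuousAt.comp (f := Prod.fst) (x := (0 : (K × G) × A))
        hτ.self_of_nhds.1.continuousAt continuousAt_fst).prodMk continuousAt_snd
    exact hcont.eventually_mem (by simpa [hτ0] using hN)
  obtain ⟨δ, hδ, hball⟩ := Metric.eventually_nhds_iff_ball.1
    ((ψ.open_source.eventually_mem hψ0).and (hτN.and
      ((continuous_fst.tendsto' (0 : (K × G) × A) (0 : K × G) rfl).eventually hτ)))
  exact ⟨_, δ, hδ, isSlice_of_straightening hn hδ hτ0 hψ hinv hball⟩

end Slices

lemma contDiffAt_deriv {f : ℝ → ℝ} {z : ℝ} (hf : ContDiffAt ℝ ∞ f z) :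
    ContDiffAt ℝ ∞ (deriv f) z :=
  hf.derivWithin (by simp)

lemma eventually_hasDerivAt {f : ℝ → ℝ} {z : ℝ} (hf : ContDiffAt ℝ ∞ f z) :
    ∀ᶠ x in nhds z, HasDerivAt f (deriv f x) x := by
  have hf₁ : ContDiffAt ℝ 1 f z := hf.of_le (by simp)
  filter_upwards [hf₁.eventually (by simp)] with x hx
  exact (hx.differentiableAt one_ne_zero).hasDerivAt

lemma hasDerivAt_of_contDiffAt {f : ℝ → ℝ} {z : ℝ} (hf : ContDiffAt ℝ ∞ f z) :
    HasDerivAt f (deriv f z) z :=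
  (eventually_hasDerivAt hf).self_of_nhds

/-! ## The reduced operators in terms of derivatives -/

section ReducedOperators

variable {F C s : ℝ → ℝ} {z : ℝ}

lemma Lplus_eventuallyEq (hF : ContDiffAt ℝ ∞ F z) :
    Lplus F =ᶠ[nhds z] fun x => 1 / 2 * deriv (deriv F) x - 3 / 2 * deriv F x + F x := by
  filter_upwards [eventually_hasDerivAt hF, eventually_hasDerivAt (contDiffAt_deriv hF)]
    with x hFx hF'x
  have hderiv : deriv (fun y => -deriv F y + F y) x = -deriv (deriv F) x + deriv F x :=
    (hF'x.neg.add hFx).deriv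
  simp only [Lplus, hderiv]
  ring

lemma Lminus_eventuallyEq (hF : ContDiffAt ℝ ∞ F z) :
    Lminus F =ᶠ[nhds z] fun x => 1 / 2 * deriv (deriv F) x + 3 / 2 * deriv F x + F x := by
  filter_upwards [eventually_hasDerivAt hF, eventually_hasDerivAt (contDiffAt_deriv hF)]
    with x hFx hF'x
  have hderiv : deriv (fun y => deriv F y + F y) x = deriv (deriv F) x + deriv F x :=
    (hF'x.add hFx).deriv
  simp only [Lminus, hderiv]
  ring

lemma Lplus_congr {G : ℝ → ℝ} (h : F =ᶠ[nhds z] G) : Lplus F z = Lplus G z := by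
  have hinner : (fun x => -deriv F x + F x) =ᶠ[nhds z] fun x => -deriv G x + G x := by
    filter_upwards [h, h.deriv] with x hx hx'
    rw [hx, hx']
  simp only [Lplus, hinner.deriv_eq, hinner.self_of_nhds]

lemma eventually_hasDerivAt_secondOrder (hF : ContDiffAt ℝ ∞ F z) (c : ℝ) :
    ∀ᶠ x in nhds z, HasDerivAt (fun y => 1 / 2 * deriv (deriv F) y + c * deriv F y + F y)
      (1 / 2 * deriv (deriv (deriv F)) x + c * deriv (deriv F) x + deriv F x) x := by
  have hF' := contDiffAt_deriv hF
  filter_upwards [eventually_hasDerivAt hF, eventually_hasDerivAt hF',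
    eventually_hasDerivAt (contDiffAt_deriv hF')] with x hFx hF'x hF''x
  exact ((hF''x.const_mul (1 / 2)).add (hF'x.const_mul c)).add hFx

lemma deriv_Lplus (hF : ContDiffAt ℝ ∞ F z) :
    deriv (Lplus F) z =
      1 / 2 * deriv (deriv (deriv F)) z - 3 / 2 * deriv (deriv F) z + deriv F z := by
  rw [(Lplus_eventuallyEq hF).deriv_eq]
  simpa only [neg_mul, ← sub_eq_add_neg] using
    (eventually_hasDerivAt_secondOrder hF (-(3 / 2))).self_of_nhds.deriv

lemma Lplus_Lminus (hF : ContDiffAt ℝ ∞ F z) :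
    Lplus (Lminus F) z = 1 / 4 * deriv (deriv (deriv (deriv F))) z - 5 / 4 * deriv (deriv F) z
      + F z := by
  have hF' := contDiffAt_deriv hF
  have hF'' := contDiffAt_deriv hF'
  have hderiv : deriv (fun x => 1 / 2 * deriv (deriv F) x + 3 / 2 * deriv F x + F x) =ᶠ[nhds z]
      fun x => 1 / 2 * deriv (deriv (deriv F)) x + 3 / 2 * deriv (deriv F) x + deriv F x := by
    filter_upwards [eventually_hasDerivAt_secondOrder hF (3 / 2)] with x hx using hx.deriv
  rw [Lplus_congr (Lminus_eventuallyEq hF),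
    (Lplus_eventuallyEq (by fun_prop)).self_of_nhds]
  beta_reduce
  rw [hderiv.deriv_eq, (eventually_hasDerivAt_secondOrder hF' (3 / 2)).self_of_nhds.deriv,
    hderiv.self_of_nhds]
  ring

lemma opB_eq (hF : ContDiffAt ℝ ∞ F z) :
    opB F z = (F z - 1) ^ 2 - (deriv (deriv F) z / 2 - 3 / 2 * deriv F z) ^ 2
      + deriv F z * (deriv (deriv (deriv F)) z / 2 - 3 / 2 * deriv (deriv F) z + deriv F z) := by
  rw [opB, deriv_Lplus hF, (Lplus_eventuallyEq hF).self_of_nhds]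
  ring

lemma opE_eq (hF : ContDiffAt ℝ ∞ F z) (hC : ContDiffAt ℝ ∞ C z) (hs : ContDiffAt ℝ ∞ s z) :
    opE F C s z = (deriv C z * F z + C z * deriv F z) * deriv s z
      + C z * F z * deriv (deriv s) z :=
  (((hasDerivAt_of_contDiffAt hC).mul (hasDerivAt_of_contDiffAt hF)).mul
    (hasDerivAt_of_contDiffAt (contDiffAt_deriv hs))).deriv

lemma eventually_hasDerivAt_sqrt (hC : ContDiffAt ℝ ∞ C z) (hC₀ : 0 < C z) :
    ∀ᶠ x in nhds z, HasDerivAt (fun y => √(C y)) (deriv C x / (2 * √(C x))) x := by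
  filter_upwards [eventually_hasDerivAt hC, hC.continuousAt.eventually (lt_mem_nhds hC₀)]
    with x hx hx₀
  exact hx.sqrt hx₀.ne'

lemma sqrt_mul_opF1 (hF : ContDiffAt ℝ ∞ F z) (hC : ContDiffAt ℝ ∞ C z) (hC₀ : 0 < C z) :
    √(C z) * opF1 F C s z =
      12 * F z * (deriv (deriv C) z - deriv C z ^ 2 / (2 * C z)) + 12 * deriv F z * deriv C z
        + 4 * C z * (deriv (deriv F) z + F z / 2 - 2) + s z * C z ^ 2 := by
  have hsqrt := eventually_hasDerivAt_sqrt hC hC₀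
  have hflux : (fun x => F x * deriv (fun y => √(C y)) x) =ᶠ[nhds z]
      F * (deriv C / fun x => 2 * √(C x)) := by
    filter_upwards [hsqrt] with x hx
    simp [hx.deriv]
  have hr : 0 < √(C z) := Real.sqrt_pos.2 hC₀
  have hrr : √(C z) ^ 2 = C z := Real.sq_sqrt hC₀.le
  rw [opF1, hflux.deriv_eq, ((hasDerivAt_of_contDiffAt hF).mul ((hasDerivAt_of_contDiffAt
    (contDiffAt_deriv hC)).div (hsqrt.self_of_nhds.const_mul 2) (by positivity))).deriv]
  simp only [Pi.div_apply]
  generalize √(C z) = r at *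
  rw [← hrr]
  field_simp
  ring

lemma opF2_eq (t : ℝ) (hF : ContDiffAt ℝ ∞ F z) (hC : ContDiffAt ℝ ∞ C z) (hC₀ : 0 < C z) :
    opF2 t F C s z =
      8 / 3 * (deriv (deriv (deriv (deriv F))) z / 4 - 5 / 4 * deriv (deriv F) z + F z - 1)
        + t * s z * (-(deriv (deriv C) z / 2) + 3 / 4 * (deriv C z ^ 2 / C z) - C z / 4)
        + t / 2 * (C z / F z) * deriv F z * deriv s z + t * deriv C z * deriv s z := by
  have hsqrt := eventually_hasDerivAt_sqrt hC hC₀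
  have hinv : deriv (fun y => (√(C y))⁻¹) =ᶠ[nhds z]
      -(deriv C / fun x => 2 * √(C x)) / (fun x => √(C x)) ^ 2 := by
    filter_upwards [hsqrt, hC.continuousAt.eventually (lt_mem_nhds hC₀)] with x hx hx₀
    exact (hx.inv (Real.sqrt_pos.2 hx₀).ne').deriv
  have hr : 0 < √(C z) := Real.sqrt_pos.2 hC₀
  have hrr : √(C z) ^ 2 = C z := Real.sq_sqrt hC₀.le
  rw [opF2, hinv.deriv_eq, Lplus_Lminus hF, ((((hasDerivAt_of_contDiffAt (contDiffAt_deriv hC)).div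
    (hsqrt.self_of_nhds.const_mul 2) (by positivity)).neg).div (hsqrt.self_of_nhds.pow 2)
    (pow_ne_zero 2 hr.ne')).deriv]
  simp only [Pi.div_apply, Pi.neg_apply, Pi.pow_apply]
  generalize √(C z) = r at *
  rw [← hrr]
  field_simp
  ring

end ReducedOperators

/-! ## Connection coefficients -/

lemma xor_left_comm (a b c : Fin 4) : a ^^^ (b ^^^ c) = b ^^^ (a ^^^ c) := by
  rw [← Fin.xor_assoc (n := 2) rfl, Fin.xor_comm a b, Fin.xor_assoc (n := 2) rfl]

/-- The structure constant in `[E_a, E_b] = bracketCoeff a b • E_{a ^^^ b}`. The frame is graded by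
the Klein four-group, realized on the indices as bitwise exclusive or, and the components of every
invariant tensor respect the grading. -/
def bracketCoeff (a b : Fin 4) : ℝ := !![0, 0, 0, 0; 0, 0, 2, -2; 0, -2, 0, 2; 0, 2, -2, 0] a b

lemma bracket_eq (a b k : Fin 4) :
    bracket a b k = if k = a ^^^ b then bracketCoeff a b else 0 := by
  fin_cases a <;> fin_cases b <;> fin_cases k <;> simp [bracket, bracketCoeff]

/-- The connection coefficient in `∇_{E_a} E_b = connCoeff F C a b • E_{a ^^^ b}`. -/
def connCoeff (F C : ℝ → ℝ) (a b : Fin 4) (z : ℝ) : ℝ :=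
  !![(logDeriv C z - deriv F z / F z) / 2, (logDeriv C z + deriv F z / F z) / 2,
      logDeriv C z / 2, logDeriv C z / 2;
    (logDeriv C z + deriv F z / F z) / 2, -2 * F z * (deriv F z + F z * logDeriv C z),
      2 - F z, F z - 2;
    logDeriv C z / 2, -F z, -2 * F z * logDeriv C z, 1;
    logDeriv C z / 2, F z, -1, -2 * F z * logDeriv C z] a b

/-- The logarithmic derivatives of the diagonal entries of the metric. -/
def gDiagLogDeriv (F C : ℝ → ℝ) (a : Fin 4) (z : ℝ) : ℝ :=
  ![logDeriv C z - deriv F z / F z, logDeriv C z + deriv F z / F z, logDeriv C z, logDeriv C z] a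

lemma sum_mul_g (F C : ℝ → ℝ) (T : Fin 4 → ℝ) (k : Fin 4) (z : ℝ) :
    ∑ l, T l * g F C l k z = T k * gDiag F C k z := by
  simp [g]

lemma sum_mul_gInv (F C : ℝ → ℝ) (T : Fin 4 → ℝ) (k : Fin 4) (z : ℝ) :
    ∑ l, T l * gInv F C l k z = T k * (gDiag F C k z)⁻¹ := by
  simp [gInv]

lemma sum_sum_gInv_mul (F C : ℝ → ℝ) (T : Fin 4 → Fin 4 → ℝ) (z : ℝ) :
    ∑ p, ∑ q, gInv F C p q z * T p q = ∑ p, T p p / gDiag F C p z := by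
  simp [gInv, div_eq_inv_mul]

namespace IsMetricOn

variable {F C : ℝ → ℝ} {I : Set ℝ} {z : ℝ}

lemma mem_nhds (hm : IsMetricOn F C I) (hz : z ∈ I) : I ∈ nhds z := hm.1.mem_nhds hz

lemma contDiffAt_F (hm : IsMetricOn F C I) (hz : z ∈ I) : ContDiffAt ℝ ∞ F z :=
  hm.2.1.contDiffAt (hm.mem_nhds hz)

lemma contDiffAt_C (hm : IsMetricOn F C I) (hz : z ∈ I) : ContDiffAt ℝ ∞ C z :=
  hm.2.2.1.contDiffAt (hm.mem_nhds hz)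

lemma F_pos (hm : IsMetricOn F C I) (hz : z ∈ I) : 0 < F z := (hm.2.2.2 z hz).1

lemma C_pos (hm : IsMetricOn F C I) (hz : z ∈ I) : 0 < C z := (hm.2.2.2 z hz).2

lemma contDiffAt_logDeriv_C (hm : IsMetricOn F C I) (hz : z ∈ I) :
    ContDiffAt ℝ ∞ (logDeriv C) z :=
  (contDiffAt_deriv (hm.contDiffAt_C hz)).div (hm.contDiffAt_C hz) (hm.C_pos hz).ne'

lemma gDiag_pos (hm : IsMetricOn F C I) (hz : z ∈ I) (a : Fin 4) : 0 < gDiag F C a z := by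
  have hF := hm.F_pos hz
  have hC := hm.C_pos hz
  fin_cases a
  · exact div_pos hC (by positivity)
  · exact mul_pos hC hF
  all_goals exact hC

lemma hasDerivAt_gDiag (hm : IsMetricOn F C I) (hz : z ∈ I) (a : Fin 4) :
    HasDerivAt (gDiag F C a) (gDiag F C a z * gDiagLogDeriv F C a z) z := by
  have hF := hasDerivAt_of_contDiffAt (hm.contDiffAt_F hz)
  have hC := hasDerivAt_of_contDiffAt (hm.contDiffAt_C hz)
  have hF₀ := hm.F_pos hz
  have hC₀ := hm.C_pos hz
  fin_cases a
  · exact (hC.div (hF.const_mul 4) (by positivity)).congr_deriv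
      (by simp [gDiag, gDiagLogDeriv, logDeriv_apply]; field_simp)
  · exact (hC.mul hF).congr_deriv (by simp [gDiag, gDiagLogDeriv, logDeriv_apply]; field_simp)
  all_goals exact hC.congr_deriv (by simp [gDiag, gDiagLogDeriv, logDeriv_apply]; field_simp)

lemma D_g (hm : IsMetricOn F C I) (hz : z ∈ I) (a b c : Fin 4) :
    D a (g F C b c) z =
      if a = 0 ∧ b = c then gDiag F C b z * gDiagLogDeriv F C b z else 0 := by
  by_cases hbc : b = c
  · subst hbc
    have hg : g F C b b = gDiag F C b := by ext; simp [g]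
    simp [D, hg, (hm.hasDerivAt_gDiag hz b).deriv]
  · have hg : g F C b c = fun _ => 0 := by ext; simp [g, hbc]
    simp [D, hg, hbc]

lemma conn_eq (hm : IsMetricOn F C I) (hz : z ∈ I) (a b k : Fin 4) :
    conn F C a b k z = if k = a ^^^ b then connCoeff F C a b z else 0 := by
  have hF := hm.F_pos hz
  have hC := hm.C_pos hz
  rw [conn, sum_mul_gInv, connLower, hm.D_g hz, hm.D_g hz, hm.D_g hz]
  simp only [Finset.sum_sub_distrib, sum_mul_g]
  rw [← div_eq_mul_inv, div_eq_iff (hm.gDiag_pos hz k).ne']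
  fin_cases a <;> fin_cases b <;> fin_cases k <;>
    simp [bracket_eq, bracketCoeff, connCoeff, gDiagLogDeriv, gDiag] <;> field_simp <;> ring

lemma deriv_connCoeff (hm : IsMetricOn F C I) (hz : z ∈ I) (a b : Fin 4) :
    deriv (connCoeff F C a b) z =
      !![(deriv (logDeriv C) z - (deriv (deriv F) z * F z - deriv F z * deriv F z) / F z ^ 2) / 2,
          (deriv (logDeriv C) z + (deriv (deriv F) z * F z - deriv F z * deriv F z) / F z ^ 2) / 2,
          deriv (logDeriv C) z / 2, deriv (logDeriv C) z / 2;
        (deriv (logDeriv C) z + (deriv (deriv F) z * F z - deriv F z * deriv F z) / F z ^ 2) / 2,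
          -2 * deriv F z * (deriv F z + F z * logDeriv C z) - 2 * F z *
            (deriv (deriv F) z + (deriv F z * logDeriv C z + F z * deriv (logDeriv C) z)),
          -deriv F z, deriv F z;
        deriv (logDeriv C) z / 2, -deriv F z,
          -2 * deriv F z * logDeriv C z - 2 * F z * deriv (logDeriv C) z, 0;
        deriv (logDeriv C) z / 2, deriv F z, 0,
          -2 * deriv F z * logDeriv C z - 2 * F z * deriv (logDeriv C) z] a b := by
  have hF := hasDerivAt_of_contDiffAt (hm.contDiffAt_F hz)
  have hF' := hasDerivAt_of_contDiffAt (contDiffAt_deriv (hm.contDiffAt_F hz))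
  have hC := hasDerivAt_of_contDiffAt (hm.contDiffAt_logDeriv_C hz)
  have hlogF := hF'.div hF (hm.F_pos hz).ne'
  have hF2 := hF.const_mul (-2)
  apply HasDerivAt.deriv
  fin_cases a <;> fin_cases b
  · exact (hC.sub hlogF).div_const 2
  · exact (hC.add hlogF).div_const 2
  · exact hC.div_const 2
  · exact hC.div_const 2
  · exact (hC.add hlogF).div_const 2
  · exact (hF2.mul (hF'.add (hF.mul hC))).congr_deriv (by simp; ring)
  · exact hF.const_sub 2
  · exact hF.sub_const 2
  · exact hC.div_const 2
  · exact hF.neg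
  · exact (hF2.mul hC).congr_deriv (by simp; ring)
  · exact hasDerivAt_const z 1
  · exact hC.div_const 2
  · exact hF
  · exact hasDerivAt_const z (-1)
  · exact (hF2.mul hC).congr_deriv (by simp; ring)

end IsMetricOn

/-! ## Curvature -/

/-- The curvature component in `R(E_a, E_b) E_c = curvCoeff F C a b c • E_{a ^^^ b ^^^ c}`. -/
def curvCoeff (F C : ℝ → ℝ) (a b c : Fin 4) (z : ℝ) : ℝ :=
  D a (connCoeff F C b c) z - D b (connCoeff F C a c) z
    + (connCoeff F C b c z * connCoeff F C a (b ^^^ c) z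
      - connCoeff F C a c z * connCoeff F C b (a ^^^ c) z
      - bracketCoeff a b * connCoeff F C (a ^^^ b) c z)

/-- The diagonal entries of the Ricci tensor. -/
def ricDiag (F C : ℝ → ℝ) (i : Fin 4) (z : ℝ) : ℝ :=
  ![-(3 / 2) * deriv (logDeriv C) z - logDeriv C z * deriv F z / F z
      - deriv (deriv F) z / (2 * F z),
    F z * (2 * F z - 2 * F z * deriv (logDeriv C) z - 2 * deriv (deriv F) z
      - 4 * deriv F z * logDeriv C z - 2 * F z * logDeriv C z ^ 2),
    4 - 2 * F z - 2 * F z * deriv (logDeriv C) z - 2 * deriv F z * logDeriv C z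
      - 2 * F z * logDeriv C z ^ 2,
    4 - 2 * F z - 2 * F z * deriv (logDeriv C) z - 2 * deriv F z * logDeriv C z
      - 2 * F z * logDeriv C z ^ 2] i

/-- The function `F'' + 2 F - 2`, to which the components `W(E_a, E_b, E_b, E_a)` of the Weyl tensor
are proportional. -/
def weylFactor (F : ℝ → ℝ) (z : ℝ) : ℝ := deriv (deriv F) z + 2 * F z - 2

/-- The components `W(E_a, E_b, E_b, E_a) / C` of the Weyl tensor. -/
def weylPair (F : ℝ → ℝ) (a b : Fin 4) (z : ℝ) : ℝ :=
  !![0, -weylFactor F z / 6, weylFactor F z / (12 * F z), weylFactor F z / (12 * F z);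
    -weylFactor F z / 6, 0, F z * weylFactor F z / 3, F z * weylFactor F z / 3;
    weylFactor F z / (12 * F z), F z * weylFactor F z / 3, 0, -2 * weylFactor F z / 3;
    weylFactor F z / (12 * F z), F z * weylFactor F z / 3, -2 * weylFactor F z / 3, 0] a b

/-- The components `W(E_a, E_b, E_c, E_d) / (C F')` of the Weyl tensor with `a`, `b`, `c`, `d`
distinct. -/
def weylMixed (a : Fin 4) : Matrix (Fin 4) (Fin 4) ℝ :=
  ![!![0, 0, 0, 0; 0, 0, -1, 1; 0, -1 / 2, 0, 1 / 2; 0, 1 / 2, -1 / 2, 0],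
    !![0, 0, 1, -1; 0, 0, 0, 0; 1 / 2, 0, 0, -1 / 2; -1 / 2, 0, 1 / 2, 0],
    !![0, 1 / 2, 0, -1 / 2; -1 / 2, 0, 0, 1 / 2; 0, 0, 0, 0; -1, 1, 0, 0],
    !![0, -1 / 2, 1 / 2, 0; 1 / 2, 0, -1 / 2, 0; 1, -1, 0, 0; 0, 0, 0, 0]] a

/-- The components `W(E_a, E_b, E_c, E_{a ^^^ b ^^^ c}) / C` of the Weyl tensor. -/
def weylCoeff (F : ℝ → ℝ) (a b c : Fin 4) (z : ℝ) : ℝ :=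
  weylPair F a b z * ((if c = b then 1 else 0) - (if c = a then 1 else 0))
    + deriv F z * weylMixed a b c

namespace IsMetricOn

variable {F C : ℝ → ℝ} {I : Set ℝ} {z : ℝ}

lemma D_conn (hm : IsMetricOn F C I) (hz : z ∈ I) (a b c k : Fin 4) :
    D a (conn F C b c k) z = if k = b ^^^ c then D a (connCoeff F C b c) z else 0 := by
  have hconn : deriv (conn F C b c k) z =
      deriv (fun x => if k = b ^^^ c then connCoeff F C b c x else 0) z :=
    EqOn.deriv (fun x hx => hm.conn_eq hx b c k) hm.1 hz
  simp only [D, hconn]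
  split_ifs <;> simp

lemma curvUp_eq (hm : IsMetricOn F C I) (hz : z ∈ I) (a b c k : Fin 4) :
    curvUp F C a b c k z = if k = a ^^^ b ^^^ c then curvCoeff F C a b c z else 0 := by
  have hD : ∀ p q : Fin 4, (if k = q ^^^ c then D p (connCoeff F C q c) z else 0)
      = if k = p ^^^ q ^^^ c then D p (connCoeff F C q c) z else 0 := by
    intro p q
    by_cases hp : p = 0
    · have : (0 : Fin 4) ^^^ q ^^^ c = q ^^^ c := by revert q c; decide
      simp [hp, this]
    · simp [D, hp]
  simp only [curvUp, hm.D_conn hz, hm.conn_eq hz, bracket_eq, Finset.sum_sub_distrib, ite_mul,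
    zero_mul, Finset.sum_ite_eq', Finset.mem_univ, if_true, hD, Fin.xor_assoc (n := 2) rfl,
    xor_left_comm b a c, curvCoeff]
  split_ifs <;> simp

lemma riem_eq (hm : IsMetricOn F C I) (hz : z ∈ I) (a b c d : Fin 4) :
    riem F C a b c d z =
      if d = a ^^^ b ^^^ c then curvCoeff F C a b c z * gDiag F C d z else 0 := by
  rw [riem, sum_mul_g, hm.curvUp_eq hz, ite_mul, zero_mul]

lemma sum_curvCoeff (hm : IsMetricOn F C I) (hz : z ∈ I) (i : Fin 4) :
    ∑ p, curvCoeff F C p i i z = ricDiag F C i z := by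
  have hF := (hm.F_pos hz).ne'
  fin_cases i <;>
    simp [Fin.sum_univ_four, curvCoeff, D, hm.deriv_connCoeff hz, connCoeff, bracketCoeff,
      ricDiag] <;>
    field_simp <;> ring

lemma ric_eq (hm : IsMetricOn F C I) (hz : z ∈ I) (i j : Fin 4) :
    ric F C i j z = if i = j then ricDiag F C i z else 0 := by
  have hxor : ∀ p : Fin 4, p = p ^^^ i ^^^ j ↔ i = j := by revert i j; decide
  simp only [ric, sum_sum_gInv_mul, hm.riem_eq hz, hxor]
  split_ifs with hij
  · subst hij
    rw [← hm.sum_curvCoeff hz]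
    exact Finset.sum_congr rfl fun p _ => mul_div_cancel_right₀ _ (hm.gDiag_pos hz p).ne'
  · simp

lemma scal_eq (hm : IsMetricOn F C I) (hz : z ∈ I) :
    scal F C z = (8 - 2 * F z - 4 * deriv (deriv F) z - 12 * deriv F z * logDeriv C z
      - 12 * F z * deriv (logDeriv C) z - 6 * F z * logDeriv C z ^ 2) / C z := by
  have hF := hm.F_pos hz
  have hC := hm.C_pos hz
  simp only [scal, sum_sum_gInv_mul, hm.ric_eq hz, if_true]
  simp [Fin.sum_univ_four, gDiag, ricDiag]
  field_simp
  ring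

lemma weyl_eq_of_xor (hm : IsMetricOn F C I) (hz : z ∈ I) (a b c : Fin 4) :
    weyl F C a b c (a ^^^ b ^^^ c) z = C z * weylCoeff F a b c z := by
  have hF := (hm.F_pos hz).ne'
  have hC := (hm.C_pos hz).ne'
  simp only [weyl, hm.riem_eq hz, hm.ric_eq hz, hm.scal_eq hz, g, if_true]
  fin_cases a <;> fin_cases b <;> fin_cases c <;>
    simp [curvCoeff, D, hm.deriv_connCoeff hz, connCoeff, bracketCoeff, weylCoeff, weylPair,
      weylFactor, weylMixed, ricDiag, gDiag] <;>
    field_simp <;> ring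

lemma weyl_eq (hm : IsMetricOn F C I) (hz : z ∈ I) (a b c d : Fin 4) :
    weyl F C a b c d z = if d = a ^^^ b ^^^ c then C z * weylCoeff F a b c z else 0 := by
  split_ifs with hd
  · rw [hd, hm.weyl_eq_of_xor hz]
  · have had : ¬ (a = d ∧ b = c) := by revert a b c d; decide
    have hac : ¬ (a = c ∧ b = d) := by revert a b c d; decide
    rw [weyl, hm.riem_eq hz, if_neg hd]
    simp only [hm.ric_eq hz, g]
    split_ifs <;> simp_all

end IsMetricOn

/-! ## The Bach tensor and the Euler-Lagrange tensor -/

/-- The component of the divergence of the Weyl tensor with one index normal to the orbits of the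
action. -/
def divWeylNormal (F C : ℝ → ℝ) (z : ℝ) : ℝ :=
  deriv (deriv (deriv F)) z - 5 / 2 * deriv F z + logDeriv C z * weylFactor F z / 2

/-- The component of the divergence of the Weyl tensor with all indices tangent to the orbits of the
action. -/
def divWeylTangential (F C : ℝ → ℝ) (z : ℝ) : ℝ :=
  -deriv (deriv F) z + 2 * F z - 2 - deriv F z * logDeriv C z

/-- The components `(∇^q W)(E_b, E_c, E_{b ^^^ c}, E_q)` of the divergence of the Weyl tensor. -/
def divWeylCoeff (F C : ℝ → ℝ) (b c : Fin 4) (z : ℝ) : ℝ :=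
  !![0, -(2 / 3) * (F z * divWeylNormal F C z), divWeylNormal F C z / 3, divWeylNormal F C z / 3;
    2 / 3 * (F z * divWeylNormal F C z), 0, F z * divWeylTangential F C z,
      -(F z * divWeylTangential F C z);
    -divWeylNormal F C z / 3, -(F z * divWeylTangential F C z), 0,
      -2 * (F z * divWeylTangential F C z);
    -divWeylNormal F C z / 3, F z * divWeylTangential F C z, 2 * (F z * divWeylTangential F C z),
      0] b c

namespace IsMetricOn

variable {F C : ℝ → ℝ} {I : Set ℝ} {z : ℝ}

lemma hasDerivAt_weylFactor (hm : IsMetricOn F C I) (hz : z ∈ I) :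
    HasDerivAt (weylFactor F) (deriv (deriv (deriv F)) z + 2 * deriv F z) z := by
  have hF := hm.contDiffAt_F hz
  have hF'' := contDiffAt_deriv (contDiffAt_deriv hF)
  exact ((hasDerivAt_of_contDiffAt hF'').add
    ((hasDerivAt_of_contDiffAt hF).const_mul 2)).sub_const 2

lemma hasDerivAt_weylPair (hm : IsMetricOn F C I) (hz : z ∈ I) (a b : Fin 4) :
    HasDerivAt (weylPair F a b)
      (!![0, -deriv (weylFactor F) z / 6,
          (deriv (weylFactor F) z - weylFactor F z * deriv F z / F z) / (12 * F z),
          (deriv (weylFactor F) z - weylFactor F z * deriv F z / F z) / (12 * F z);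
        -deriv (weylFactor F) z / 6, 0,
          (deriv F z * weylFactor F z + F z * deriv (weylFactor F) z) / 3,
          (deriv F z * weylFactor F z + F z * deriv (weylFactor F) z) / 3;
        (deriv (weylFactor F) z - weylFactor F z * deriv F z / F z) / (12 * F z),
          (deriv F z * weylFactor F z + F z * deriv (weylFactor F) z) / 3, 0,
          -2 * deriv (weylFactor F) z / 3;
        (deriv (weylFactor F) z - weylFactor F z * deriv F z / F z) / (12 * F z),
          (deriv F z * weylFactor F z + F z * deriv (weylFactor F) z) / 3,
          -2 * deriv (weylFactor F) z / 3, 0] a b) z := by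
  have hF := hasDerivAt_of_contDiffAt (hm.contDiffAt_F hz)
  have hF₀ := (hm.F_pos hz).ne'
  have hP := (hm.hasDerivAt_weylFactor hz).differentiableAt.hasDerivAt
  have hzero : HasDerivAt (fun _ : ℝ => (0 : ℝ)) 0 z := hasDerivAt_const z 0
  have hFP := (hF.mul hP).div_const 3
  have hP₂ := (hP.const_mul (-2)).div_const 3
  have hP₆ := hP.neg.div_const 6
  have hPF : HasDerivAt (fun x => weylFactor F x / (12 * F x))
      ((deriv (weylFactor F) z - weylFactor F z * deriv F z / F z) / (12 * F z)) z :=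
    (hP.div (hF.const_mul 12) (by positivity)).congr_deriv (by field_simp)
  fin_cases a <;> fin_cases b
  exacts [hzero, hP₆, hPF, hPF, hP₆, hzero, hFP, hFP, hPF, hFP, hzero, hP₂, hPF, hFP, hP₂, hzero]

lemma hasDerivAt_weylCoeff (hm : IsMetricOn F C I) (hz : z ∈ I) (a b c : Fin 4) :
    HasDerivAt (weylCoeff F a b c)
      (deriv (weylPair F a b) z * ((if c = b then 1 else 0) - (if c = a then 1 else 0))
        + deriv (deriv F) z * weylMixed a b c) z :=
  ((hm.hasDerivAt_weylPair hz a b).differentiableAt.hasDerivAt.mul_const _).add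
    ((hasDerivAt_of_contDiffAt (contDiffAt_deriv (hm.contDiffAt_F hz))).mul_const _)

lemma D_weyl (hm : IsMetricOn F C I) (hz : z ∈ I) (a b c d e : Fin 4) :
    D a (weyl F C b c d e) z = if e = b ^^^ c ^^^ d then
      D a (fun x => C x * weylCoeff F b c d x) z else 0 := by
  have hweyl : deriv (weyl F C b c d e) z =
      deriv (fun x => if e = b ^^^ c ^^^ d then C x * weylCoeff F b c d x else 0) z :=
    EqOn.deriv (fun x hx => hm.weyl_eq hx b c d e) hm.1 hz
  simp only [D, hweyl]
  split_ifs <;> simp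

lemma covDeriv4_weyl (hm : IsMetricOn F C I) (hz : z ∈ I) (p b c d : Fin 4) :
    covDeriv4 F C (weyl F C) p b c d p z = if d = b ^^^ c then
      D p (fun x => C x * weylCoeff F b c d x) z
        - C z * (connCoeff F C p b z * weylCoeff F (p ^^^ b) c d z
          + connCoeff F C p c z * weylCoeff F b (p ^^^ c) d z
          + connCoeff F C p d z * weylCoeff F b c (p ^^^ d) z
          + connCoeff F C p p z * weylCoeff F b c d z) else 0 := by
  have h₁ : p = p ^^^ b ^^^ c ^^^ d ↔ d = b ^^^ c := by revert p b c d; decide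
  have h₂ : p = b ^^^ (p ^^^ c) ^^^ d ↔ d = b ^^^ c := by revert p b c d; decide
  have h₃ : p = b ^^^ c ^^^ (p ^^^ d) ↔ d = b ^^^ c := by revert p b c d; decide
  have h₄ : p ^^^ p = b ^^^ c ^^^ d ↔ d = b ^^^ c := by revert p b c d; decide
  have hD : D p (weyl F C b c d p) z =
      if d = b ^^^ c then D p (fun x => C x * weylCoeff F b c d x) z else 0 := by
    have h₀ : p = 0 → (p = b ^^^ c ^^^ d ↔ d = b ^^^ c) := by revert p b c d; decide
    by_cases hp : p = 0
    · rw [hm.D_weyl hz]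
      simp only [h₀ hp]
    · simp [D, hp]
  simp only [covDeriv4, hD, hm.conn_eq hz, ite_mul, zero_mul, Finset.sum_add_distrib,
    Finset.sum_ite_eq', Finset.mem_univ, if_true, hm.weyl_eq hz, h₁, h₂, h₃, h₄]
  split_ifs
  · ring
  · simp

lemma divWeyl_eq (hm : IsMetricOn F C I) (hz : z ∈ I) (b c d : Fin 4) :
    divWeyl F C b c d z = if d = b ^^^ c then divWeylCoeff F C b c z else 0 := by
  have hF := (hm.F_pos hz).ne'
  have hC := (hm.C_pos hz).ne'
  have hD (b c d : Fin 4) : deriv (fun x => C x * weylCoeff F b c d x) z = _ :=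
    ((hasDerivAt_of_contDiffAt (hm.contDiffAt_C hz)).mul (hm.hasDerivAt_weylCoeff hz b c d)).deriv
  simp only [divWeyl, sum_sum_gInv_mul, hm.covDeriv4_weyl hz]
  split_ifs with hd
  · subst hd
    simp only [Fin.sum_univ_four, D, hD]
    fin_cases b <;> fin_cases c <;>
      simp [(hm.hasDerivAt_weylPair hz _ _).deriv,
        (hm.hasDerivAt_weylFactor hz).deriv, divWeylCoeff, connCoeff, weylCoeff, weylPair,
        weylMixed, gDiag, divWeylNormal, divWeylTangential, weylFactor, logDeriv_apply,
        -mul_eq_zero, -div_eq_zero_iff] <;>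
      field_simp <;> ring
  · simp

lemma hasDerivAt_divWeylNormal (hm : IsMetricOn F C I) (hz : z ∈ I) :
    HasDerivAt (divWeylNormal F C)
      (deriv (deriv (deriv (deriv F))) z - 5 / 2 * deriv (deriv F) z
        + (deriv (logDeriv C) z * weylFactor F z
          + logDeriv C z * (deriv (deriv (deriv F)) z + 2 * deriv F z)) / 2) z := by
  have hF' := contDiffAt_deriv (hm.contDiffAt_F hz)
  have hF''' := contDiffAt_deriv (contDiffAt_deriv hF')
  exact ((hasDerivAt_of_contDiffAt hF''').sub
    ((hasDerivAt_of_contDiffAt hF').const_mul (5 / 2))).add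
    (((hasDerivAt_of_contDiffAt (hm.contDiffAt_logDeriv_C hz)).mul
      (hm.hasDerivAt_weylFactor hz)).div_const 2)

lemma deriv_divWeylCoeff_zero (hm : IsMetricOn F C I) (hz : z ∈ I) (i : Fin 4) :
    deriv (divWeylCoeff F C 0 i) z =
      ![0, -(2 / 3) * (deriv F z * divWeylNormal F C z + F z * deriv (divWeylNormal F C) z),
        deriv (divWeylNormal F C) z / 3, deriv (divWeylNormal F C) z / 3] i := by
  have hA := (hm.hasDerivAt_divWeylNormal hz).differentiableAt.hasDerivAt
  apply HasDerivAt.deriv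
  fin_cases i
  · exact hasDerivAt_const z 0
  · exact ((hasDerivAt_of_contDiffAt (hm.contDiffAt_F hz)).mul hA).const_mul (-(2 / 3))
  all_goals exact hA.div_const 3

lemma D_divWeyl (hm : IsMetricOn F C I) (hz : z ∈ I) (p i j : Fin 4) :
    D p (divWeyl F C p i j) z = if i = j then D p (divWeylCoeff F C p i) z else 0 := by
  by_cases hp : p = 0
  · subst hp
    have hij : j = 0 ^^^ i ↔ i = j := by revert i j; decide
    have hdiv : deriv (divWeyl F C 0 i j) z =
        deriv (fun x => if i = j then divWeylCoeff F C 0 i x else 0) z :=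
      EqOn.deriv (fun x hx => by simpa only [hij] using hm.divWeyl_eq hx 0 i j) hm.1 hz
    simp only [D, hdiv]
    split_ifs <;> simp
  · simp [D, hp]

lemma covDeriv3_divWeyl (hm : IsMetricOn F C I) (hz : z ∈ I) (p i j : Fin 4) :
    covDeriv3 F C (divWeyl F C) p p i j z = if i = j then D p (divWeylCoeff F C p i) z
      - (connCoeff F C p p z * divWeylCoeff F C 0 i z
        + connCoeff F C p i z * divWeylCoeff F C p (p ^^^ i) z
        + connCoeff F C p i z * divWeylCoeff F C p i z) else 0 := by
  have h₀ : p ^^^ p = 0 := by revert p; decide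
  have h₁ : j = 0 ^^^ i ↔ i = j := by revert i j; decide
  have h₂ : j = p ^^^ (p ^^^ i) ↔ i = j := by revert p i j; decide
  have h₃ : p ^^^ j = p ^^^ i ↔ i = j := by revert p i j; decide
  simp only [covDeriv3, hm.D_divWeyl hz, hm.conn_eq hz, ite_mul, zero_mul, Finset.sum_add_distrib,
    Finset.sum_ite_eq', Finset.mem_univ, if_true, h₀, hm.divWeyl_eq hz, h₁, h₂, h₃]
  split_ifs with hij
  · rw [hij]
  · simp

lemma sum_weyl_mul_ric (hm : IsMetricOn F C I) (hz : z ∈ I) (i j : Fin 4) :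
    ∑ p, ∑ q, ∑ k, ∑ l, gInv F C p k z * gInv F C q l z * weyl F C p i j q z * ric F C k l z =
      if i = j then ∑ p, C z * weylCoeff F p i i z * ricDiag F C p z / gDiag F C p z ^ 2
      else 0 := by
  have hij : ∀ p : Fin 4, p = p ^^^ i ^^^ j ↔ i = j := by revert i j; decide
  have hraise : ∀ (p q : Fin 4) (x : ℝ),
      ∑ k, ∑ l, gInv F C p k z * gInv F C q l z * x * ric F C k l z
        = if p = q then x * ricDiag F C p z / (gDiag F C p z * gDiag F C q z) else 0 := by
    intro p q x
    simp only [gInv, hm.ric_eq hz, ite_mul, zero_mul, mul_ite, mul_zero, Finset.sum_ite_eq,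
      Finset.mem_univ, if_true]
    split_ifs with hpq
    · rw [hpq]
      ring
    · rfl
  simp only [hraise, Finset.sum_ite_eq, Finset.mem_univ, if_true, hm.weyl_eq hz, hij]
  split_ifs with h
  · simp [h, sq]
  · simp

lemma bach_eq (hm : IsMetricOn F C I) (hz : z ∈ I) (i j : Fin 4) :
    bach F C i j z = if i = j then -(8 / 3) * gDiag F C i z / C z ^ 2 *
      ![opB F z, opB F z + 4 * F z * (Lplus (Lminus F) z - 1),
        -opB F z - 2 * F z * (Lplus (Lminus F) z - 1),
        -opB F z - 2 * F z * (Lplus (Lminus F) z - 1)] i else 0 := by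
  have hF := (hm.F_pos hz).ne'
  have hC := (hm.C_pos hz).ne'
  have hsum : ∑ p, ∑ q, gInv F C p q z * covDeriv3 F C (divWeyl F C) q p i j z
      = ∑ p, ∑ q, gInv F C p q z * covDeriv3 F C (divWeyl F C) p p i j z := by
    simp only [gInv, ite_mul, zero_mul, Finset.sum_ite_eq, Finset.mem_univ, if_true]
  rw [bach, hsum]
  simp only [sum_sum_gInv_mul, hm.covDeriv3_divWeyl hz, hm.sum_weyl_mul_ric hz]
  split_ifs with hij
  · subst hij
    simp only [Fin.sum_univ_four, D, hm.deriv_divWeylCoeff_zero hz,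
      (hm.hasDerivAt_divWeylNormal hz).deriv, opB_eq (hm.contDiffAt_F hz),
      Lplus_Lminus (hm.contDiffAt_F hz)]
    fin_cases i <;>
      simp [divWeylCoeff, connCoeff, divWeylNormal, divWeylTangential, weylCoeff, weylPair,
        weylMixed, weylFactor, ricDiag, gDiag, -mul_eq_zero] <;>
      field_simp <;> ring
  · simp

lemma hess_eq (hm : IsMetricOn F C I) (hz : z ∈ I) (f : ℝ → ℝ) (i j : Fin 4) :
    hess F C f i j z = if i = j then
      (if i = 0 then deriv (deriv f) z else 0) - connCoeff F C i i z * deriv f z else 0 := by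
  have hxor : 0 = i ^^^ j ↔ i = j := by revert i j; decide
  have hDD : D i (D j f) z = if i = j then if i = 0 then deriv (deriv f) z else 0 else 0 := by
    have hD₀ : D 0 f = deriv f := by ext; simp [D]
    by_cases hi : i = 0 <;> by_cases hj : j = 0
    · simp [hi, hj, D, hD₀]
    · have hDj : D j f = fun _ => 0 := by ext; simp [D, hj]
      simp [hi, hDj, Ne.symm hj, D]
    all_goals simp [D, hi]
  simp only [hess, covDeriv1, hm.conn_eq hz]
  rw [hDD]
  simp only [D, ite_mul, zero_mul, mul_ite, mul_zero, Finset.sum_ite_eq', Finset.mem_univ,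
    if_true, hxor]
  split_ifs with hij <;> simp [hij]

lemma lap_eq (hm : IsMetricOn F C I) (hz : z ∈ I) (f : ℝ → ℝ) :
    lap F C f z = 4 / C z * (F z * deriv (deriv f) z
      + (deriv F z + F z * logDeriv C z) * deriv f z) := by
  have hF := hm.F_pos hz
  have hC := hm.C_pos hz
  simp only [lap, sum_sum_gInv_mul, hm.hess_eq hz, if_true]
  simp [Fin.sum_univ_four, gDiag, connCoeff]
  field_simp
  ring

lemma deriv_logDeriv_C (hm : IsMetricOn F C I) (hz : z ∈ I) :
    deriv (logDeriv C) z = deriv (deriv C) z / C z - (deriv C z / C z) ^ 2 := by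
  have hC := hm.contDiffAt_C hz
  have hC₀ := (hm.C_pos hz).ne'
  rw [logDeriv, ((hasDerivAt_of_contDiffAt (contDiffAt_deriv hC)).div
    (hasDerivAt_of_contDiffAt hC) hC₀).deriv]
  field_simp

lemma contDiffAt_scal (hm : IsMetricOn F C I) (hz : z ∈ I) : ContDiffAt ℝ ∞ (scal F C) z := by
  have hF := hm.contDiffAt_F hz
  have hF' := contDiffAt_deriv hF
  have hF'' := contDiffAt_deriv hF'
  have hC := hm.contDiffAt_C hz
  have hL := hm.contDiffAt_logDeriv_C hz
  have hL' := contDiffAt_deriv hL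
  have hC₀ := (hm.C_pos hz).ne'
  refine ContDiffAt.congr_of_eventuallyEq (ContDiffAt.div (by fun_prop) hC hC₀)
    (Filter.eventually_of_mem (hm.mem_nhds hz) fun x hx => hm.scal_eq hx)

lemma opF1_eq_sub_scal (hm : IsMetricOn F C I) (hz : z ∈ I) (s : ℝ → ℝ) :
    opF1 F C s z = √(C z) ^ 3 * (s z - scal F C z) := by
  have hC := hm.C_pos hz
  have hr : 0 < √(C z) := Real.sqrt_pos.2 hC
  have hrr : √(C z) ^ 4 = C z ^ 2 := by
    rw [show 4 = 2 * 2 from rfl, pow_mul, Real.sq_sqrt hC.le]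
  apply mul_left_cancel₀ hr.ne'
  rw [sqrt_mul_opF1 (hm.contDiffAt_F hz) (hm.contDiffAt_C hz) hC, hm.scal_eq hz,
    hm.deriv_logDeriv_C hz, logDeriv_apply, ← mul_assoc, ← pow_succ', hrr]
  field_simp
  ring

lemma opF1_eq_zero_iff (hm : IsMetricOn F C I) (hz : z ∈ I) (s : ℝ → ℝ) :
    opF1 F C s z = 0 ↔ s z = scal F C z := by
  rw [hm.opF1_eq_sub_scal hz, mul_eq_zero_iff_left, sub_eq_zero]
  exact pow_ne_zero 3 (Real.sqrt_pos.2 (hm.C_pos hz)).ne'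

lemma btTensor_eq (t : ℝ) (hm : IsMetricOn F C I) (hz : z ∈ I) (i j : Fin 4) :
    btTensor t F C i j z = if i = j then gDiag F C i z / C z ^ 2 *
      ![2 / 3 * opT t F C (scal F C) z,
        2 / 3 * opT t F C (scal F C) z + 16 * F z * opF2 t F C (scal F C) z
          - 8 * t * opE F C (scal F C) z,
        -(2 / 3) * opT t F C (scal F C) z - 8 * F z * opF2 t F C (scal F C) z
          - 8 * t * opE F C (scal F C) z,
        -(2 / 3) * opT t F C (scal F C) z - 8 * F z * opF2 t F C (scal F C) z
          - 8 * t * opE F C (scal F C) z] i else 0 := by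
  have hF := (hm.F_pos hz).ne'
  have hC := (hm.C_pos hz).ne'
  simp only [btTensor, ricTF, g, hm.bach_eq hz, hm.hess_eq hz, hm.lap_eq hz, hm.ric_eq hz]
  by_cases hij : i = j
  · subst hij
    simp only [if_true]
    rw [opT, opF2_eq t (hm.contDiffAt_F hz) (hm.contDiffAt_C hz) (hm.C_pos hz),
      opE_eq (hm.contDiffAt_F hz) (hm.contDiffAt_C hz) (hm.contDiffAt_scal hz),
      Lplus_Lminus (hm.contDiffAt_F hz), hm.scal_eq hz]
    fin_cases i <;>
      simp [gDiag, ricDiag, connCoeff, hm.deriv_logDeriv_C hz, logDeriv_apply] <;>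
      field_simp <;> ring
  · simp [hij]

end IsMetricOn

/-! ## The reduced system as a vector field on the initial conditions -/

section ReducedField

variable {t z z₀ : ℝ} {F C s F' C' s' : ℝ → ℝ} {I : Set ℝ} {p : Fin 8 → ℝ}

/-- The value of `C''` prescribed by `F₁ = 0` in terms of the initial conditions. -/
def secondDerivC (p : Fin 8 → ℝ) : ℝ :=
  p 5 ^ 2 / (2 * p 4)
    - (12 * p 1 * p 5 + 4 * p 4 * (p 2 + p 0 / 2 - 2) + p 6 * p 4 ^ 2) / (12 * p 0)

/-- The value of `F''''` prescribed by `F₁ = F₂ = 0` in terms of the initial conditions. -/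
def fourthDerivF (t : ℝ) (p : Fin 8 → ℝ) : ℝ :=
  5 * p 2 - 4 * p 0 + 4
    - 3 / 2 * (t * p 6 * (-(secondDerivC p / 2) + 3 / 4 * (p 5 ^ 2 / p 4) - p 4 / 4)
      + t / 2 * (p 4 / p 0) * p 1 * p 7 + t * p 5 * p 7)

/-- The value of `s''` prescribed by `(C F s')' = 0` in terms of the initial conditions. -/
def secondDerivS (p : Fin 8 → ℝ) : ℝ := -((p 5 * p 0 + p 4 * p 1) * p 7) / (p 4 * p 0)

/-- The vector field on the space of initial conditions whose integral curves are the solutions of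
the reduced system. -/
def reducedField (t : ℝ) (p : Fin 8 → ℝ) : Fin 8 → ℝ :=
  ![p 1, p 2, p 3, fourthDerivF t p, p 5, secondDerivC p, p 7, secondDerivS p]

lemma opE_eq_zero_iff (hF : ContDiffAt ℝ ∞ F z) (hC : ContDiffAt ℝ ∞ C z)
    (hs : ContDiffAt ℝ ∞ s z) (hF₀ : F z ≠ 0) (hC₀ : C z ≠ 0) :
    opE F C s z = 0 ↔ deriv (deriv s) z = secondDerivS (cauchyData F C s z) := by
  simp only [opE_eq hF hC hs, secondDerivS, cauchyData, Matrix.cons_val,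
    eq_div_iff (mul_ne_zero hC₀ hF₀)]
  constructor <;> intro h <;> linarith

lemma opF1_eq_zero_iff (hF : ContDiffAt ℝ ∞ F z) (hC : ContDiffAt ℝ ∞ C z) (hF₀ : F z ≠ 0)
    (hC₀ : 0 < C z) :
    opF1 F C s z = 0 ↔ deriv (deriv C) z = secondDerivC (cauchyData F C s z) := by
  have hfactor : √(C z) * opF1 F C s z =
      12 * F z * (deriv (deriv C) z - secondDerivC (cauchyData F C s z)) := by
    have := hC₀.ne'
    simp only [sqrt_mul_opF1 hF hC hC₀, secondDerivC, cauchyData, Matrix.cons_val]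
    field_simp
    ring
  rw [← mul_eq_zero_iff_left (Real.sqrt_pos.2 hC₀).ne', hfactor,
    mul_eq_zero_iff_left (mul_ne_zero (by norm_num) hF₀), sub_eq_zero]

lemma opF2_eq_zero_iff (hF : ContDiffAt ℝ ∞ F z) (hC : ContDiffAt ℝ ∞ C z) (hC₀ : 0 < C z)
    (hC'' : deriv (deriv C) z = secondDerivC (cauchyData F C s z)) :
    opF2 t F C s z = 0 ↔
      deriv (deriv (deriv (deriv F))) z = fourthDerivF t (cauchyData F C s z) := by
  simp only [opF2_eq t hF hC hC₀, hC'', fourthDerivF, cauchyData, Matrix.cons_val]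
  constructor <;> intro h <;> linarith

lemma reduced_iff_highestDerivs_eq (hF : ContDiffAt ℝ ∞ F z) (hC : ContDiffAt ℝ ∞ C z)
    (hs : ContDiffAt ℝ ∞ s z) (hF₀ : F z ≠ 0) (hC₀ : 0 < C z) :
    (opE F C s z = 0 ∧ opF1 F C s z = 0 ∧ opF2 t F C s z = 0) ↔
      deriv (deriv (deriv (deriv F))) z = fourthDerivF t (cauchyData F C s z) ∧
      deriv (deriv C) z = secondDerivC (cauchyData F C s z) ∧
      deriv (deriv s) z = secondDerivS (cauchyData F C s z) := by
  rw [opE_eq_zero_iff hF hC hs hF₀ hC₀.ne', opF1_eq_zero_iff hF hC hF₀ hC₀]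
  constructor
  · rintro ⟨hs'', hC'', hF2⟩
    exact ⟨(opF2_eq_zero_iff hF hC hC₀ hC'').1 hF2, hC'', hs''⟩
  · rintro ⟨hF'''', hC'', hs''⟩
    exact ⟨hs'', hC'', (opF2_eq_zero_iff hF hC hC₀ hC'').2 hF''''⟩

lemma isOpen_admissible : IsOpen admissible :=
  (isOpen_ne_fun (continuous_apply 0) continuous_const).inter
    (isOpen_lt continuous_const (continuous_apply 4))

lemma contDiffAt_secondDerivC (hp : p ∈ admissible) : ContDiffAt ℝ ∞ secondDerivC p := by
  have hp₀ := hp.1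
  have hp₄ := hp.2.ne'
  unfold secondDerivC
  fun_prop (disch := simp [hp₀, hp₄])

lemma contDiffAt_fourthDerivF (t : ℝ) (hp : p ∈ admissible) :
    ContDiffAt ℝ ∞ (fourthDerivF t) p := by
  have hp₀ := hp.1
  have hp₄ := hp.2.ne'
  have := contDiffAt_secondDerivC hp
  unfold fourthDerivF
  fun_prop (disch := simp [hp₀, hp₄])

lemma contDiffAt_secondDerivS (hp : p ∈ admissible) : ContDiffAt ℝ ∞ secondDerivS p := by
  have hp₀ := hp.1
  have hp₄ := hp.2.ne'
  unfold secondDerivS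
  fun_prop (disch := simp [hp₀, hp₄])

lemma contDiffOn_reducedField (t : ℝ) : ContDiffOn ℝ ∞ (reducedField t) admissible := by
  refine fun p hp => (contDiffAt_pi.2 fun i => ?_).contDiffWithinAt
  have hcoord (j : Fin 8) : ContDiffAt ℝ ∞ (fun q : Fin 8 → ℝ => q j) p := contDiffAt_apply ..
  fin_cases i
  exacts [hcoord 1, hcoord 2, hcoord 3, contDiffAt_fourthDerivF t hp, hcoord 5,
    contDiffAt_secondDerivC hp, hcoord 7, contDiffAt_secondDerivS hp]

theorem exists_highest_derivatives (t : ℝ) :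
    ∃ Φ : (Fin 8 → ℝ) → (Fin 3 → ℝ), ContDiffOn ℝ ∞ Φ admissible ∧
      ∀ (F C s : ℝ → ℝ) (z : ℝ), ContDiffAt ℝ ∞ F z → ContDiffAt ℝ ∞ C z → ContDiffAt ℝ ∞ s z →
        F z ≠ 0 → 0 < C z →
        ((opE F C s z = 0 ∧ opF1 F C s z = 0 ∧ opF2 t F C s z = 0) ↔
          ![iteratedDeriv 4 F z, iteratedDeriv 2 C z, iteratedDeriv 2 s z]
            = Φ (cauchyData F C s z)) := by
  refine ⟨fun p => ![fourthDerivF t p, secondDerivC p, secondDerivS p],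
    fun p hp => (contDiffAt_pi.2 fun i => ?_).contDiffWithinAt, fun F C s z hF hC hs hF₀ hC₀ => ?_⟩
  · fin_cases i
    exacts [contDiffAt_fourthDerivF t hp, contDiffAt_secondDerivC hp, contDiffAt_secondDerivS hp]
  · rw [reduced_iff_highestDerivs_eq hF hC hs hF₀ hC₀]
    simp [iteratedDeriv_succ, iteratedDeriv_zero, funext_iff, Fin.forall_fin_succ]

namespace SolvesReduced

lemma isOpen (h : SolvesReduced t F C s I) : IsOpen I := h.1

lemma contDiffAt_F (h : SolvesReduced t F C s I) (hz : z ∈ I) : ContDiffAt ℝ ∞ F z :=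
  h.2.1.contDiffAt (h.isOpen.mem_nhds hz)

lemma contDiffAt_C (h : SolvesReduced t F C s I) (hz : z ∈ I) : ContDiffAt ℝ ∞ C z :=
  h.2.2.1.contDiffAt (h.isOpen.mem_nhds hz)

lemma contDiffAt_s (h : SolvesReduced t F C s I) (hz : z ∈ I) : ContDiffAt ℝ ∞ s z :=
  h.2.2.2.1.contDiffAt (h.isOpen.mem_nhds hz)

lemma ne_zero_and_pos (h : SolvesReduced t F C s I) (hz : z ∈ I) : F z ≠ 0 ∧ 0 < C z :=
  h.2.2.2.2.1 z hz

lemma equations (h : SolvesReduced t F C s I) (hz : z ∈ I) :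
    opE F C s z = 0 ∧ opF1 F C s z = 0 ∧ opF2 t F C s z = 0 :=
  h.2.2.2.2.2 z hz

theorem isIntegralCurveIn (h : SolvesReduced t F C s I) :
    IsIntegralCurveIn (reducedField t) admissible (cauchyData F C s) I := by
  refine ⟨h.isOpen, fun z hz => h.ne_zero_and_pos hz, fun z hz => hasDerivAt_pi.2 fun i => ?_⟩
  have hF := h.contDiffAt_F hz
  have hC := h.contDiffAt_C hz
  have hs := h.contDiffAt_s hz
  have hF' := contDiffAt_deriv hF
  have hF'' := contDiffAt_deriv hF'
  obtain ⟨hF₀, hC₀⟩ := h.ne_zero_and_pos hz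
  obtain ⟨hF'''', hC'', hs''⟩ := (reduced_iff_highestDerivs_eq hF hC hs hF₀ hC₀).1 (h.equations hz)
  fin_cases i
  exacts [hasDerivAt_of_contDiffAt hF, hasDerivAt_of_contDiffAt hF',
    hasDerivAt_of_contDiffAt hF'',
    (hasDerivAt_of_contDiffAt (contDiffAt_deriv hF'')).congr_deriv hF'''',
    hasDerivAt_of_contDiffAt hC,
    (hasDerivAt_of_contDiffAt (contDiffAt_deriv hC)).congr_deriv hC'',
    hasDerivAt_of_contDiffAt hs,
    (hasDerivAt_of_contDiffAt (contDiffAt_deriv hs)).congr_deriv hs'']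

theorem eqOn (h : SolvesReduced t F C s I) (h' : SolvesReduced t F' C' s' I)
    (hI : IsPreconnected I) (hz₀ : z₀ ∈ I)
    (heq : cauchyData F C s z₀ = cauchyData F' C' s' z₀) :
    EqOn F F' I ∧ EqOn C C' I ∧ EqOn s s' I := by
  have hdata := h.isIntegralCurveIn.eqOn isOpen_admissible
    ((contDiffOn_reducedField t).of_le (by simp)) hI h'.isIntegralCurveIn hz₀ heq
  exact ⟨fun z hz => congrFun (hdata hz) 0, fun z hz => congrFun (hdata hz) 4,
    fun z hz => congrFun (hdata hz) 6⟩

end SolvesReduced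

namespace IsIntegralCurveIn

variable {y : ℝ → Fin 8 → ℝ}

lemma contDiffAt_apply (hy : IsIntegralCurveIn (reducedField t) admissible y I) (hz : z ∈ I)
    (i : Fin 8) : ContDiffAt ℝ ∞ (fun x => y x i) z :=
  contDiffAt_pi.1 (hy.contDiffAt (contDiffOn_reducedField t) hz) i

lemma eqOn_deriv_apply (hy : IsIntegralCurveIn (reducedField t) admissible y I) {f : ℝ → ℝ}
    {i : Fin 8} (hf : EqOn f (fun x => y x i) I) :
    EqOn (deriv f) (fun x => reducedField t (y x) i) I := fun z hz =>
  (hf.deriv hy.isOpen hz).trans (hasDerivAt_pi.1 (hy.hasDerivAt z hz) i).deriv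

lemma cauchyData_eqOn (hy : IsIntegralCurveIn (reducedField t) admissible y I) :
    EqOn (cauchyData (fun z => y z 0) (fun z => y z 4) fun z => y z 6) y I := fun z hz => by
  have hF' := hy.eqOn_deriv_apply (i := 0) (eqOn_refl _ _)
  have hF'' := hy.eqOn_deriv_apply (i := 1) hF'
  ext i
  fin_cases i
  exacts [rfl, hF' hz, hF'' hz, hy.eqOn_deriv_apply (i := 2) hF'' hz, rfl,
    hy.eqOn_deriv_apply (i := 4) (eqOn_refl _ _) hz, rfl,
    hy.eqOn_deriv_apply (i := 6) (eqOn_refl _ _) hz]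

theorem solvesReduced (hy : IsIntegralCurveIn (reducedField t) admissible y I) :
    SolvesReduced t (fun z => y z 0) (fun z => y z 4) (fun z => y z 6) I := by
  have hdata := hy.cauchyData_eqOn
  refine ⟨hy.isOpen, fun z hz => (hy.contDiffAt_apply hz 0).contDiffWithinAt,
    fun z hz => (hy.contDiffAt_apply hz 4).contDiffWithinAt,
    fun z hz => (hy.contDiffAt_apply hz 6).contDiffWithinAt, fun z hz => hy.mapsTo hz,
    fun z hz => ?_⟩
  rw [reduced_iff_highestDerivs_eq (hy.contDiffAt_apply hz 0) (hy.contDiffAt_apply hz 4)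
    (hy.contDiffAt_apply hz 6) (hy.mapsTo hz).1 (hy.mapsTo hz).2, hdata hz]
  exact ⟨hy.eqOn_deriv_apply (i := 3) (fun x hx => congrFun (hdata hx) 3) hz,
    hy.eqOn_deriv_apply (i := 5) (fun x hx => congrFun (hdata hx) 5) hz,
    hy.eqOn_deriv_apply (i := 7) (fun x hx => congrFun (hdata hx) 7) hz⟩

end IsIntegralCurveIn

theorem exists_solvesReduced (t z₀ : ℝ) (hp : p ∈ admissible) :
    ∃ ε > 0, ∃ F C s : ℝ → ℝ, SolvesReduced t F C s (Ioo (z₀ - ε) (z₀ + ε)) ∧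
      cauchyData F C s z₀ = p := by
  obtain ⟨ε, hε, y, rfl, hy⟩ := exists_isIntegralCurveIn isOpen_admissible
    ((contDiffOn_reducedField t).of_le (by simp)) hp z₀
  exact ⟨ε, hε, _, _, _, hy.solvesReduced, hy.cauchyData_eqOn ⟨by linarith, by linarith⟩⟩

end ReducedField

/-! ## The conserved quantities -/

section Conserved

variable {t z w : ℝ} {F C s : ℝ → ℝ} {I : Set ℝ} {p : Fin 8 → ℝ}

/-- The conserved quantity `T` as a function of the initial conditions. -/
def conservedT (t : ℝ) (p : Fin 8 → ℝ) : ℝ :=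
  16 * ((p 0 - 1) ^ 2 - (p 2 / 2 - 3 / 2 * p 1) ^ 2 + p 1 * (p 3 / 2 - 3 / 2 * p 2 + p 1))
    - 18 * t * p 0 * p 5 * p 7 - 6 * t * p 4 * p 1 * p 7
    - 3 / 4 * t * p 6 * (p 4)⁻¹ * (p 4 ^ 2 * (-16 + 4 * p 0 + p 4 * p 6)
      + 12 * p 0 * p 5 ^ 2 + 8 * p 4 * p 5 * p 1)

/-- The first integral `C F s'` of `(C F s')' = 0` as a function of the initial conditions. It is
zero exactly when the scalar curvature is constant. -/
def scalFlux (p : Fin 8 → ℝ) : ℝ := p 4 * p 0 * p 7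

lemma opT_eq_conservedT (t : ℝ) (hF : ContDiffAt ℝ ∞ F z) :
    opT t F C s z = conservedT t (cauchyData F C s z) := by
  simp only [opT, opB_eq hF, conservedT, cauchyData, Matrix.cons_val]

lemma contDiffAt_conservedT (t : ℝ) (hp : p 4 ≠ 0) : ContDiffAt ℝ ∞ (conservedT t) p := by
  unfold conservedT
  fun_prop (disch := simp [hp])

lemma fderiv_conservedT (t : ℝ) (hp : p 4 ≠ 0) (v : Fin 8 → ℝ) :
    fderiv ℝ (conservedT t) p v =
      16 * (2 * (p 0 - 1) * v 0 - 2 * (p 2 / 2 - 3 / 2 * p 1) * (v 2 / 2 - 3 / 2 * v 1)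
        + (v 1 * (p 3 / 2 - 3 / 2 * p 2 + p 1) + p 1 * (v 3 / 2 - 3 / 2 * v 2 + v 1)))
      - 18 * t * (v 0 * p 5 * p 7 + p 0 * v 5 * p 7 + p 0 * p 5 * v 7)
      - 6 * t * (v 4 * p 1 * p 7 + p 4 * v 1 * p 7 + p 4 * p 1 * v 7)
      - 3 / 4 * t * ((v 6 / p 4 - p 6 * v 4 / p 4 ^ 2) * (p 4 ^ 2 * (-16 + 4 * p 0 + p 4 * p 6)
          + 12 * p 0 * p 5 ^ 2 + 8 * p 4 * p 5 * p 1)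
        + p 6 / p 4 * (2 * p 4 * v 4 * (-16 + 4 * p 0 + p 4 * p 6)
          + p 4 ^ 2 * (4 * v 0 + v 4 * p 6 + p 4 * v 6) + 12 * v 0 * p 5 ^ 2
          + 24 * p 0 * p 5 * v 5
          + 8 * (v 4 * p 5 * p 1 + p 4 * v 5 * p 1 + p 4 * p 5 * v 1))) := by
  have d (i : Fin 8) : HasDerivAt (fun x : ℝ => p i + x * v i) (v i) 0 := by
    simpa using ((hasDerivAt_id (0 : ℝ)).mul_const (v i)).const_add (p i)
  have hB := ((((d 0).sub_const 1).pow 2).sub ((((d 2).div_const 2).sub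
    ((d 1).const_mul (3 / 2))).pow 2)).add
      ((d 1).mul ((((d 3).div_const 2).sub ((d 2).const_mul (3 / 2))).add (d 1)))
  have hFC's' := (((d 0).const_mul (18 * t)).mul (d 5)).mul (d 7)
  have hCF's' := (((d 4).const_mul (6 * t)).mul (d 1)).mul (d 7)
  have hsC := ((d 6).const_mul (3 / 4 * t)).mul ((d 4).inv (by simpa using hp))
  have hpoly := ((((d 4).pow 2).mul ((((d 0).const_mul 4).const_add (-16)).add
    ((d 4).mul (d 6)))).add (((d 0).const_mul 12).mul ((d 5).pow 2))).add
      ((((d 4).const_mul 8).mul (d 5)).mul (d 1))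
  rw [← ((contDiffAt_conservedT t hp).differentiableAt (by simp)).lineDeriv_eq_fderiv]
  refine HasLineDerivAt.lineDeriv
    (((((hB.const_mul 16).sub hFC's').sub hCF's').sub (hsC.mul hpoly)).congr_deriv ?_)
  simp only [Pi.mul_apply, Pi.add_apply, Pi.sub_apply, Pi.pow_apply, Pi.inv_apply, zero_mul,
    add_zero]
  field_simp
  ring

lemma fderiv_conservedT_reducedField (t : ℝ) (hp : p ∈ admissible) :
    fderiv ℝ (conservedT t) p (reducedField t p) = 0 := by
  obtain ⟨hp₀, hp₄⟩ := hp
  replace hp₄ := hp₄.ne'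
  simp only [fderiv_conservedT t hp₄, reducedField, fourthDerivF, secondDerivC, secondDerivS,
    Matrix.cons_val]
  field_simp
  ring

lemma contDiff_scalFlux : ContDiff ℝ ∞ scalFlux := by
  unfold scalFlux
  fun_prop

lemma fderiv_scalFlux (p v : Fin 8 → ℝ) :
    fderiv ℝ scalFlux p v = p 4 * p 0 * v 7 + p 7 * (p 4 * v 0 + p 0 * v 4) := by
  have d (i : Fin 8) := hasFDerivAt_apply (𝕜 := ℝ) (F' := fun _ : Fin 8 => ℝ) i p
  have hflux : HasFDerivAt scalFlux _ p := ((d 4).mul (d 0)).mul (d 7)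
  simp [hflux.fderiv, mul_add]

lemma fderiv_scalFlux_reducedField (t : ℝ) (hp : p ∈ admissible) :
    fderiv ℝ scalFlux p (reducedField t p) = 0 := by
  obtain ⟨hp₀, hp₄⟩ := hp
  replace hp₄ := hp₄.ne'
  simp only [fderiv_scalFlux, reducedField, secondDerivS, Matrix.cons_val]
  field_simp
  ring

theorem SolvesReduced.opT_eq (h : SolvesReduced t F C s I) (hI : IsPreconnected I) (hz : z ∈ I)
    (hw : w ∈ I) : opT t F C s z = opT t F C s w := by
  rw [opT_eq_conservedT t (h.contDiffAt_F hz), opT_eq_conservedT t (h.contDiffAt_F hw)]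
  exact h.isIntegralCurveIn.comp_eq_comp
    (fun _ hp => (contDiffAt_conservedT t hp.2.ne').differentiableAt (by simp))
    (fun _ hp => fderiv_conservedT_reducedField t hp) hI hz hw

end Conserved

/-! ## The reduced system and `B^t`-flat metrics -/

section Equivalence

variable {t z : ℝ} {F C s s' : ℝ → ℝ} {I : Set ℝ}

/-- The initial conditions of metrics: `F > 0` and `C > 0`. -/
def positiveData : Set (Fin 8 → ℝ) := {p | 0 < p 0 ∧ 0 < p 4}

lemma positiveData_subset_admissible : positiveData ⊆ admissible := fun _ hp => ⟨hp.1.ne', hp.2⟩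

lemma isOpen_positiveData : IsOpen positiveData :=
  (isOpen_lt continuous_const (continuous_apply 0)).inter
    (isOpen_lt continuous_const (continuous_apply 4))

lemma contDiffOn_reducedField_positiveData (t : ℝ) :
    ContDiffOn ℝ 1 (reducedField t) positiveData :=
  ((contDiffOn_reducedField t).mono positiveData_subset_admissible).of_le (by simp)

lemma cauchyData_congr (hs : s =ᶠ[nhds z] s') : cauchyData F C s z = cauchyData F C s' z := by
  simp only [cauchyData, hs.eq_of_nhds, hs.deriv_eq]

lemma opE_congr (hs : s =ᶠ[nhds z] s') : opE F C s z = opE F C s' z :=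
  Filter.EventuallyEq.deriv_eq (hs.deriv.mono fun x hx => by simp only [hx])

lemma opF1_congr (hs : s =ᶠ[nhds z] s') : opF1 F C s z = opF1 F C s' z := by
  simp only [opF1, hs.eq_of_nhds]

lemma opF2_congr (t : ℝ) (hs : s =ᶠ[nhds z] s') : opF2 t F C s z = opF2 t F C s' z := by
  simp only [opF2, hs.eq_of_nhds, hs.deriv_eq]

lemma opT_congr (t : ℝ) (hs : s =ᶠ[nhds z] s') : opT t F C s z = opT t F C s' z := by
  simp only [opT, hs.eq_of_nhds, hs.deriv_eq]

lemma SolvesReduced.congr (h : SolvesReduced t F C s I) (hs : EqOn s s' I) :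
    SolvesReduced t F C s' I := by
  obtain ⟨hI, hF, hC, hs_smooth, hpos, heq⟩ := h
  refine ⟨hI, hF, hC, hs_smooth.congr hs.symm, hpos, fun z hz => ?_⟩
  have hgerm := hs.eventuallyEq_of_mem (hI.mem_nhds hz)
  rw [← opE_congr hgerm, ← opF1_congr hgerm, ← opF2_congr t hgerm]
  exact heq z hz

lemma SolvesReduced.isMetricOn (h : SolvesReduced t F C s I) (hF : ∀ z ∈ I, 0 < F z) :
    IsMetricOn F C I :=
  ⟨h.1, h.2.1, h.2.2.1, fun z hz => ⟨hF z hz, (h.ne_zero_and_pos hz).2⟩⟩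

lemma SolvesReduced.eqOn_scal (h : SolvesReduced t F C s I) (hF : ∀ z ∈ I, 0 < F z) :
    EqOn s (scal F C) I := fun _ hz =>
  ((h.isMetricOn hF).opF1_eq_zero_iff hz s).1 (h.equations hz).2.1

lemma IsMetricOn.solvesReduced_iff (hm : IsMetricOn F C I) (t : ℝ) :
    SolvesReduced t F C (scal F C) I ↔
      ∀ z ∈ I, opE F C (scal F C) z = 0 ∧ opF2 t F C (scal F C) z = 0 :=
  ⟨fun h _ hz => ⟨(h.equations hz).1, (h.equations hz).2.2⟩, fun h =>
    ⟨hm.1, hm.2.1, hm.2.2.1, fun _ hz => (hm.contDiffAt_scal hz).contDiffWithinAt,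
      fun _ hz => ⟨(hm.F_pos hz).ne', hm.C_pos hz⟩, fun z hz =>
      ⟨(h z hz).1, (hm.opF1_eq_zero_iff hz _).2 rfl, (h z hz).2⟩⟩⟩

lemma IsMetricOn.btTensor_eq_zero_iff (hm : IsMetricOn F C I) (ht : t ≠ 0) (hz : z ∈ I) :
    (∀ i j, btTensor t F C i j z = 0) ↔
      (opE F C (scal F C) z = 0 ∧ opF2 t F C (scal F C) z = 0) ∧ opT t F C (scal F C) z = 0 := by
  have hF := hm.F_pos hz
  have hC := hm.C_pos hz
  constructor
  · intro h
    have hdiag (i : Fin 4) := h i i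
    simp only [hm.btTensor_eq t hz, if_true] at hdiag
    have hcoef (i : Fin 4) := (mul_eq_zero_iff_left
      (div_pos (hm.gDiag_pos hz i) (pow_pos hC 2)).ne').1 (hdiag i)
    have h₀ := hcoef 0
    have h₁ := hcoef 1
    have h₂ := hcoef 2
    simp only [Matrix.cons_val] at h₀ h₁ h₂
    have hT : opT t F C (scal F C) z = 0 := by linarith
    have hE : t * opE F C (scal F C) z = 0 := by linarith
    have hF2 : F z * opF2 t F C (scal F C) z = 0 := by linarith
    exact ⟨⟨(mul_eq_zero_iff_left ht).1 hE, (mul_eq_zero_iff_left hF.ne').1 hF2⟩, hT⟩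
  · rintro ⟨⟨hE, hF2⟩, hT⟩ i j
    rw [hm.btTensor_eq t hz]
    fin_cases i <;> simp [hE, hF2, hT]

lemma isBtFlat_iff_solvesReduced (ht : t ≠ 0) :
    IsBtFlat t F C I ↔ IsMetricOn F C I ∧ SolvesReduced t F C (scal F C) I ∧
      ∀ z ∈ I, opT t F C (scal F C) z = 0 :=
  and_congr_right fun hm => by
    rw [hm.solvesReduced_iff t, ← forall₂_and]
    exact forall₂_congr fun z hz => hm.btTensor_eq_zero_iff ht hz

theorem solvesReduced_iff_isBtFlat (ht : t ≠ 0) (hF : ∀ z ∈ I, 0 < F z) :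
    (SolvesReduced t F C s I ∧ ∀ z ∈ I, opT t F C s z = 0) ↔
      (IsBtFlat t F C I ∧ EqOn s (scal F C) I) := by
  rw [isBtFlat_iff_solvesReduced ht]
  have hgerm (hI : IsOpen I) (hs : EqOn s (scal F C) I) (z : ℝ) (hz : z ∈ I) :=
    hs.eventuallyEq_of_mem (hI.mem_nhds hz)
  constructor
  · rintro ⟨h, hT⟩
    have hs := h.eqOn_scal hF
    exact ⟨⟨h.isMetricOn hF, h.congr hs,
      fun z hz => (opT_congr t (hgerm h.isOpen hs z hz)).symm.trans (hT z hz)⟩, hs⟩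
  · rintro ⟨⟨-, h, hT⟩, hs⟩
    exact ⟨h.congr hs.symm, fun z hz => (opT_congr t (hgerm h.isOpen hs z hz)).trans (hT z hz)⟩

end Equivalence

/-! ## Homotheties -/

section Homothety

variable {t z z₀ a : ℝ} {F C : ℝ → ℝ} {I : Set ℝ} {p : Fin 8 → ℝ}

/-- The exponents `w` with which the initial conditions `p` scale, `p i ↦ e^{b w i} p i`, when the
metric is multiplied by `e^b`. -/
def scalingWeight : Fin 8 → ℝ := ![0, 0, 0, 0, 1, 1, -1, -1]

/-- The action of multiplication of the metric by `e^b` on the initial conditions. -/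
def rescale (b : ℝ) (p : Fin 8 → ℝ) : Fin 8 → ℝ := fun i => Real.exp (b * scalingWeight i) * p i

lemma rescale_eq (b : ℝ) (p : Fin 8 → ℝ) :
    rescale b p = ![p 0, p 1, p 2, p 3, Real.exp b * p 4, Real.exp b * p 5, (Real.exp b)⁻¹ * p 6,
      (Real.exp b)⁻¹ * p 7] := by
  ext i
  fin_cases i <;> simp [rescale, scalingWeight, Real.exp_neg]

lemma rescale_zero (p : Fin 8 → ℝ) : rescale 0 p = p := by
  ext i
  simp [rescale]

lemma hasDerivAt_rescale (b : ℝ) (p : Fin 8 → ℝ) :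
    HasDerivAt (fun b => rescale b p) (scalingWeight * rescale b p) b := by
  refine hasDerivAt_pi.2 fun i =>
    ((((hasDerivAt_id b).mul_const (scalingWeight i)).exp).mul_const (p i)).congr_deriv ?_
  simp only [rescale, Pi.mul_apply, id_eq, one_mul]
  ring

lemma hasStrictFDerivAt_rescale (p : Fin 8 → ℝ) :
    HasStrictFDerivAt (fun x : (Fin 8 → ℝ) × ℝ => rescale x.2 x.1)
      (ContinuousLinearMap.fst ℝ (Fin 8 → ℝ) ℝ
        + (ContinuousLinearMap.snd ℝ (Fin 8 → ℝ) ℝ).smulRight (scalingWeight * p)) (p, 0) := by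
  refine hasStrictFDerivAt_pi'.2 fun i => ?_
  have hexp := ((hasStrictFDerivAt_snd (𝕜 := ℝ) (p := (p, (0 : ℝ)))).mul_const
    (scalingWeight i)).exp
  have hcoord : HasStrictFDerivAt (fun x : (Fin 8 → ℝ) × ℝ => x.1 i)
      ((ContinuousLinearMap.proj (R := ℝ) (φ := fun _ : Fin 8 => ℝ) i).comp
        (ContinuousLinearMap.fst ℝ (Fin 8 → ℝ) ℝ)) (p, 0) :=
    ((ContinuousLinearMap.proj (R := ℝ) (φ := fun _ : Fin 8 => ℝ) i).comp
      (ContinuousLinearMap.fst ℝ (Fin 8 → ℝ) ℝ)).hasStrictFDerivAt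
  refine (hexp.mul hcoord).congr_fderiv ?_
  ext <;> simp [mul_comm]

lemma rescale_mem_positiveData (b : ℝ) (hp : p ∈ positiveData) : rescale b p ∈ positiveData := by
  rw [rescale_eq]
  exact ⟨hp.1, mul_pos (Real.exp_pos b) hp.2⟩

lemma conservedT_rescale (t b : ℝ) (hp : p 4 ≠ 0) :
    conservedT t (rescale b p) = conservedT t p := by
  have := Real.exp_ne_zero b
  simp only [rescale_eq, conservedT, Matrix.cons_val]
  field_simp

lemma scalFlux_rescale (b : ℝ) (p : Fin 8 → ℝ) : scalFlux (rescale b p) = scalFlux p := by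
  have := Real.exp_ne_zero b
  simp only [rescale_eq, scalFlux, Matrix.cons_val]
  field_simp

lemma secondDerivC_rescale (b : ℝ) (hp : p ∈ admissible) :
    secondDerivC (rescale b p) = Real.exp b * secondDerivC p := by
  have := Real.exp_ne_zero b
  have hp₀ := hp.1
  have hp₄ := hp.2.ne'
  simp only [rescale_eq, secondDerivC, Matrix.cons_val]
  field_simp

lemma fourthDerivF_rescale (t b : ℝ) (hp : p ∈ admissible) :
    fourthDerivF t (rescale b p) = fourthDerivF t p := by
  have := Real.exp_ne_zero b
  have hp₀ := hp.1
  have hp₄ := hp.2.ne'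
  rw [fourthDerivF, secondDerivC_rescale b hp, fourthDerivF]
  simp only [rescale_eq, Matrix.cons_val]
  field_simp

lemma secondDerivS_rescale (b : ℝ) (hp : p ∈ admissible) :
    secondDerivS (rescale b p) = (Real.exp b)⁻¹ * secondDerivS p := by
  have := Real.exp_ne_zero b
  have hp₀ := hp.1
  have hp₄ := hp.2.ne'
  simp only [rescale_eq, secondDerivS, Matrix.cons_val]
  field_simp

lemma reducedField_rescale (t b : ℝ) (hp : p ∈ admissible) :
    reducedField t (rescale b p) = rescale b (reducedField t p) := by
  rw [reducedField, fourthDerivF_rescale t b hp, secondDerivC_rescale b hp,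
    secondDerivS_rescale b hp, rescale_eq, rescale_eq]
  rfl

lemma IsMetricOn.homothety (hm : IsMetricOn F C I) (a b : ℝ) :
    IsMetricOn (fun z => F (z + a)) (fun z => Real.exp b * C (z + a)) ((· + a) ⁻¹' I) := by
  have htrans : ContDiffOn ℝ ∞ (· + a) ((· + a) ⁻¹' I) := by fun_prop
  exact ⟨hm.1.preimage (by fun_prop), hm.2.1.comp htrans (mapsTo_preimage _ _),
    contDiffOn_const.mul (hm.2.2.1.comp htrans (mapsTo_preimage _ _)),
    fun z hz => ⟨hm.F_pos hz, mul_pos (Real.exp_pos b) (hm.C_pos hz)⟩⟩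

lemma deriv_translate (f : ℝ → ℝ) (a : ℝ) :
    deriv (fun z => f (z + a)) = fun z => deriv f (z + a) :=
  funext fun z => deriv_comp_add_const f a z

lemma logDeriv_homothety (C : ℝ → ℝ) (a b : ℝ) :
    logDeriv (fun z => Real.exp b * C (z + a)) = fun z => logDeriv C (z + a) := by
  ext z
  rw [logDeriv_const_mul _ _ (Real.exp_ne_zero b), logDeriv_apply, deriv_comp_add_const,
    logDeriv_apply]

lemma IsMetricOn.scal_homothety (hm : IsMetricOn F C I) (b : ℝ) (hz : z + a ∈ I) :
    scal (fun z => F (z + a)) (fun z => Real.exp b * C (z + a)) z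
      = (Real.exp b)⁻¹ * scal F C (z + a) := by
  have hC := (hm.C_pos hz).ne'
  have := Real.exp_ne_zero b
  rw [(hm.homothety a b).scal_eq hz, hm.scal_eq hz, logDeriv_homothety]
  simp only [deriv_translate]
  field_simp

lemma IsMetricOn.homothetyData_eq (hm : IsMetricOn F C I) (b : ℝ) (hz : z₀ + a ∈ I) :
    homothetyData F C z₀ a b = rescale b (metricData F C (z₀ + a)) := by
  have hscal : scal (fun z => F (z + a)) (fun z => Real.exp b * C (z + a))
      =ᶠ[nhds z₀] fun z => (Real.exp b)⁻¹ * scal F C (z + a) := by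
    filter_upwards [(hm.homothety a b).mem_nhds hz] with z hz using hm.scal_homothety b hz
  rw [homothetyData, metricData, cauchyData_congr hscal, rescale_eq]
  simp only [cauchyData, metricData, deriv_translate, deriv_const_mul_field, Matrix.cons_val]

end Homothety

/-! ## Classes of metrics cut out by first integrals -/

section LevelClasses

variable {G : Type*} [NormedAddCommGroup G] [NormedSpace ℝ G] {t z z₀ : ℝ} {F C : ℝ → ℝ}
  {I : Set ℝ} {p : Fin 8 → ℝ} {y : ℝ → Fin 8 → ℝ} {Q : (Fin 8 → ℝ) → G}
  {P : (ℝ → ℝ) → (ℝ → ℝ) → Set ℝ → Prop}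

/-- The class `P` of metrics consists of the solutions `(F, C, s)` of the reduced system, `s` being
the scalar curvature of `F`, `C`, on which the homothety-invariant first integral `Q` vanishes. This
is what `B^t`-flat metrics and `B^t`-flat metrics of constant scalar curvature have in common. -/
structure IsLevelClass (t : ℝ) (Q : (Fin 8 → ℝ) → G)
    (P : (ℝ → ℝ) → (ℝ → ℝ) → Set ℝ → Prop) : Prop where
  contDiffOn : ContDiffOn ℝ ∞ Q admissible
  fderiv_reducedField : ∀ p ∈ admissible, fderiv ℝ Q p (reducedField t p) = 0
  apply_rescale : ∀ p ∈ admissible, ∀ b, Q (rescale b p) = Q p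
  iff_solvesReduced : ∀ {F C : ℝ → ℝ} {I : Set ℝ}, IsPreconnected I → (P F C I ↔
    IsMetricOn F C I ∧ SolvesReduced t F C (scal F C) I ∧ ∀ z ∈ I, Q (metricData F C z) = 0)

theorem isLevelClass_isBtFlat (ht : t ≠ 0) : IsLevelClass t (conservedT t) (IsBtFlat t) where
  contDiffOn p hp := (contDiffAt_conservedT t hp.2.ne').contDiffWithinAt
  fderiv_reducedField _ hp := fderiv_conservedT_reducedField t hp
  apply_rescale _ hp b := conservedT_rescale t b hp.2.ne'
  iff_solvesReduced {F C I} _ := by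
    rw [isBtFlat_iff_solvesReduced ht]
    refine and_congr_right fun hm => and_congr_right fun _ => forall₂_congr fun z hz => ?_
    rw [opT_eq_conservedT t (hm.contDiffAt_F hz), metricData]

lemma IsMetricOn.exists_scal_eq_iff (hm : IsMetricOn F C I) (hI : IsPreconnected I) :
    (∃ c, ∀ z ∈ I, scal F C z = c) ↔ ∀ z ∈ I, scalFlux (metricData F C z) = 0 := by
  have hflux (z : ℝ) (hz : z ∈ I) :
      scalFlux (metricData F C z) = 0 ↔ deriv (scal F C) z = 0 :=
    mul_eq_zero_iff_left (mul_pos (hm.C_pos hz) (hm.F_pos hz)).ne'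
  rw [forall₂_congr hflux]
  constructor
  · rintro ⟨c, hc⟩ z hz
    exact (EqOn.deriv (g := fun _ => c) hc hm.1 hz).trans (deriv_const z c)
  · intro hs
    exact hm.1.exists_is_const_of_deriv_eq_zero hI (fun z hz =>
      ((hm.contDiffAt_scal hz).differentiableAt (by simp)).differentiableWithinAt) hs

theorem isLevelClass_isCSCBtFlat (ht : t ≠ 0) :
    IsLevelClass t (fun p => (conservedT t p, scalFlux p)) (IsCSCBtFlat t) where
  contDiffOn := (isLevelClass_isBtFlat ht).contDiffOn.prodMk contDiff_scalFlux.contDiffOn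
  fderiv_reducedField p hp := by
    rw [DifferentiableAt.fderiv_prodMk
      ((contDiffAt_conservedT t hp.2.ne').differentiableAt (by simp))
      (contDiff_scalFlux.contDiffAt.differentiableAt (by simp))]
    exact Prod.ext (fderiv_conservedT_reducedField t hp) (fderiv_scalFlux_reducedField t hp)
  apply_rescale p hp b := Prod.ext (conservedT_rescale t b hp.2.ne') (scalFlux_rescale b p)
  iff_solvesReduced {F C I} hI := by
    simp only [IsCSCBtFlat, (isLevelClass_isBtFlat ht).iff_solvesReduced hI, Prod.mk_eq_zero,
      forall_and, and_assoc]
    exact and_congr_right fun hm => by rw [hm.exists_scal_eq_iff hI]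

namespace IsLevelClass

lemma isMetricOn (hP : IsLevelClass t Q P) (hI : IsPreconnected I) (h : P F C I) :
    IsMetricOn F C I :=
  ((hP.iff_solvesReduced hI).1 h).1

lemma apply_metricData (hP : IsLevelClass t Q P) (hI : IsPreconnected I) (h : P F C I)
    (hz : z ∈ I) : Q (metricData F C z) = 0 :=
  ((hP.iff_solvesReduced hI).1 h).2.2 z hz

lemma isIntegralCurveIn (hP : IsLevelClass t Q P) (hI : IsPreconnected I) (h : P F C I) :
    IsIntegralCurveIn (reducedField t) positiveData (metricData F C) I :=
  ⟨(hP.isMetricOn hI h).1, (hP.isMetricOn hI h).2.2.2,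
    ((hP.iff_solvesReduced hI).1 h).2.1.isIntegralCurveIn.hasDerivAt⟩

lemma differentiableAt (hP : IsLevelClass t Q P) (hp : p ∈ admissible) :
    DifferentiableAt ℝ Q p :=
  (hP.contDiffOn.contDiffAt (isOpen_admissible.mem_nhds hp)).differentiableAt (by simp)

lemma apply_eq_apply (hP : IsLevelClass t Q P) (hI : IsPreconnected I)
    (hy : IsIntegralCurveIn (reducedField t) positiveData y I) (hz : z ∈ I) (hz₀ : z₀ ∈ I) :
    Q (y z) = Q (y z₀) :=
  (hy.mono positiveData_subset_admissible).comp_eq_comp (fun _ => hP.differentiableAt)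
    hP.fderiv_reducedField hI hz hz₀

end IsLevelClass

lemma IsIntegralCurveIn.eqOn_metricData
    (hy : IsIntegralCurveIn (reducedField t) positiveData y I) :
    EqOn (metricData (fun z => y z 0) fun z => y z 4) y I := fun z hz => by
  have hy' := hy.mono positiveData_subset_admissible
  have hscal := hy'.solvesReduced.eqOn_scal fun z hz => (hy.mapsTo hz).1
  rw [metricData, ← cauchyData_congr (hscal.eventuallyEq_of_mem (hy.isOpen.mem_nhds hz)),
    hy'.cauchyData_eqOn hz]

namespace IsLevelClass

theorem of_isIntegralCurveIn (hP : IsLevelClass t Q P) (hI : IsPreconnected I)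
    (hy : IsIntegralCurveIn (reducedField t) positiveData y I) (hz₀ : z₀ ∈ I)
    (hQ : Q (y z₀) = 0) : P (fun z => y z 0) (fun z => y z 4) I := by
  have hsol := (hy.mono positiveData_subset_admissible).solvesReduced
  have hF (z : ℝ) (hz : z ∈ I) : 0 < y z 0 := (hy.mapsTo hz).1
  refine (hP.iff_solvesReduced hI).2 ⟨hsol.isMetricOn hF, hsol.congr (hsol.eqOn_scal hF),
    fun z hz => ?_⟩
  rw [hy.eqOn_metricData hz, hP.apply_eq_apply hI hy hz hz₀, hQ]

theorem dataSet_eq (hP : IsLevelClass t Q P) (z₀ : ℝ) :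
    dataSet P z₀ = {p ∈ positiveData | Q p = 0} := by
  ext p
  constructor
  · rintro ⟨ε, hε, F, C, h, rfl⟩
    have hz₀ : z₀ ∈ Ioo (z₀ - ε) (z₀ + ε) := by constructor <;> linarith
    exact ⟨(hP.isIntegralCurveIn isPreconnected_Ioo h).mapsTo hz₀,
      hP.apply_metricData isPreconnected_Ioo h hz₀⟩
  · rintro ⟨hp, hQ⟩
    obtain ⟨ε, hε, y, rfl, hy⟩ := exists_isIntegralCurveIn isOpen_positiveData
      (contDiffOn_reducedField_positiveData t) hp z₀
    have hz₀ : z₀ ∈ Ioo (z₀ - ε) (z₀ + ε) := by constructor <;> linarith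
    exact ⟨ε, hε, _, _, hP.of_isIntegralCurveIn isPreconnected_Ioo hy hz₀ hQ,
      hy.eqOn_metricData hz₀⟩

end IsLevelClass

theorem reducedDataSet_eq (t z₀ : ℝ) :
    reducedDataSet t z₀ = {p ∈ admissible | conservedT t p = 0} := by
  ext p
  constructor
  · rintro ⟨ε, hε, F, C, s, h, hT, rfl⟩
    have hz₀ : z₀ ∈ Ioo (z₀ - ε) (z₀ + ε) := by constructor <;> linarith
    exact ⟨h.ne_zero_and_pos hz₀, (opT_eq_conservedT t (h.contDiffAt_F hz₀)).symm.trans (hT z₀ hz₀)⟩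
  · rintro ⟨hp, hT⟩
    obtain ⟨ε, hε, F, C, s, h, rfl⟩ := exists_solvesReduced t z₀ hp
    have hz₀ : z₀ ∈ Ioo (z₀ - ε) (z₀ + ε) := by constructor <;> linarith
    refine ⟨ε, hε, F, C, s, h, fun z hz => ?_, rfl⟩
    rw [h.opT_eq isPreconnected_Ioo hz hz₀, opT_eq_conservedT t (h.contDiffAt_F hz₀), hT]

end LevelClasses

/-! ## Self-homothetic metrics -/

section SelfHomothetic

variable {t z₀ : ℝ} {F C : ℝ → ℝ} {I : Set ℝ} {p : Fin 8 → ℝ}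

lemma isIntegralCurveIn_rescale {μ : ℝ} (hp : p ∈ positiveData)
    (h : reducedField t p = μ • (scalingWeight * p)) (hI : IsOpen I) (z₀ : ℝ) :
    IsIntegralCurveIn (reducedField t) positiveData (fun z => rescale (μ * (z - z₀)) p) I := by
  refine ⟨hI, fun z _ => rescale_mem_positiveData _ hp, fun z _ => ?_⟩
  refine ((hasDerivAt_rescale (μ * (z - z₀)) p).scomp z
    (((hasDerivAt_id z).sub_const z₀).const_mul μ)).congr_deriv ?_
  rw [reducedField_rescale t _ (positiveData_subset_admissible hp), h]
  ext i
  simp only [rescale, Pi.smul_apply, Pi.mul_apply, smul_eq_mul]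
  ring

lemma IsIntegralCurveIn.selfHomothetic {μ : ℝ} (hI : IsPreconnected I)
    (hcurve : IsIntegralCurveIn (reducedField t) positiveData (metricData F C) I) (hz₀ : z₀ ∈ I)
    (h : reducedField t (metricData F C z₀) = μ • (scalingWeight * metricData F C z₀)) :
    SelfHomothetic F C I := by
  have heq := hcurve.eqOn isOpen_positiveData (contDiffOn_reducedField_positiveData t) hI
    (isIntegralCurveIn_rescale (hcurve.mapsTo hz₀) h hcurve.isOpen z₀) hz₀
    (by rw [sub_self, mul_zero, rescale_zero])
  refine ⟨F z₀, C z₀ * Real.exp (-(μ * z₀)), μ, fun z hz => ?_⟩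
  have hz := heq hz
  simp only [rescale_eq] at hz
  refine ⟨congrFun hz 0, (congrFun hz 4).trans ?_⟩
  rw [mul_sub, sub_eq_add_neg, Real.exp_add]
  change _ * C z₀ = _
  ring

end SelfHomothetic

/-! ## Families up to homothety -/

section Families

open Module

variable {G : Type*} [NormedAddCommGroup G] [NormedSpace ℝ G] {t a δ ε : ℝ} {p : Fin 8 → ℝ}
  {y : ℝ → Fin 8 → ℝ} {Q : (Fin 8 → ℝ) → G} {P : (ℝ → ℝ) → (ℝ → ℝ) → Set ℝ → Prop}

/-- The local action of the homotheties on initial conditions, `α` being a local flow of the reduced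
system: `(a, b)` acts by the translation by `a` followed by the multiplication by `e^b`. -/
def homothetyAction (α : (Fin 8 → ℝ) × ℝ → Fin 8 → ℝ) (x : (Fin 8 → ℝ) × ℝ × ℝ) : Fin 8 → ℝ :=
  rescale x.2.2 (α (x.1, x.2.1))

/-- The generators of the translations and of the multiplications at the initial conditions `p`. -/
def homothetyGenerators (t : ℝ) (p : Fin 8 → ℝ) : ℝ × ℝ →L[ℝ] Fin 8 → ℝ :=
  (ContinuousLinearMap.fst ℝ ℝ ℝ).smulRight (reducedField t p)
    + (ContinuousLinearMap.snd ℝ ℝ ℝ).smulRight (scalingWeight * p)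

lemma injective_homothetyGenerators (hp : p 4 ≠ 0)
    (h : ∀ μ : ℝ, reducedField t p ≠ μ • (scalingWeight * p)) :
    Function.Injective (homothetyGenerators t p) := by
  refine (injective_iff_map_eq_zero _).2 fun ⟨a, b⟩ hab => ?_
  change a • reducedField t p + b • (scalingWeight * p) = 0 at hab
  have ha : a = 0 := by
    by_contra ha
    refine h (-(a⁻¹ * b)) ?_
    rw [neg_smul, mul_smul, ← smul_neg, eq_inv_smul_iff₀ ha]
    exact eq_neg_of_add_eq_zero_left hab
  rw [ha, zero_smul, zero_add] at hab
  have hb : b = 0 := (smul_eq_zero.1 hab).resolve_right fun hw =>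
    hp ((one_mul _).symm.trans (congrFun hw 4))
  rw [ha, hb, Prod.mk_zero_zero]

/-- The class `P` has, near its metric with initial conditions `p` at `z₀`, a `k`-parameter family
of metrics up to homothety, in the sense of `IsFamilyUpToHomothety`. -/
def HasLocalFamily (k : ℕ) (P : (ℝ → ℝ) → (ℝ → ℝ) → Set ℝ → Prop) (z₀ : ℝ) (p : Fin 8 → ℝ) : Prop :=
  ∃ ε > 0, ∃ V : Set (Fin k → ℝ), IsOpen V ∧
    ∃ F C : (Fin k → ℝ) → ℝ → ℝ,
      (∀ u ∈ V, P (F u) (C u) (Ioo (z₀ - ε) (z₀ + ε))) ∧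
      (∃ u ∈ V, metricData (F u) (C u) z₀ = p) ∧
      ContDiffOn ℝ ∞ (fun u => metricData (F u) (C u) z₀) V ∧
      (∀ u ∈ V, Function.Injective (fderiv ℝ (fun u => metricData (F u) (C u) z₀) u)) ∧
      Topology.IsEmbedding ((V ×ˢ Ioo (-ε) ε ×ˢ Ioo (-ε) ε).domRestrict
        fun x : (Fin k → ℝ) × ℝ × ℝ => homothetyData (F x.1) (C x.1) z₀ x.2.1 x.2.2) ∧
      ∃ U : Set (Fin 8 → ℝ), IsOpen U ∧
        (fun x : (Fin k → ℝ) × ℝ × ℝ => homothetyData (F x.1) (C x.1) z₀ x.2.1 x.2.2) ''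
          (V ×ˢ Ioo (-ε) ε ×ˢ Ioo (-ε) ε) = U ∩ dataSet P z₀

variable {α : (Fin 8 → ℝ) × ℝ → Fin 8 → ℝ} {N : Set (Fin 8 → ℝ)}

lemma hasStrictFDerivAt_homothetyAction (hα₀ : α (p, 0) = p)
    (hα : HasStrictFDerivAt α (ContinuousLinearMap.fst ℝ (Fin 8 → ℝ) ℝ
      + (ContinuousLinearMap.snd ℝ (Fin 8 → ℝ) ℝ).smulRight (reducedField t p)) (p, 0)) :
    HasStrictFDerivAt (homothetyAction α) (ContinuousLinearMap.fst ℝ (Fin 8 → ℝ) (ℝ × ℝ)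
      + (homothetyGenerators t p).comp (ContinuousLinearMap.snd ℝ (Fin 8 → ℝ) (ℝ × ℝ)))
      (p, 0) := by
  let πα := (ContinuousLinearMap.fst ℝ (Fin 8 → ℝ) (ℝ × ℝ)).prod
    ((ContinuousLinearMap.fst ℝ ℝ ℝ).comp (ContinuousLinearMap.snd ℝ (Fin 8 → ℝ) (ℝ × ℝ)))
  let πb := (ContinuousLinearMap.snd ℝ ℝ ℝ).comp (ContinuousLinearMap.snd ℝ (Fin 8 → ℝ) (ℝ × ℝ))
  have hflow : HasStrictFDerivAt (fun x : (Fin 8 → ℝ) × ℝ × ℝ => α (x.1, x.2.1)) _ (p, 0) :=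
    HasStrictFDerivAt.comp (g := α) (f := πα) (p, 0) hα πα.hasStrictFDerivAt
  have hrescale : HasStrictFDerivAt (fun x : (Fin 8 → ℝ) × ℝ => rescale x.2 x.1) _ (α (p, 0), 0) :=
    hα₀.symm ▸ hasStrictFDerivAt_rescale p
  refine (hrescale.comp (f := fun x : (Fin 8 → ℝ) × ℝ × ℝ => (α (x.1, x.2.1), x.2.2)) (p, 0)
    (hflow.prodMk πb.hasStrictFDerivAt)).congr_fderiv (ContinuousLinearMap.ext fun x => ?_)
  simp [homothetyGenerators, πα, πb, add_assoc, hα₀]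

lemma IsIntegralCurveIn.homothetyData_eq (hy : IsIntegralCurveIn (reducedField t) positiveData y
    (Ioo (-δ) δ)) (z₀ b : ℝ) (ha : a ∈ Ioo (-δ) δ) :
    homothetyData (fun z => y (z - z₀) 0) (fun z => y (z - z₀) 4) z₀ a b = rescale b (y a) := by
  have hcurve := hy.comp_sub_const z₀
  have hm := (hcurve.mono positiveData_subset_admissible).solvesReduced.isMetricOn
    fun z hz => (hcurve.mapsTo hz).1
  have hz : z₀ + a ∈ Ioo (z₀ - δ) (z₀ + δ) := by constructor <;> linarith [ha.1, ha.2]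
  rw [hm.homothetyData_eq b hz, hcurve.eqOn_metricData hz]
  simp only [add_sub_cancel_left]

lemma ball_zero_prod_eq (δ : ℝ) : Metric.ball (0 : ℝ × ℝ) δ = Ioo (-δ) δ ×ˢ Ioo (-δ) δ := by
  rw [Prod.zero_eq_mk, ← ball_prod_same, Real.ball_eq_Ioo, zero_sub, zero_add]

variable {k : ℕ} {σ : (Fin k → ℝ) → Fin 8 → ℝ}

lemma isIntegralCurveIn_of_isSlice {H : Type*} {Q : (Fin 8 → ℝ) → H}
    (hα : ∀ q ∈ N, IsIntegralCurveIn (reducedField t) positiveData (fun s => α (q, s))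
      (Ioo (-ε) ε))
    (hσ : IsSlice ∞ (homothetyAction α) (N ×ˢ Ioo (-ε) ε ×ˢ univ) Q p σ δ) {u : Fin k → ℝ}
    (hu : u ∈ Metric.ball 0 δ) :
    IsIntegralCurveIn (reducedField t) positiveData (fun s => α (σ u, s)) (Ioo (-δ) δ) := by
  have hmem {a : ℝ} (ha : a ∈ Ioo (-δ) δ) : σ u ∈ N ∧ a ∈ Ioo (-ε) ε := by
    have h := hσ.mem u hu (a, a) (ball_zero_prod_eq δ ▸ ⟨ha, ha⟩)
    exact ⟨h.1, h.2.1⟩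
  exact ⟨isOpen_Ioo, fun _ ha => (hα _ (hmem ha).1).mapsTo (hmem ha).2,
    fun a ha => (hα _ (hmem ha).1).hasDerivAt a (hmem ha).2⟩

namespace IsLevelClass

lemma apply_homothetyAction (hP : IsLevelClass t Q P) (hα₀ : ∀ q ∈ N, α (q, 0) = q)
    (hα : ∀ q ∈ N, IsIntegralCurveIn (reducedField t) positiveData (fun s => α (q, s))
      (Ioo (-ε) ε)) {x : (Fin 8 → ℝ) × ℝ × ℝ} (hx : x ∈ N ×ˢ Ioo (-ε) ε ×ˢ univ) :
    Q (homothetyAction α x) = Q x.1 := by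
  obtain ⟨hx₁, ha, -⟩ := hx
  have hcurve := hα x.1 hx₁
  have hε : (0 : ℝ) ∈ Ioo (-ε) ε := by constructor <;> linarith [ha.1, ha.2]
  rw [homothetyAction, hP.apply_rescale _ (positiveData_subset_admissible (hcurve.mapsTo ha)),
    hP.apply_eq_apply isPreconnected_Ioo hcurve ha hε, hα₀ x.1 hx₁]

theorem hasLocalFamily_of_isSlice (hP : IsLevelClass t Q P) (hQp : Q p = 0) (z₀ : ℝ)
    (hα₀ : ∀ q ∈ N, α (q, 0) = q)
    (hα : ∀ q ∈ N, IsIntegralCurveIn (reducedField t) positiveData (fun s => α (q, s))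
      (Ioo (-ε) ε))
    (hδ : 0 < δ) (hσ : IsSlice ∞ (homothetyAction α) (N ×ˢ Ioo (-ε) ε ×ˢ univ) Q p σ δ) :
    HasLocalFamily k P z₀ p := by
  have hball := ball_zero_prod_eq δ
  have hσN (u) (hu : u ∈ Metric.ball 0 δ) : σ u ∈ N := (hσ.mem u hu 0 (by simpa using hδ)).1
  have hcurve (u) (hu : u ∈ Metric.ball 0 δ) := isIntegralCurveIn_of_isSlice hα hσ hu
  have hz₀ : z₀ ∈ Ioo (z₀ - δ) (z₀ + δ) := by constructor <;> linarith
  have hdata : EqOn (fun u => metricData (fun z => α (σ u, z - z₀) 0)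
      (fun z => α (σ u, z - z₀) 4) z₀) σ (Metric.ball 0 δ) := fun u hu =>
    (((hcurve u hu).comp_sub_const z₀).eqOn_metricData hz₀).trans
      (by simp only [sub_self, hα₀ _ (hσN u hu)])
  have hhomothety : EqOn (fun x : (Fin k → ℝ) × ℝ × ℝ => homothetyData
      (fun z => α (σ x.1, z - z₀) 0) (fun z => α (σ x.1, z - z₀) 4) z₀ x.2.1 x.2.2)
      (fun x => homothetyAction α (σ x.1, x.2)) (Metric.ball 0 δ ×ˢ Ioo (-δ) δ ×ˢ Ioo (-δ) δ) :=
    fun x hx => (hcurve x.1 hx.1).homothetyData_eq z₀ x.2.2 hx.2.1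
  obtain ⟨O, hO, hOimage⟩ := hσ.exists_image_eq
  have himage : (fun x : (Fin k → ℝ) × ℝ × ℝ => homothetyAction α (σ x.1, x.2)) ''
      (Metric.ball 0 δ ×ˢ Ioo (-δ) δ ×ˢ Ioo (-δ) δ) ⊆ positiveData := by
    rintro _ ⟨x, hx, rfl⟩
    exact rescale_mem_positiveData _ ((hcurve x.1 hx.1).mapsTo hx.2.1)
  refine ⟨δ, hδ, Metric.ball 0 δ, Metric.isOpen_ball, fun u z => α (σ u, z - z₀) 0,
    fun u z => α (σ u, z - z₀) 4, fun u hu => ?_, ?_, hσ.contDiffOn.congr hdata, fun u hu => ?_,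
    ?_, O, hO, ?_⟩
  · refine hP.of_isIntegralCurveIn isPreconnected_Ioo ((hcurve u hu).comp_sub_const z₀) hz₀ ?_
    simp only [sub_self, hα₀ _ (hσN u hu), hσ.apply_eq u hu, hQp]
  · exact ⟨0, by simpa using hδ, (hdata (by simpa using hδ)).trans hσ.map_zero⟩
  · rw [(hdata.eventuallyEq_of_mem (Metric.isOpen_ball.mem_nhds hu)).fderiv_eq]
    exact hσ.injective_fderiv u hu
  · rw [domRestrict_eq_domRestrict_iff.2 hhomothety, ← hball]
    exact hσ.isEmbedding
  · rw [image_congr hhomothety, hP.dataSet_eq]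
    rw [hball, hQp] at hOimage
    refine Subset.antisymm (fun q hq => ?_) fun q hq => ?_
    · exact ⟨(hOimage.subset hq).1, himage hq, (hOimage.subset hq).2⟩
    · exact hOimage.superset ⟨hq.1, hq.2.2⟩

theorem hasLocalFamily [FiniteDimensional ℝ G] (hP : IsLevelClass t Q P)
    (hk : k + finrank ℝ G = 6) (z₀ : ℝ) (hp : p ∈ positiveData) (hQp : Q p = 0)
    (hsurj : Function.Surjective (fderiv ℝ Q p))
    (hL : Function.Injective (homothetyGenerators t p)) : HasLocalFamily k P z₀ p := by
  obtain ⟨α, N, hN, ε, hε, hα₀, hα, hα'⟩ := exists_isLocalFlow_isIntegralCurveIn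
    isOpen_positiveData (contDiffOn_reducedField_positiveData t) hp
  have hα₀p := hα₀ p (mem_of_mem_nhds hN)
  have hfin : finrank ℝ (Fin 8 → ℝ)
      = finrank ℝ (Fin k → ℝ) + finrank ℝ G + finrank ℝ (ℝ × ℝ) := by
    simp only [finrank_fin_fun, finrank_prod, finrank_self]
    omega
  obtain ⟨σ, δ, hδ, hσ⟩ := exists_isSlice (K := Fin k → ℝ) hfin isOpen_admissible hP.contDiffOn
    (by simp) (positiveData_subset_admissible hp) hsurj hL
    (hasStrictFDerivAt_homothetyAction hα₀p hα')
    (by simp only [homothetyAction, Prod.fst_zero, Prod.snd_zero, hα₀p, rescale_zero])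
    (prod_mem_nhds hN (prod_mem_nhds (Ioo_mem_nhds (neg_lt_zero.2 hε) hε) Filter.univ_mem))
    fun x hx => hP.apply_homothetyAction hα₀ hα hx
  exact hP.hasLocalFamily_of_isSlice hQp z₀ hα₀ hα hδ hσ

end IsLevelClass

end Families

/-! ## Regularity of the first integrals -/

section Regularity

variable {t : ℝ} {p : Fin 8 → ℝ}

lemma fderiv_conservedT_single_three (t : ℝ) (hp : p 4 ≠ 0) :
    fderiv ℝ (conservedT t) p (Pi.single 3 1) = 8 * p 1 := by
  simp only [fderiv_conservedT t hp, Pi.single_apply, Fin.reduceEq, reduceIte]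
  ring

lemma fderiv_conservedT_single_two (t : ℝ) (hp : p 4 ≠ 0) (h₁ : p 1 = 0) :
    fderiv ℝ (conservedT t) p (Pi.single 2 1) = -8 * p 2 := by
  simp only [fderiv_conservedT t hp, h₁, Pi.single_apply, Fin.reduceEq, reduceIte]
  ring

lemma fderiv_conservedT_single_seven (t : ℝ) (hp : p 4 ≠ 0) (h₁ : p 1 = 0) :
    fderiv ℝ (conservedT t) p (Pi.single 7 1) = -18 * t * p 0 * p 5 := by
  simp [fderiv_conservedT t hp, h₁, mul_assoc]

lemma fderiv_conservedT_single_five (t : ℝ) (hp : p 4 ≠ 0) (h₁ : p 1 = 0) (h₇ : p 7 = 0) :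
    fderiv ℝ (conservedT t) p (Pi.single 5 1) = -18 * t * p 0 * p 5 * p 6 / p 4 := by
  simp only [fderiv_conservedT t hp, h₁, h₇, Pi.single_apply, Fin.reduceEq, reduceIte]
  ring

lemma fderiv_conservedT_single_zero_or_single_six_ne_zero (ht : t ≠ 0) (hp : p 4 ≠ 0)
    (hT : conservedT t p = 0) (h₁ : p 1 = 0) (h₂ : p 2 = 0) (h₅ : p 5 = 0) :
    fderiv ℝ (conservedT t) p (Pi.single 0 1) ≠ 0
      ∨ fderiv ℝ (conservedT t) p (Pi.single 6 1) ≠ 0 := by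
  have hsingle₀ : fderiv ℝ (conservedT t) p (Pi.single 0 1)
      = 32 * (p 0 - 1) - 3 * t * (p 4 * p 6) := by
    simp only [fderiv_conservedT t hp, h₁, h₂, h₅, Pi.single_apply, Fin.reduceEq, reduceIte]
    field_simp
    ring
  have hsingle₆ : fderiv ℝ (conservedT t) p (Pi.single 6 1)
      = -(3 / 2) * t * p 4 * (p 4 * p 6 - (8 - 2 * p 0)) := by
    simp only [fderiv_conservedT t hp, h₁, h₂, h₅, Pi.single_apply, Fin.reduceEq, reduceIte]
    field_simp
    ring
  have hT_eq : conservedT t p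
      = 16 * (p 0 - 1) ^ 2 - 3 / 4 * t * (p 4 * p 6) * (-16 + 4 * p 0 + p 4 * p 6) := by
    simp only [conservedT, h₁, h₂, h₅]
    field_simp
    ring
  by_contra! h
  have hCs : p 4 * p 6 = 8 - 2 * p 0 :=
    sub_eq_zero.1 ((mul_eq_zero.1 (hsingle₆.symm.trans h.2)).resolve_left
      (mul_ne_zero (mul_ne_zero (by norm_num) ht) hp))
  have hlinear : 16 * (p 0 - 1) = 3 * t * (4 - p 0) := by
    linear_combination (hsingle₀.symm.trans h.1) / 2 + 3 / 2 * t * hCs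
  have hquadratic : 16 * (p 0 - 1) ^ 2 + 3 * t * (4 - p 0) ^ 2 = 0 := by
    linear_combination hT_eq.symm.trans hT + 3 / 4 * t * (p 4 * p 6 + 2 * p 0 - 8) * hCs
  have hF : 4 - p 0 = 0 := (mul_eq_zero.1 (show t * (4 - p 0) = 0 by
    linear_combination hquadratic / 9 - (p 0 - 1) / 9 * hlinear)).resolve_left ht
  rw [hF, mul_zero] at hlinear
  linarith

lemma exists_fderiv_conservedT_ne_zero (ht : t ≠ 0) (hp : p ∈ admissible)
    (hT : conservedT t p = 0) : ∃ v, fderiv ℝ (conservedT t) p v ≠ 0 := by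
  by_contra! h
  have hp₄ := hp.2.ne'
  have h₁ : p 1 = 0 := by linarith [fderiv_conservedT_single_three t hp₄, h (Pi.single 3 1)]
  have h₂ : p 2 = 0 := by linarith [fderiv_conservedT_single_two t hp₄ h₁, h (Pi.single 2 1)]
  have h₅ : p 5 = 0 := by
    simpa [ht, hp.1] using (fderiv_conservedT_single_seven t hp₄ h₁).symm.trans (h _)
  exact (fderiv_conservedT_single_zero_or_single_six_ne_zero ht hp₄ hT h₁ h₂ h₅).elim
    (absurd (h _)) (absurd (h _))

/-- The critical points in question are the initial conditions of flat metrics. -/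
lemma reducedField_eq_smul_of_fderiv_conservedT_eq_zero (ht : t ≠ 0) (hp : p 4 ≠ 0)
    (hT : conservedT t p = 0) (h₁ : p 1 = 0) (h₂ : p 2 = 0) (h₆ : p 6 = 0) (h₇ : p 7 = 0)
    (hd₁ : fderiv ℝ (conservedT t) p (Pi.single 1 1) = 0)
    (hd₆ : fderiv ℝ (conservedT t) p (Pi.single 6 1) = 0) :
    reducedField t p = (p 5 / p 4) • (scalingWeight * p) := by
  have h₀ : p 0 = 1 := by
    simpa [conservedT, h₁, h₂, h₆, h₇, sub_eq_zero] using hT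
  have h₃ : p 3 = 0 := by
    simpa [fderiv_conservedT t hp, h₀, h₁, h₂, h₆, h₇] using hd₁
  have hC : p 5 ^ 2 = p 4 ^ 2 := by
    have hd₆_eq : fderiv ℝ (conservedT t) p (Pi.single 6 1)
        = -(9 * t) / p 4 * (p 5 ^ 2 - p 4 ^ 2) := by
      simp only [fderiv_conservedT t hp, h₀, h₁, h₂, h₆, h₇, Pi.single_apply, Fin.reduceEq,
        reduceIte]
      field_simp
      ring
    exact sub_eq_zero.1 ((mul_eq_zero.1 (hd₆_eq.symm.trans hd₆)).resolve_left (by simp [ht, hp]))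
  have hC'' : secondDerivC p = p 5 / p 4 * p 5 := by
    simp only [secondDerivC, h₀, h₁, h₂, h₆]
    field_simp
    linarith
  ext i
  fin_cases i <;>
    simp [reducedField, scalingWeight, hC'', fourthDerivF, secondDerivS, h₀, h₁, h₂, h₃, h₆, h₇, hp]

lemma exists_fderiv_conservedT_ne_zero_of_scalFlux_eq_zero (ht : t ≠ 0) (hp : p ∈ admissible)
    (hT : conservedT t p = 0) (h₇ : p 7 = 0)
    (hp' : reducedField t p ≠ (p 5 / p 4) • (scalingWeight * p)) :
    ∃ v : Fin 8 → ℝ, v 7 = 0 ∧ fderiv ℝ (conservedT t) p v ≠ 0 := by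
  by_contra! h
  have hp₄ := hp.2.ne'
  have hd {i : Fin 8} (hi : i ≠ 7) : fderiv ℝ (conservedT t) p (Pi.single i 1) = 0 :=
    h _ (Pi.single_eq_of_ne hi.symm 1)
  have h₁ : p 1 = 0 := by
    linarith [fderiv_conservedT_single_three t hp₄, hd (i := 3) (by decide)]
  have h₂ : p 2 = 0 := by
    linarith [fderiv_conservedT_single_two t hp₄ h₁, hd (i := 2) (by decide)]
  have h₅₆ : p 5 = 0 ∨ p 6 = 0 := by
    simpa [ht, hp.1, hp₄] using
      (fderiv_conservedT_single_five t hp₄ h₁ h₇).symm.trans (hd (by decide))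
  rcases h₅₆ with h₅ | h₆
  · exact (fderiv_conservedT_single_zero_or_single_six_ne_zero ht hp₄ hT h₁ h₂ h₅).elim
      (absurd (hd (by decide))) (absurd (hd (by decide)))
  · exact hp' (reducedField_eq_smul_of_fderiv_conservedT_eq_zero ht hp₄ hT h₁ h₂ h₆ h₇
      (hd (by decide)) (hd (by decide)))

theorem surjective_fderiv_conservedT (ht : t ≠ 0) (hp : p ∈ admissible)
    (hT : conservedT t p = 0) : Function.Surjective (fderiv ℝ (conservedT t) p) := by
  obtain ⟨v, hv⟩ := exists_fderiv_conservedT_ne_zero ht hp hT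
  exact fun x => ⟨(x / fderiv ℝ (conservedT t) p v) • v, by simp [hv]⟩

theorem surjective_fderiv_conservedT_scalFlux (ht : t ≠ 0) (hp : p ∈ admissible)
    (hT : conservedT t p = 0) (hs : scalFlux p = 0)
    (hp' : reducedField t p ≠ (p 5 / p 4) • (scalingWeight * p)) :
    Function.Surjective (fderiv ℝ (fun p => (conservedT t p, scalFlux p)) p) := by
  have hCF : p 4 * p 0 ≠ 0 := mul_ne_zero hp.2.ne' hp.1
  have h₇ : p 7 = 0 := (mul_eq_zero.1 hs).resolve_left hCF
  obtain ⟨v, hv₇, hv⟩ := exists_fderiv_conservedT_ne_zero_of_scalFlux_eq_zero ht hp hT h₇ hp'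
  rw [DifferentiableAt.fderiv_prodMk
    ((contDiffAt_conservedT t hp.2.ne').differentiableAt (by simp))
    (contDiff_scalFlux.contDiffAt.differentiableAt (by simp))]
  rintro ⟨x, y⟩
  set w : Fin 8 → ℝ := (y / (p 4 * p 0)) • Pi.single 7 1 with hw
  refine ⟨((x - fderiv ℝ (conservedT t) p w) / fderiv ℝ (conservedT t) p v) • v + w,
    Prod.ext ?_ ?_⟩
  · simp [hv]
  · simp [fderiv_scalFlux, h₇, hv₇, hw, hp.1, hp.2.ne', mul_div_cancel₀]

end Regularity

/-! ## Submanifolds of initial conditions -/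

section Submanifolds

open Module

variable {G : Type*} [NormedAddCommGroup G] [NormedSpace ℝ G] [FiniteDimensional ℝ G]
  {t : ℝ} {d e : ℕ} {U : Set (Fin 8 → ℝ)}

theorem isSubmanifold_levelSet {Q : (Fin 8 → ℝ) → G} (hd : 8 = d + finrank ℝ G)
    (hG : finrank ℝ G = e) (hU : IsOpen U) (hQ : ContDiffOn ℝ ∞ Q U)
    (hsurj : ∀ p ∈ U, Q p = 0 → Function.Surjective (fderiv ℝ Q p)) :
    IsSubmanifold d e {p ∈ U | Q p = 0} := by
  rintro p ⟨hp, hQp⟩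
  have L : G ≃L[ℝ] (Fin e → ℝ) := .ofFinrankEq (by rw [hG, finrank_fin_fun])
  have hfderiv : fderiv ℝ (L ∘ Q) p = (L : G →L[ℝ] Fin e → ℝ).comp (fderiv ℝ Q p) :=
    L.comp_fderiv
  obtain ⟨φ, hpφ, hφU, hφ, hφ', hφQ⟩ := exists_chart_of_surjective_fderiv (n := ∞)
    (K := Fin d → ℝ) (by rw [finrank_fin_fun, finrank_fin_fun, finrank_fin_fun, ← hG, hd]) hU
    (L.contDiff.comp_contDiffOn hQ) (by simp) hp
    (hfderiv ▸ L.surjective.comp (hsurj p hp hQp))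
  refine ⟨φ, hpφ, hφ, hφ', fun q hq => ?_⟩
  rw [hφQ q hq, Function.comp_apply, L.map_eq_zero_iff]
  exact and_iff_right (hφU hq)

theorem isSubmanifold_reducedDataSet (ht : t ≠ 0) (z₀ : ℝ) :
    IsSubmanifold 7 1 (reducedDataSet t z₀) :=
  reducedDataSet_eq t z₀ ▸ isSubmanifold_levelSet (by simp) (finrank_self ℝ) isOpen_admissible
    (isLevelClass_isBtFlat ht).contDiffOn fun _ => surjective_fderiv_conservedT ht

theorem isSubmanifold_dataSet_isBtFlat (ht : t ≠ 0) (z₀ : ℝ) :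
    IsSubmanifold 7 1 (dataSet (IsBtFlat t) z₀) :=
  (isLevelClass_isBtFlat ht).dataSet_eq z₀ ▸ isSubmanifold_levelSet (by simp) (finrank_self ℝ)
    isOpen_positiveData ((isLevelClass_isBtFlat ht).contDiffOn.mono positiveData_subset_admissible)
    fun _ hp => surjective_fderiv_conservedT ht (positiveData_subset_admissible hp)

end Submanifolds

/-! ## Parameter counts -/

section ParameterCounts

open Module

variable {G : Type*} [NormedAddCommGroup G] [NormedSpace ℝ G] {t z z₀ : ℝ} {F C : ℝ → ℝ}
  {I : Set ℝ} {Q : (Fin 8 → ℝ) → G} {P : (ℝ → ℝ) → (ℝ → ℝ) → Set ℝ → Prop}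

lemma SelfHomothetic.metricData_eq_zero (h : SelfHomothetic F C I) (hI : IsOpen I) (hz : z ∈ I) :
    metricData F C z 1 = 0 ∧ metricData F C z 3 = 0 := by
  obtain ⟨c, C₀, μ, h⟩ := h
  have hF' : EqOn (deriv F) (fun _ => 0) I := fun x hx =>
    (EqOn.deriv (g := fun _ => c) (fun y hy => (h y hy).1) hI hx).trans (deriv_const x c)
  have hF'' : EqOn (deriv (deriv F)) (fun _ => 0) I := fun x hx =>
    (hF'.deriv hI hx).trans (deriv_const x 0)
  exact ⟨hF' hz, (hF''.deriv hI hz).trans (deriv_const z 0)⟩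

/-- Self-homothetic metrics have `F' = F''' = 0`, hence become regular when `F'''` is varied. -/
theorem dataSet_subset_closure_regularDataSet
    (h : ∀ p ∈ dataSet P z₀, p 1 = 0 → ∀ x, Function.update p 3 x ∈ dataSet P z₀) :
    dataSet P z₀ ⊆ closure (regularDataSet P z₀) := by
  intro p hp
  by_cases hreg : p ∈ regularDataSet P z₀
  · exact subset_closure hreg
  have hz₀ {ε : ℝ} (hε : 0 < ε) : z₀ ∈ Ioo (z₀ - ε) (z₀ + ε) := by constructor <;> linarith
  have ⟨ε, hε, F, C, hP, hFC⟩ := hp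
  have hself : SelfHomothetic F C (Ioo (z₀ - ε) (z₀ + ε)) :=
    not_not.1 fun hself => hreg ⟨ε, hε, F, C, hP, hFC, hself⟩
  have hp₁₃ := hself.metricData_eq_zero isOpen_Ioo (hz₀ hε)
  rw [hFC] at hp₁₃
  have hupdate (x : ℝ) (hx : x ∈ ({0}ᶜ : Set ℝ)) :
      Function.update p 3 x ∈ regularDataSet P z₀ := by
    obtain ⟨ε, hε, F, C, hP, hFC⟩ := h p hp hp₁₃.1 x
    refine ⟨ε, hε, F, C, hP, hFC, fun hself => hx ?_⟩
    simpa [hFC] using (hself.metricData_eq_zero isOpen_Ioo (hz₀ hε)).2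
  have hcont : Continuous fun x : ℝ => Function.update p 3 x := by fun_prop
  have hlimit := map_mem_closure hcont (dense_compl_singleton (0 : ℝ) 0) hupdate
  rwa [← hp₁₃.2, Function.update_eq_self] at hlimit

theorem IsLevelClass.isFamilyUpToHomothety [FiniteDimensional ℝ G] {k : ℕ}
    (hP : IsLevelClass t Q P) (hk : k + finrank ℝ G = 6) (z₀ : ℝ)
    (hne : ∃ p ∈ positiveData, Q p = 0)
    (hupdate : ∀ p, p 1 = 0 → ∀ x, Q (Function.update p 3 x) = Q p)
    (hsurj : ∀ p ∈ admissible, Q p = 0 → (∀ μ : ℝ, reducedField t p ≠ μ • (scalingWeight * p)) →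
      Function.Surjective (fderiv ℝ Q p)) : IsFamilyUpToHomothety k P z₀ := by
  refine ⟨hP.dataSet_eq z₀ ▸ hne, dataSet_subset_closure_regularDataSet ?_, ?_⟩
  · rw [hP.dataSet_eq]
    exact fun p hp hp₁ x => ⟨by simpa [positiveData] using hp.1, (hupdate p hp₁ x).trans hp.2⟩
  · rintro _ ⟨ε, hε, F, C, hFC, rfl, hself⟩
    have hz₀ : z₀ ∈ Ioo (z₀ - ε) (z₀ + ε) := by constructor <;> linarith
    have hcurve := hP.isIntegralCurveIn isPreconnected_Ioo hFC
    have hp := hcurve.mapsTo hz₀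
    have hregular (μ : ℝ) : reducedField t (metricData F C z₀) ≠ μ • (scalingWeight * _) :=
      fun h => hself (hcurve.selfHomothetic isPreconnected_Ioo hz₀ h)
    have hQ := hP.apply_metricData isPreconnected_Ioo hFC hz₀
    exact hP.hasLocalFamily hk z₀ hp hQ
      (hsurj _ (positiveData_subset_admissible hp) hQ hregular)
      (injective_homothetyGenerators hp.2.ne' hregular)

lemma exists_conservedT_eq_zero_and_scalFlux_eq_zero (t : ℝ) :
    ∃ p ∈ positiveData, conservedT t p = 0 ∧ scalFlux p = 0 :=
  ⟨![1, 0, 0, 0, 1, 0, 0, 0], by simp [positiveData], by simp [conservedT], by simp [scalFlux]⟩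

lemma conservedT_update_three {p : Fin 8 → ℝ} (t : ℝ) (hp : p 1 = 0) (x : ℝ) :
    conservedT t (Function.update p 3 x) = conservedT t p := by
  simp [conservedT, hp]

lemma scalFlux_update_three (p : Fin 8 → ℝ) (x : ℝ) :
    scalFlux (Function.update p 3 x) = scalFlux p := by
  simp [scalFlux]

theorem isFamilyUpToHomothety_isBtFlat (ht : t ≠ 0) (z₀ : ℝ) :
    IsFamilyUpToHomothety 5 (IsBtFlat t) z₀ :=
  have ⟨p, hp, hT, _⟩ := exists_conservedT_eq_zero_and_scalFlux_eq_zero t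
  (isLevelClass_isBtFlat ht).isFamilyUpToHomothety (by simp) z₀ ⟨p, hp, hT⟩
    (fun _ => conservedT_update_three t) fun _ hp hT _ => surjective_fderiv_conservedT ht hp hT

theorem isFamilyUpToHomothety_isCSCBtFlat (ht : t ≠ 0) (z₀ : ℝ) :
    IsFamilyUpToHomothety 4 (IsCSCBtFlat t) z₀ :=
  have ⟨p, hp, hT, hs⟩ := exists_conservedT_eq_zero_and_scalFlux_eq_zero t
  (isLevelClass_isCSCBtFlat ht).isFamilyUpToHomothety (by simp) z₀ ⟨p, hp, Prod.ext hT hs⟩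
    (fun p hp x => Prod.ext (conservedT_update_three t hp x) (scalFlux_update_three p x))
    fun p hp hQ h => surjective_fderiv_conservedT_scalFlux ht hp (congrArg Prod.fst hQ)
      (congrArg Prod.snd hQ) (h (p 5 / p 4))

end ParameterCounts

/-! ## Conformally extremal metrics -/

namespace IsExtremalKahler

variable {ε z : ℝ} {F K : ℝ → ℝ} {I : Set ℝ}

lemma isMetricOn (h : IsExtremalKahler ε F K I) : IsMetricOn F K I := h.1

lemma logDeriv_eq (h : IsExtremalKahler ε F K I) (hz : z ∈ I) : logDeriv K z = -ε := by
  have hF := (h.isMetricOn.F_pos hz).ne'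
  have hK := (h.isMetricOn.C_pos hz).ne'
  have hparallel := h.2.1 z hz 2 0 3
  simp [covDeriv2, D, h.isMetricOn.conn_eq hz, Fin.sum_univ_four, connCoeff, kForm, cxStr, g,
    gDiag] at hparallel
  field_simp at hparallel
  have hfactor : K z * (logDeriv K z + ε) = 0 := by linarith
  exact eq_neg_of_add_eq_zero_left ((mul_eq_zero_iff_left hK).1 hfactor)

lemma hasDerivAt_factor (h : IsExtremalKahler ε F K I) (hz : z ∈ I) :
    HasDerivAt K (-ε * K z) z := by
  have hK := (h.isMetricOn.C_pos hz).ne'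
  have hlog := h.logDeriv_eq hz
  rw [logDeriv_apply, div_eq_iff hK] at hlog
  exact hlog ▸ hasDerivAt_of_contDiffAt (h.isMetricOn.contDiffAt_C hz)

lemma hasDerivAt_div_factor (h : IsExtremalKahler ε F K I) (hz : z ∈ I) {w : ℝ → ℝ} {w' : ℝ}
    (hw : HasDerivAt w w' z) : HasDerivAt (fun x => w x / K x) ((w' + ε * w z) / K z) z := by
  have hK := (h.isMetricOn.C_pos hz).ne'
  refine (hw.div (h.hasDerivAt_factor hz) hK).congr_deriv ?_
  field_simp
  ring

lemma scal_eq (h : IsExtremalKahler ε F K I) (hε : ε ^ 2 = 1) (hz : z ∈ I) :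
    scal F K z = (8 - 8 * F z - 4 * deriv (deriv F) z + 12 * ε * deriv F z) / K z := by
  have hlog' : deriv (logDeriv K) z = 0 :=
    (EqOn.deriv (fun _ => h.logDeriv_eq) h.isMetricOn.1 hz).trans (deriv_const z (-ε))
  rw [h.isMetricOn.scal_eq hz, h.logDeriv_eq hz, hlog']
  congr 1
  linear_combination -6 * F z * hε

lemma jGradScal_one (h : IsExtremalKahler ε F K I) (hz : z ∈ I) :
    jGradScal ε F K 1 z = 2 * ε * (F z * deriv (scal F K) z) := by
  have hF := (h.isMetricOn.F_pos hz).ne'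
  have hK := (h.isMetricOn.C_pos hz).ne'
  simp [jGradScal, D, kForm, cxStr, g, gInv, gDiag]
  field_simp
  ring

lemma deriv_deriv_scal (h : IsExtremalKahler ε F K I) (hε : ε ≠ 0) (hz : z ∈ I) :
    deriv (deriv (scal F K)) z = -ε * deriv (scal F K) z := by
  have hm := h.isMetricOn
  have hF := (hm.F_pos hz).ne'
  have hderiv : deriv (jGradScal ε F K 1) z =
      2 * ε * (deriv F z * deriv (scal F K) z + F z * deriv (deriv (scal F K)) z) :=
    (EqOn.deriv (fun _ => h.jGradScal_one) hm.1 hz).trans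
      (((hasDerivAt_of_contDiffAt (hm.contDiffAt_F hz)).mul
        (hasDerivAt_of_contDiffAt (contDiffAt_deriv (hm.contDiffAt_scal hz)))).const_mul _).deriv
  have hKilling := h.2.2 z hz 0 1
  simp only [covDeriv1, hm.conn_eq hz, Fin.sum_univ_four, D, hderiv] at hKilling
  simp [connCoeff, h.jGradScal_one hz, h.logDeriv_eq hz] at hKilling
  field_simp at hKilling
  have hfactor : 2 * ε * F z * (deriv (deriv (scal F K)) z + ε * deriv (scal F K) z) = 0 := by
    linarith
  rw [mul_eq_zero_iff_left (by simp [hε, hF])] at hfactor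
  linarith

lemma deriv_scal (h : IsExtremalKahler ε F K I) (hε : ε ^ 2 = 1) (hz : z ∈ I) :
    deriv (scal F K) z = ((-8 * deriv F z - 4 * deriv (deriv (deriv F)) z
      + 12 * ε * deriv (deriv F) z) + ε * (8 - 8 * F z - 4 * deriv (deriv F) z
      + 12 * ε * deriv F z)) / K z := by
  have hF := h.isMetricOn.contDiffAt_F hz
  have hF' := contDiffAt_deriv hF
  have hnum := ((((hasDerivAt_of_contDiffAt hF).const_mul 8).const_sub 8).sub
    ((hasDerivAt_of_contDiffAt (contDiffAt_deriv hF')).const_mul 4)).add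
    ((hasDerivAt_of_contDiffAt hF').const_mul (12 * ε))
  refine (EqOn.deriv (fun _ => h.scal_eq hε) h.isMetricOn.1 hz).trans
    ((h.hasDerivAt_div_factor hz hnum).deriv.trans ?_)
  simp only [Pi.add_apply, Pi.sub_apply, neg_mul]

theorem Lplus_Lminus_eq_one (h : IsExtremalKahler ε F K I) (hε : ε ^ 2 = 1) (hz : z ∈ I) :
    Lplus (Lminus F) z = 1 := by
  have hm := h.isMetricOn
  have hK := (hm.C_pos hz).ne'
  have hF := hm.contDiffAt_F hz
  have hF' := contDiffAt_deriv hF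
  have hF'' := contDiffAt_deriv hF'
  have d₀ := hasDerivAt_of_contDiffAt hF
  have d₁ := hasDerivAt_of_contDiffAt hF'
  have d₂ := hasDerivAt_of_contDiffAt hF''
  have d₃ := hasDerivAt_of_contDiffAt (contDiffAt_deriv hF'')
  have hnum := (((d₁.const_mul (-8)).sub (d₃.const_mul 4)).add (d₂.const_mul (12 * ε))).add
    (((((d₀.const_mul 8).const_sub 8).sub (d₂.const_mul 4)).add
      (d₁.const_mul (12 * ε))).const_mul ε)
  have hode := h.deriv_deriv_scal (by rintro rfl; norm_num at hε) hz
  rw [(EqOn.deriv (fun _ => h.deriv_scal hε) hm.1 hz).trans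
    (h.hasDerivAt_div_factor hz hnum).deriv, h.deriv_scal hε hz] at hode
  simp only [Pi.add_apply, Pi.sub_apply] at hode
  field_simp at hode
  rw [Lplus_Lminus hF]
  obtain rfl | rfl := sq_eq_one_iff.1 hε <;> linarith

end IsExtremalKahler

lemma IsConformallyExtremal.Lplus_Lminus_eq_one {F : ℝ → ℝ} {I : Set ℝ} {z : ℝ}
    (h : IsConformallyExtremal F I) (hz : z ∈ I) : Lplus (Lminus F) z = 1 := by
  obtain ⟨K, h | h⟩ := h
  · exact h.Lplus_Lminus_eq_one (by norm_num) hz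
  · exact h.Lplus_Lminus_eq_one (by norm_num) hz

theorem exists_isCSCBtFlat_not_isConformallyExtremal {t : ℝ} (ht : t ≠ 0) :
    ∃ (a b : ℝ) (F C : ℝ → ℝ), a < b ∧ IsCSCBtFlat t F C (Ioo a b) ∧
      ¬ IsConformallyExtremal F (Ioo a b) := by
  -- `F = 1`, `F'' = 0` and `s' = 0`, so that `L⁺ L⁻ F = 1` amounts to `F'''' = 0`; the value of
  -- `F'''` is the one for which `T = 0`.
  let p : Fin 8 → ℝ := ![1, 1, 0, 5 / 2 - 33 / 32 * t, 1, 0, 1, 0]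
  have hp : p ∈ dataSet (IsCSCBtFlat t) 0 := by
    rw [(isLevelClass_isCSCBtFlat ht).dataSet_eq]
    refine ⟨by simp [p, positiveData], Prod.ext ?_ ?_⟩
    · simp [p, conservedT]
      ring
    · simp [p, scalFlux]
  obtain ⟨ε, hε, F, C, h, hFC⟩ := hp
  have h₀ : (0 : ℝ) ∈ Ioo (0 - ε) (0 + ε) := by constructor <;> linarith
  refine ⟨0 - ε, 0 + ε, F, C, h₀.1.trans h₀.2, h, fun hextremal => ht ?_⟩
  have hsol := ((isBtFlat_iff_solvesReduced ht).1 h.1).2.1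
  have hF'''' : deriv (deriv (deriv (deriv F))) 0 = fourthDerivF t p := hFC ▸
    ((reduced_iff_highestDerivs_eq (hsol.contDiffAt_F h₀) (hsol.contDiffAt_C h₀)
      (hsol.contDiffAt_s h₀) (hsol.ne_zero_and_pos h₀).1 (hsol.ne_zero_and_pos h₀).2).1
      (hsol.equations h₀)).1
  have hL := hextremal.Lplus_Lminus_eq_one h₀
  rw [Lplus_Lminus (hsol.contDiffAt_F h₀), hF'''', show F 0 = 1 from congrFun hFC 0,
    show deriv (deriv F) 0 = 0 from congrFun hFC 2] at hL
  simp only [fourthDerivF, secondDerivC, p, Matrix.cons_val] at hL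
  linarith

end U2

end

theorem mainTheorem2 (t : ℝ) :
    -- the reduced system is critically determined where `F ≠ 0`, `C > 0`:
    -- it can be solved for the highest derivatives of the three unknowns
    (∃ Φ : (Fin 8 → ℝ) → (Fin 3 → ℝ), ContDiffOn ℝ ∞ Φ U2.admissible ∧
      ∀ (F C s : ℝ → ℝ) (z : ℝ), ContDiffAt ℝ ∞ F z → ContDiffAt ℝ ∞ C z → ContDiffAt ℝ ∞ s z →
        F z ≠ 0 → 0 < C z →
        ((U2.opE F C s z = 0 ∧ U2.opF1 F C s z = 0 ∧ U2.opF2 t F C s z = 0) ↔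
          ![iteratedDeriv 4 F z, iteratedDeriv 2 C z, iteratedDeriv 2 s z]
            = Φ (U2.cauchyData F C s z))) ∧
    -- and eight initial conditions determine a unique solution
    (∀ z₀ : ℝ, ∀ p ∈ U2.admissible, ∃ ε > 0, ∃ F C s : ℝ → ℝ,
      U2.SolvesReduced t F C s (Ioo (z₀ - ε) (z₀ + ε)) ∧ U2.cauchyData F C s z₀ = p) ∧
    (∀ (I : Set ℝ) (z₀ : ℝ) (F C s F' C' s' : ℝ → ℝ), IsPreconnected I → z₀ ∈ I →
      U2.SolvesReduced t F C s I → U2.SolvesReduced t F' C' s' I →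
      U2.cauchyData F C s z₀ = U2.cauchyData F' C' s' z₀ →
      EqOn F F' I ∧ EqOn C C' I ∧ EqOn s s' I) ∧
    -- `T` is a constant of the motion
    (∀ (I : Set ℝ) (F C s : ℝ → ℝ), IsPreconnected I → U2.SolvesReduced t F C s I →
      ∀ z ∈ I, ∀ w ∈ I, U2.opT t F C s z = U2.opT t F C s w) ∧
    (t ≠ 0 →
      -- the reduced system with `T = 0` is the system of the `B^t`-flat metrics
      (∀ (I : Set ℝ) (F C s : ℝ → ℝ), (∀ z ∈ I, 0 < F z) →
        ((U2.SolvesReduced t F C s I ∧ ∀ z ∈ I, U2.opT t F C s z = 0) ↔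
          (U2.IsBtFlat t F C I ∧ EqOn s (U2.scal F C) I))) ∧
      -- the solutions with `T = 0`, and the `B^t`-flat metrics, form 7-parameter families
      (∀ z₀ : ℝ,
        (U2.reducedDataSet t z₀).Nonempty ∧ U2.IsSubmanifold 7 1 (U2.reducedDataSet t z₀) ∧
        (U2.dataSet (U2.IsBtFlat t) z₀).Nonempty ∧
        U2.IsSubmanifold 7 1 (U2.dataSet (U2.IsBtFlat t) z₀)) ∧
      -- up to homothety, 5 parameters remain, and 4 for constant scalar curvature
      (∀ z₀ : ℝ, U2.IsFamilyUpToHomothety 5 (U2.IsBtFlat t) z₀ ∧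
        U2.IsFamilyUpToHomothety 4 (U2.IsCSCBtFlat t) z₀) ∧
      -- some metrics of constant scalar curvature are not conformal to an extremal metric
      (∃ (a b : ℝ) (F C : ℝ → ℝ), a < b ∧ U2.IsCSCBtFlat t F C (Ioo a b) ∧
        ¬ U2.IsConformallyExtremal F (Ioo a b))) := by
  refine ⟨U2.exists_highest_derivatives t, fun z₀ p hp => U2.exists_solvesReduced t z₀ hp,
    fun I z₀ F C s F' C' s' hI hz₀ h h' heq => h.eqOn h' hI hz₀ heq,
    fun I F C s hI h z hz w hw => h.opT_eq hI hz hw,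
    fun ht => ⟨fun I F C s hF => U2.solvesReduced_iff_isBtFlat ht hF,
      fun z₀ => ⟨?_, U2.isSubmanifold_reducedDataSet ht z₀,
        (U2.isFamilyUpToHomothety_isBtFlat ht z₀).1, U2.isSubmanifold_dataSet_isBtFlat ht z₀⟩,
      fun z₀ => ⟨U2.isFamilyUpToHomothety_isBtFlat ht z₀,
        U2.isFamilyUpToHomothety_isCSCBtFlat ht z₀⟩,
      U2.exists_isCSCBtFlat_not_isConformallyExtremal ht⟩⟩
  obtain ⟨p, hp, hT, -⟩ := U2.exists_conservedT_eq_zero_and_scalFlux_eq_zero t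
  rw [U2.reducedDataSet_eq]
  exact ⟨p, U2.positiveData_subset_admissible hp, hT⟩
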